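/- **Theorem (stable phase diagram of the three-state mean-field Potts model in a vector field).** Let $\Delta^2=\{\nu\in\mathbb R^3:\nu_i\ge 0,\ \nu_1+\nu_2+\nu_3=1\}$. For $\beta>0$ and a field $\alpha$ in the open simplex ($\alpha_i>0$, $\alpha_1+\alpha_2+\alpha_3=1$) let $$f_{\beta,\alpha}(\nu)=-\tfrac12\beta\langle\nu,\nu\rangle+\sum_{i=1}^3\nu_i\log\frac{\nu_i}{\alpha_i},\qquad \nu\in\Delta^2\quad(0\log 0=0).$$ Minimizers are minimizers on $\Delta^2$. On fields use the coordinates $x=\frac{\sqrt3}{2}(\alpha_1-\alpha_2)$, $y=\frac12(3\alpha_3-1)$, and also $u=\log\frac{\alpha_1}{\alpha_3}$, $v=\log\frac{\alpha_2}{\alpha_3}$. The permutation group $S_3$ acts on fields by permuting components. Let $C=\{\nu_1\le\nu_2\le\nu_3\}$ be the closed fundamental cell. 1. If $0<\beta\le 2$, then $f_{\beta,\alpha}$ has a unique global minimizer for every $\alpha$. 2. If $2<\beta\le\frac{18}{7}$, then $f_{\beta,\alpha}$ has exactly two global minimizers if, in $(x,y)$-coordinates, $\alpha$ lies in the segment $$\{0\}\times\Big(-\tfrac12,\,-\frac{1-(\beta-2)e^{3-\beta}}{2+(\beta-2)e^{3-\beta}}\Big)$$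 or in one of its images under $S_3$; for every other $\alpha$ the global minimizer is unique. 3. If $\frac{18}{7}<\beta<4\log 2$, there is a field $\tau$ (the triple point) with $(x,y)$-coordinates $(0,y_{\mathrm{triple}}(\beta))$, $y_{\mathrm{triple}}(\beta)<0$, for which the following holds. Let $(u_0,v_0)$ be the $(u,v)$-coordinates of the image $(\tau_3,\tau_2,\tau_1)\in C$ of $\tau$. Consider the initial value problem $$\frac{dv}{du}=-\frac{\nu_1-\mu_1}{\nu_2-\mu_2},\qquad v(u_0)=v_0,$$ for real functions $v$ on intervals with least element $u_0$, such that for each $u$ in the interval the field $\alpha$ with $(u,v)$-coordinates $(u,v(u))$ lies in $C$ and $f_{\beta,\alpha}$ has exactly two local minimizers in $C$; these are $\nu,\mu$, and $\nu_2\ne\mu_2$ (at endpoints of the interval the derivative is one-sided). This problem has a maximal solution on a nondegenerate interval $I$, of which every solution is a restriction. The function $f_{\beta,\alpha}$ has - exactly three global minimizers if $\alpha$ is a triple point, that is, $\tau$ or one of its images under $S_3$; - exactly two global minimizers if $\alpha$ lies in the segment $\{0\}\times(-\frac12,y_{\mathrm{triple}}(\beta))$ in $(x,y)$-coordinates, or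 on the curve $\{(u,v(u)):u\in I,\ u\ne u_0\}$ in $(u,v)$-coordinates given by the maximal solution, or in one of their images under $S_3$; - a unique global minimizer for every other $\alpha$. 4. If $\beta\ge 4\log 2$, then $f_{\beta,\alpha}$ has exactly two global minimizers if $\alpha$ lies in the segment $\{0\}\times(-\frac12,0)$ in $(x,y)$-coordinates or in one of its images under $S_3$. For $\alpha=(\frac13,\frac13,\frac13)$ it has exactly four global minimizers if $\beta=4\log 2$ and exactly three if $\beta>4\log 2$. For every other $\alpha$ the global minimizer is unique. -/

import Mathlib

namespace PottsField

/-- The a-priori measures on three states for which the free energy is real valued: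
probability vectors with positive entries. -/
def fields : Set (Fin 3 → ℝ) :=
  {α | (∀ i, 0 < α i) ∧ ∑ i, α i = 1}

/-- The free energy (rate function) `f_{β,α}` of the three-state mean-field Potts model.
The convention `0 log 0 = 0` holds because `0 * x = 0`. -/
noncomputable def freeEnergy (β : ℝ) (α ν : Fin 3 → ℝ) : ℝ :=
  -(1 / 2) * β * ∑ i, ν i * ν i + ∑ i, ν i * Real.log (ν i / α i)

/-- The global minimizers of `f_{β,α}` on the closed unit simplex. -/
def globalMinimizers (β : ℝ) (α : Fin 3 → ℝ) : Set (Fin 3 → ℝ) :=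
  {ν | ν ∈ stdSimplex ℝ (Fin 3) ∧ IsMinOn (freeEnergy β α) (stdSimplex ℝ (Fin 3)) ν}

/-- The local minimizers of `f_{β,α}` on the closed unit simplex. -/
def localMinimizers (β : ℝ) (α : Fin 3 → ℝ) : Set (Fin 3 → ℝ) :=
  {ν | ν ∈ stdSimplex ℝ (Fin 3) ∧ IsLocalMinOn (freeEnergy β α) (stdSimplex ℝ (Fin 3)) ν}

/-- The coordinate `x = (√3 / 2) (α₁ - α₂)`. -/
noncomputable def xCoord (α : Fin 3 → ℝ) : ℝ := Real.sqrt 3 / 2 * (α 0 - α 1)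

/-- The coordinate `y = (3 α₃ - 1) / 2`. -/
noncomputable def yCoord (α : Fin 3 → ℝ) : ℝ := (3 * α 2 - 1) / 2

/-- The coordinate `u = log (α₁ / α₃)`. -/
noncomputable def uCoord (α : Fin 3 → ℝ) : ℝ := Real.log (α 0 / α 2)

/-- The coordinate `v = log (α₂ / α₃)`. -/
noncomputable def vCoord (α : Fin 3 → ℝ) : ℝ := Real.log (α 1 / α 2)

/-- The field with `(u, v)`-coordinates `u` and `v`. -/
noncomputable def fieldOfUV (u v : ℝ) : Fin 3 → ℝ :=
  fun i => ![Real.exp u, Real.exp v, 1] i / (Real.exp u + Real.exp v + 1)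

/-- The fields on the segment `{0} × (a, b)` in `(x, y)`-coordinates. -/
def axisSegment (a b : ℝ) : Set (Fin 3 → ℝ) :=
  {α | α ∈ fields ∧ xCoord α = 0 ∧ a < yCoord α ∧ yCoord α < b}

/-- The union of the images of `A` under the permutations of the three states. -/
def orbit (A : Set (Fin 3 → ℝ)) : Set (Fin 3 → ℝ) :=
  {α | ∃ σ : Equiv.Perm (Fin 3), α ∘ σ ∈ A}

/-- The closed fundamental cell `ν₁ ≤ ν₂ ≤ ν₃` of the permutation action. -/
def cell : Set (Fin 3 → ℝ) := {ν | ν 0 ≤ ν 1 ∧ ν 1 ≤ ν 2}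

/-- `v`, on the interval `I` with least element `u₀`, solves in the closed fundamental cell
the initial value problem
`dv/du = -(ν₁ - μ₁) / (ν₂ - μ₂)`, `v(u₀) = v₀`,
where `ν` and `μ` are the two local minimizers of `f_{β,α}` in that cell,
for the field `α` with coordinates `(u, v(u))`. -/
structure IsMaxwellSolution (β u₀ v₀ : ℝ) (I : Set ℝ) (v : ℝ → ℝ) : Prop where
  interval : I.OrdConnected
  isLeast : IsLeast I u₀
  initial : v u₀ = v₀
  mem_cell : ∀ u ∈ I, fieldOfUV u (v u) ∈ cell
  ode : ∀ u ∈ I, ∃ ν μ : Fin 3 → ℝ,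
    localMinimizers β (fieldOfUV u (v u)) ∩ cell = {ν, μ} ∧ ν 1 ≠ μ 1 ∧
    HasDerivWithinAt v (-((ν 0 - μ 0) / (ν 1 - μ 1))) I u

/-- The maximal solution of the initial value problem: every solution is a restriction of it,
and it lives on a nondegenerate interval. -/
structure IsMaximalMaxwellSolution (β u₀ v₀ : ℝ) (I : Set ℝ) (v : ℝ → ℝ) : Prop where
  isSolution : IsMaxwellSolution β u₀ v₀ I v
  nontrivial : I.Nontrivial
  maximal : ∀ (J : Set ℝ) (w : ℝ → ℝ), IsMaxwellSolution β u₀ v₀ J w →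
    J ⊆ I ∧ Set.EqOn w v J

/-- The curve of fields with coordinates `(u, v(u))`, `u ∈ I`, without its initial point. -/
def maxwellCurve (u₀ : ℝ) (I : Set ℝ) (v : ℝ → ℝ) : Set (Fin 3 → ℝ) :=
  {α | ∃ u ∈ I, u ≠ u₀ ∧ α = fieldOfUV u (v u)}

end PottsField

/-!
Permutations reduce everything to sorted fields, that is, to coordinates with `u ≤ v ≤ 0`, and
rearrangement (`tiltedEnergy_comp_sort_le`) reduces the global minimizers to the sorted ones, the
`groundStates`; the numbers of their mirror images are then counted separately off the axis `v = 0`,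
on it, and at zero field.

*Sorted local minimizers.* At a stationary point the numbers `x = β ν i` satisfy
`log x - x = log α i + const`. For a sorted local minimizer the two smaller numbers lie on the branch
`x ≤ 1`, so the point is determined by its largest number `z`; as `z` varies, these points form a
path, on which the constraint reads `mass u v z = β`, and the second order condition for `1 < z` is
`0 ≤ gap u v z`. The derivative of `gap` at its zeros has the sign of a polynomial `foldPoly` which
changes sign at most once, so that the unstable part of a path is an interval
(`gap_neg_of_mem_Icc`). Hence there are at most two sorted local minimizers, and two that coexist
as global minimizers are separated by a strict saddle (`IsCandidate.exists_saddle`). Estimates for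
pairs of points with the same value of `log x - x` produce the constants: unstable points have mass
above `18 / 7` (`mass_gt_of_gap_nonpos`), so for smaller `β` sorted ground states are unique and only
the axis has to be examined; and `β ν 0` lies on different sides of `4 / 7` for a stable ordered
state on the axis and for the lower of two stable states with `1 < z` (`low_lt_of_gap_nonneg_axis`,
`IsCandidate.low_gt_of_one_lt`), which controls the axis and the range `4 log 2 ≤ β`.

*The coexistence set.* At a field with two sorted ground states the saddle value `m` still separates
phases when the field is increased or decreased, because the mass at `m` is strictly monotone in the
field. Monotonicity of minimizers in the field then shows that a larger field selects the lower phase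
and a smaller field the upper one: the coexistence set is an antichain (`Coexist.antichain`), hence
the graph of a strictly decreasing function. It is continued by an intermediate value argument
between the phases (`IsSaddle.exists_right`, `Coexist.exists_left`), and comparing energies at
neighbouring fields yields its derivative (`hasDerivWithinAt_of_coexist`). Conversely, along any
solution of the differential equation the energies of the two local minimizers keep a constant
difference, so a solution that starts in the coexistence set remains there
(`IsMaxwellSolution.coexist`); this gives maximality and uniqueness.

*The constants of the diagram.* On the axis ordered phases must exist where `mass u 0 1 < β`, and at
zero field the uniform distribution competes with `(1/6, 1/6, 2/3)`, the energies being equal at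
`β = 4 log 2`. Between `18 / 7` and `4 log 2` both regimes occur on the axis, and they meet in
exactly one point, the triple point (`exists_triple_point`).
-/

namespace PottsField

open Set Filter Topology

section

/-! ### The stationarity function and its lower branch -/

/-- The stationarity function: a coordinate `x = β ν i` of a stationary point satisfies
`ell x = log (α i) + const`. It increases on `(0, 1]` and decreases on `[1, ∞)`. -/
noncomputable def ell (z : ℝ) : ℝ := Real.log z - z

theorem ell_one : ell 1 = -1 := by simp [ell]

theorem ell_strictMonoOn : StrictMonoOn ell (Ioc 0 1) := by
  intro x hx y hy hxy
  have hy0 : 0 < y := hx.1.trans hxy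
  have h := Real.log_lt_sub_one_of_pos (div_pos hx.1 hy0) (by
    rw [Ne, div_eq_one_iff_eq hy0.ne']; exact hxy.ne)
  rw [Real.log_div hx.1.ne' hy0.ne'] at h
  have h2 : y - x ≤ 1 - x / y := by
    rw [one_sub_div hy0.ne', le_div_iff₀ hy0]
    nlinarith [hy.2]
  simp only [ell]; linarith

theorem ell_le_neg_one {z : ℝ} (hz : 0 < z) : ell z ≤ -1 := by
  have := Real.log_le_sub_one_of_pos hz
  simp only [ell]; linarith

theorem ell_lt_neg_one {z : ℝ} (hz : 0 < z) (h1 : z ≠ 1) : ell z < -1 := by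
  have := Real.log_lt_sub_one_of_pos hz h1
  simp only [ell]; linarith

theorem hasDerivAt_ell {z : ℝ} (hz : z ≠ 0) : HasDerivAt ell (1 / z - 1) z := by
  rw [one_div]
  exact (Real.hasDerivAt_log hz).sub (hasDerivAt_id z)

theorem continuousOn_ell : ContinuousOn ell (Ioi 0) := fun _ hz =>
  (hasDerivAt_ell (ne_of_gt hz)).continuousAt.continuousWithinAt

theorem exists_low {w : ℝ} (hw : w ≤ -1) : ∃ x, 0 < x ∧ x ≤ 1 ∧ ell x = w := by
  have h1 : Real.exp w ≤ 1 := Real.exp_le_one_iff.2 (by linarith)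
  have hc : ContinuousOn ell (Icc (Real.exp w) 1) :=
    continuousOn_ell.mono fun x hx => (Real.exp_pos w).trans_le hx.1
  have := intermediate_value_Icc h1 hc
  obtain ⟨x, hx, rfl⟩ := this (show w ∈ Icc _ _ from by
    refine ⟨?_, by rw [ell_one]; exact hw⟩
    simp only [ell, Real.log_exp]; linarith [Real.exp_pos w])
  exact ⟨x, (Real.exp_pos _).trans_le hx.1, hx.2, rfl⟩

open Classical in
/-- The inverse of `ell` on `(0, 1]`, defined for arguments at most `-1`; for larger arguments
the value is `1`, which makes the function monotone and continuous on the whole line. -/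
noncomputable def low (w : ℝ) : ℝ := if h : w ≤ -1 then (exists_low h).choose else 1

theorem low_pos (w : ℝ) : 0 < low w := by
  unfold low; split_ifs with h
  · exact (exists_low h).choose_spec.1
  · exact one_pos

theorem low_le_one (w : ℝ) : low w ≤ 1 := by
  unfold low; split_ifs with h
  · exact (exists_low h).choose_spec.2.1
  · exact le_rfl

theorem ell_low {w : ℝ} (h : w ≤ -1) : ell (low w) = w := by
  unfold low; rw [dif_pos h]
  exact (exists_low h).choose_spec.2.2

theorem low_ell {x : ℝ} (h0 : 0 < x) (h1 : x ≤ 1) : low (ell x) = x :=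
  ell_strictMonoOn.injOn ⟨low_pos _, low_le_one _⟩ ⟨h0, h1⟩ (ell_low (ell_le_neg_one h0))

theorem low_lt_one {w : ℝ} (h : w < -1) : low w < 1 := by
  refine lt_of_le_of_ne (low_le_one w) fun h1 => ?_
  have := ell_low h.le
  rw [h1, ell_one] at this; linarith

theorem low_neg_one : low (-1) = 1 := by
  have := low_ell one_pos le_rfl
  rwa [ell_one] at this

theorem low_lt_low {w w' : ℝ} (h : w < w') (hw : w < -1) : low w < low w' := by
  rcases le_or_gt w' (-1) with h' | h'
  · rw [← ell_strictMonoOn.lt_iff_lt ⟨low_pos _, low_le_one _⟩ ⟨low_pos _, low_le_one _⟩,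
      ell_low hw.le, ell_low h']
    exact h
  · have : low w' = 1 := by unfold low; rw [dif_neg (not_le.2 h')]
    rw [this]; exact low_lt_one hw

theorem low_mono : Monotone low := by
  intro w w' h
  rcases h.eq_or_lt with rfl | h
  · exact le_rfl
  rcases lt_or_ge w (-1) with h' | h'
  · exact (low_lt_low h h').le
  · have h2 : low w' = 1 := by unfold low; rw [dif_neg (not_le.2 (h'.trans_lt h))]
    rw [h2]; exact low_le_one w

theorem low_lt_of_lt_ell {x w : ℝ} (h0 : 0 < x) (hw : w < ell x) : low w < x := by
  rcases le_or_gt x 1 with h1 | h1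
  · have h := low_lt_low hw (hw.trans_le (ell_le_neg_one h0))
    rwa [low_ell h0 h1] at h
  · exact (low_le_one w).trans_lt h1

theorem lt_low_of_ell_lt {x w : ℝ} (h0 : 0 < x) (h1 : x < 1) (hw : ell x < w) : x < low w := by
  have h := low_lt_low hw (ell_lt_neg_one h0 h1.ne)
  rwa [low_ell h0 h1.le] at h

theorem continuous_low : Continuous low := by
  rw [continuous_iff_continuousAt]
  intro w
  refine tendsto_order.2 ⟨fun a ha => ?_, fun b hb => ?_⟩
  · rcases le_or_gt a 0 with h0 | h0
    · exact Eventually.of_forall fun w' => h0.trans_lt (low_pos w')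
    · have ha1 : a < 1 := ha.trans_le (low_le_one w)
      have : ell a < w := by
        by_contra! hle
        have := low_mono hle
        rw [low_ell h0 ha1.le] at this
        linarith
      filter_upwards [lt_mem_nhds this] with w' hw'
      exact lt_low_of_ell_lt h0 ha1 hw'
  · rcases lt_or_ge 1 b with h1 | h1
    · exact Eventually.of_forall fun w' => (low_le_one w').trans_lt h1
    · have hb0 : 0 < b := (low_pos w).trans hb
      have : w < ell b := by
        by_contra! hle
        have := low_mono hle
        rw [low_ell hb0 h1] at this
        linarith
      filter_upwards [gt_mem_nhds this] with w' hw'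
      exact low_lt_of_lt_ell hb0 hw'

/-- The odds `x / (1 - x)` of `x = low w`; this is also the derivative of `low` at `w`. -/
noncomputable def odds (w : ℝ) : ℝ := low w / (1 - low w)

theorem odds_pos {w : ℝ} (h : w < -1) : 0 < odds w :=
  div_pos (low_pos w) (by linarith [low_lt_one h])

theorem one_add_odds {w : ℝ} (h : w < -1) : 1 + odds w = 1 / (1 - low w) := by
  have : 1 - low w ≠ 0 := by linarith [low_lt_one h]
  unfold odds; field_simp; ring

theorem odds_lt_odds {w w' : ℝ} (h : w < w') (hw' : w' < -1) : odds w < odds w' := by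
  have h1 := low_lt_low h (h.trans hw')
  have h2 := low_lt_one hw'
  unfold odds
  rw [div_lt_div_iff₀ (by linarith) (by linarith)]
  nlinarith

theorem odds_le_odds {w w' : ℝ} (h : w ≤ w') (hw' : w' < -1) : odds w ≤ odds w' := by
  rcases h.eq_or_lt with rfl | h
  · exact le_rfl
  · exact (odds_lt_odds h hw').le

theorem hasDerivAt_low {w : ℝ} (h : w < -1) : HasDerivAt low (odds w) w := by
  have h1 := low_lt_one h
  have h0 := low_pos w
  have hd : HasDerivAt ell (1 / low w - 1) (low w) := hasDerivAt_ell h0.ne'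
  have hne : 1 / low w - 1 ≠ 0 := by
    rw [one_div, sub_ne_zero]; exact (one_lt_inv₀ h0 |>.2 h1).ne'
  have := HasDerivAt.of_local_left_inverse continuous_low.continuousAt hd hne
    (by filter_upwards [gt_mem_nhds h] with w' hw' using ell_low hw'.le)
  refine this.congr_deriv ?_
  unfold odds
  have h3 : 1 - low w ≠ 0 := by linarith
  field_simp

theorem hasDerivAt_odds {w : ℝ} (h : w < -1) :
    HasDerivAt odds (odds w * (1 + odds w) ^ 2) w := by
  have h1 := low_lt_one h
  have hd := hasDerivAt_low h
  have h3 : 1 - low w ≠ 0 := by linarith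
  have : HasDerivAt odds _ w := hd.div (hd.const_sub 1) h3
  refine this.congr_deriv (Eq.trans ?_ (by rw [one_add_odds h]))
  rw [odds]
  field_simp
  ring

theorem continuousAt_odds {w : ℝ} (h : w < -1) : ContinuousAt odds w :=
  (hasDerivAt_odds h).continuousAt

/-! ### Inequalities for conjugate points of `ell` -/

theorem sinh_lt_mul_cosh {s : ℝ} (hs : 0 < s) : Real.sinh s < s * Real.cosh s := by
  have hmono : StrictMonoOn (fun t => t * Real.cosh t - Real.sinh t) (Ici 0) := by
    refine strictMonoOn_of_deriv_pos (convex_Ici 0) (by fun_prop) fun t ht => ?_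
    rw [interior_Ici] at ht
    have hd : HasDerivAt (fun t => t * Real.cosh t - Real.sinh t) (t * Real.sinh t) t := by
      refine (((hasDerivAt_id t).mul (Real.hasDerivAt_cosh t)).sub
        (Real.hasDerivAt_sinh t)).congr_deriv ?_
      simp
    rw [hd.deriv]
    exact mul_pos ht (Real.sinh_pos_iff.2 ht)
  have := hmono (show (0 : ℝ) ∈ Ici 0 from self_mem_Ici) (show s ∈ Ici 0 from hs.le) hs
  simp at this; linarith

theorem mul_cosh_sub_sinh_le {s : ℝ} (hs : 0 < s) :
    s * Real.cosh s - Real.sinh s ≤ s ^ 2 / 3 * Real.sinh s := by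
  have hmono : MonotoneOn (fun t => t ^ 2 / 3 * Real.sinh t - (t * Real.cosh t - Real.sinh t))
      (Ici 0) := by
    refine monotoneOn_of_deriv_nonneg (convex_Ici 0) (by fun_prop) (by fun_prop) fun t ht => ?_
    rw [interior_Ici] at ht
    have ht0 : 0 < t := ht
    have hd : HasDerivAt (fun t => t ^ 2 / 3 * Real.sinh t - (t * Real.cosh t - Real.sinh t))
        (t / 3 * (t * Real.cosh t - Real.sinh t)) t := by
      refine (((((hasDerivAt_id t).pow 2).div_const 3).mul (Real.hasDerivAt_sinh t)).sub
        (((hasDerivAt_id t).mul (Real.hasDerivAt_cosh t)).sub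
        (Real.hasDerivAt_sinh t))).congr_deriv ?_
      simp; ring
    rw [hd.deriv]
    exact mul_nonneg (by linarith) (by linarith [sinh_lt_mul_cosh ht0])
  have := hmono (show (0 : ℝ) ∈ Ici 0 from self_mem_Ici) (show s ∈ Ici 0 from hs.le) hs.le
  simp at this; linarith

theorem two_sinh_sq_lt {s : ℝ} (hs : 0 < s) :
    2 * Real.sinh s ^ 2 < s * (Real.sinh s * Real.cosh s) + s ^ 2 := by
  have hmono : StrictMonoOn
      (fun t => t * (Real.sinh t * Real.cosh t) + t ^ 2 - 2 * Real.sinh t ^ 2) (Ici 0) := by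
    refine strictMonoOn_of_deriv_pos (convex_Ici 0) (by fun_prop) fun t ht => ?_
    rw [interior_Ici] at ht
    have ht0 : 0 < t := ht
    have hd : HasDerivAt
        (fun t => t * (Real.sinh t * Real.cosh t) + t ^ 2 - 2 * Real.sinh t ^ 2)
        (t * (Real.cosh t ^ 2 + Real.sinh t ^ 2) + 2 * t
          - 3 * (Real.sinh t * Real.cosh t)) t := by
      refine ((((hasDerivAt_id t).mul ((Real.hasDerivAt_sinh t).mul (Real.hasDerivAt_cosh t))).add
        ((hasDerivAt_id t).pow 2)).sub (((Real.hasDerivAt_sinh t).pow 2).const_mul 2)).congr_deriv ?_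
      simp; ring
    rw [hd.deriv]
    have h1 := sinh_lt_mul_cosh ht0
    have h2 := Real.cosh_sq t
    have h3 := Real.sinh_pos_iff.2 ht0
    have h4 := Real.cosh_pos t
    -- `t cosh (2t) + 2t - (3/2) sinh (2t)` has derivative `2t sinh (2t) - 2 cosh (2t) + 2`
    have hmono2 : StrictMonoOn (fun t => t * (Real.cosh t ^ 2 + Real.sinh t ^ 2) + 2 * t
          - 3 * (Real.sinh t * Real.cosh t)) (Ici 0) := by
      refine strictMonoOn_of_deriv_pos (convex_Ici 0) (by fun_prop) fun t ht => ?_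
      rw [interior_Ici] at ht
      have ht0 : 0 < t := ht
      have hd : HasDerivAt (fun t => t * (Real.cosh t ^ 2 + Real.sinh t ^ 2) + 2 * t
          - 3 * (Real.sinh t * Real.cosh t))
          (4 * Real.sinh t * (t * Real.cosh t - Real.sinh t)) t := by
        refine ((((hasDerivAt_id t).mul (((Real.hasDerivAt_cosh t).pow 2).add
          ((Real.hasDerivAt_sinh t).pow 2))).add ((hasDerivAt_id t).const_mul 2)).sub
          (((Real.hasDerivAt_sinh t).mul (Real.hasDerivAt_cosh t)).const_mul 3)).congr_deriv ?_
        simp only [Pi.add_apply, Pi.pow_apply, id]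
        have := Real.cosh_sq t
        linear_combination (-2) * this
      rw [hd.deriv]
      exact mul_pos (mul_pos (by norm_num) (Real.sinh_pos_iff.2 ht0))
        (by linarith [sinh_lt_mul_cosh ht0])
    have := hmono2 (show (0 : ℝ) ∈ Ici 0 from self_mem_Ici) (show t ∈ Ici 0 from ht0.le) ht0
    simpa using this
  have := hmono (show (0 : ℝ) ∈ Ici 0 from self_mem_Ici) (show s ∈ Ici 0 from hs.le) hs
  simp at this; linarith

/-- Two points with the same value of `ell` have logarithmic mean `1`, which yields a
parametrization by hyperbolic functions of half their difference. -/
theorem conj_param {x z : ℝ} (hx : 0 < x) (hxz : x < z) (h : ell x = ell z) :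
    (x + z) * Real.sinh ((z - x) / 2) = (z - x) * Real.cosh ((z - x) / 2) ∧
    x * z * Real.sinh ((z - x) / 2) ^ 2 = ((z - x) / 2) ^ 2 := by
  set s := (z - x) / 2 with hs
  have hz : 0 < z := hx.trans hxz
  have hzx : z = x * (Real.exp s) ^ 2 := by
    have : Real.log z = Real.log x + 2 * s := by simp only [ell] at h; rw [hs]; linarith
    rw [← Real.exp_log hz, this, Real.exp_add, Real.exp_log hx, two_mul, Real.exp_add, sq]
  have hs2 : z - x = 2 * s := by rw [hs]; ring
  have hS : Real.sinh s = (Real.exp s - (Real.exp s)⁻¹) / 2 := by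
    rw [Real.sinh_eq, Real.exp_neg]
  have hC : Real.cosh s = (Real.exp s + (Real.exp s)⁻¹) / 2 := by
    rw [Real.cosh_eq, Real.exp_neg]
  have hE : Real.exp s ≠ 0 := (Real.exp_pos s).ne'
  constructor
  · rw [hS, hC, hzx]; field_simp; ring
  · have hs' : s = (z - x) / 2 := hs
    have hs3 : s = x * (Real.exp s ^ 2 - 1) / 2 := by linear_combination hs' + hzx / 2
    rw [hS, hzx]
    generalize Real.exp s = t at *
    rw [hs3]
    field_simp

variable {x z : ℝ}

/-- The conjugate of `x` is more than its reflection in `1`. -/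
theorem two_lt_conj_add (hx : 0 < x) (hxz : x < z) (h : ell x = ell z) : 2 < x + z := by
  obtain ⟨h1, -⟩ := conj_param hx hxz h
  have hs : 0 < (z - x) / 2 := by linarith
  have h2 := sinh_lt_mul_cosh hs
  have h3 := Real.sinh_pos_iff.2 hs
  nlinarith

theorem conj_mul_le_one (hx : 0 < x) (hxz : x < z) (h : ell x = ell z) : x * z ≤ 1 := by
  obtain ⟨-, h1⟩ := conj_param hx hxz h
  have hs : 0 < (z - x) / 2 := by linarith
  have h2 := Real.self_le_sinh_iff.2 hs.le
  have h3 := Real.sinh_pos_iff.2 hs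
  have : ((z - x) / 2) ^ 2 ≤ Real.sinh ((z - x) / 2) ^ 2 := by gcongr
  by_contra! hc
  nlinarith [sq_pos_of_pos h3]

theorem conj_add_le (hx : 0 < x) (hxz : x < z) (h : ell x = ell z) :
    6 * (x + z - 2) ≤ (z - x) ^ 2 := by
  obtain ⟨h1, -⟩ := conj_param hx hxz h
  have hs : 0 < (z - x) / 2 := by linarith
  have h2 := mul_cosh_sub_sinh_le hs
  have h3 := Real.sinh_pos_iff.2 hs
  have : (6 * (x + z - 2)) * Real.sinh ((z - x) / 2)
    ≤ (z - x) ^ 2 * Real.sinh ((z - x) / 2) := by nlinarith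
  exact le_of_mul_le_mul_right this h3

/-- In terms of `x` and `z` this says `z / (z - 1) - x / (1 - x) < 4 / 3`. -/
theorem four_lt_conj (hx : 0 < x) (hxz : x < z) (h : ell x = ell z) :
    4 < x + z + 2 * (x * z) := by
  obtain ⟨h1, h4⟩ := conj_param hx hxz h
  have hs : 0 < (z - x) / 2 := by linarith
  have h2 := two_sinh_sq_lt hs
  have h3 := Real.sinh_pos_iff.2 hs
  set S := Real.sinh ((z - x) / 2)
  set C := Real.cosh ((z - x) / 2)
  have h5 : (x + z) * S ^ 2 = (z - x) * (S * C) := by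
    rw [sq, ← mul_assoc, h1]; ring
  have : 4 * S ^ 2 < (x + z + 2 * (x * z)) * S ^ 2 := by nlinarith
  exact lt_of_mul_lt_mul_right this (sq_nonneg S)

end

section

/-! ### The one-parameter family of candidate minimizers -/

theorem exists_lt_left_of_hasDerivAt_pos {F : ℝ → ℝ} {F' a c : ℝ} (hF : HasDerivAt F F' c)
    (h0 : 0 < F') (hac : a < c) : ∃ z ∈ Ioo a c, F z < F c := by
  have h1 := (hasDerivAt_iff_tendsto_slope.1 hF).eventually (lt_mem_nhds h0)
  have h2 : ∀ᶠ z in 𝓝[<] c, 0 < slope F c z :=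
    h1.filter_mono (nhdsWithin_mono _ fun z hz => ne_of_lt hz)
  obtain ⟨z, hz, hzI⟩ := (h2.and (Ioo_mem_nhdsLT hac)).exists
  refine ⟨z, hzI, ?_⟩
  rw [slope_def_field] at hz
  have h3 : z - c < 0 := by linarith [hzI.2]
  by_contra! hle
  have : (F z - F c) / (z - c) ≤ 0 := div_nonpos_of_nonneg_of_nonpos (by linarith) h3.le
  linarith

/-- A function that crosses zero only upwards stays positive once it is nonnegative. -/
theorem pos_of_deriv_pos_of_eq_zero {F F' : ℝ → ℝ} {a b : ℝ} (hab : a < b)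
    (hd : ∀ z ∈ Icc a b, HasDerivAt F (F' z) z) (h0 : ∀ z ∈ Icc a b, F z = 0 → 0 < F' z)
    (ha : 0 ≤ F a) : 0 < F b := by
  have key := image_le_of_deriv_right_lt_deriv_boundary' (f := fun _ => (0 : ℝ))
    (f' := fun _ => 0) (a := a) (b := b) continuousOn_const
    (fun x _ => hasDerivWithinAt_const x (Ici x) (0 : ℝ)) ha
    (fun z hz => (hd z hz).continuousAt.continuousWithinAt)
    (fun z hz => (hd z (Ico_subset_Icc_self hz)).hasDerivWithinAt)
    (fun z hz h => h0 z (Ico_subset_Icc_self hz) h.symm)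
  have hb : b ∈ Icc a b := right_mem_Icc.2 hab.le
  refine lt_of_le_of_ne (key hb) fun h => ?_
  obtain ⟨z, hz, hlt⟩ := exists_lt_left_of_hasDerivAt_pos (hd b hb) (h0 b hb h.symm) hab
  have := key (Ioo_subset_Icc_self hz)
  linarith

/-- A function that is increasing wherever it is nonpositive stays positive once it is
nonnegative; nothing is assumed at the initial point. -/
theorem pos_of_deriv_pos_of_nonpos {F F' : ℝ → ℝ} {a b : ℝ} (hab : a < b)
    (hF : ContinuousOn F (Icc a b)) (hd : ∀ z ∈ Ioc a b, HasDerivAt F (F' z) z)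
    (h0 : ∀ z ∈ Ioc a b, F z ≤ 0 → 0 < F' z)
    (ha : 0 ≤ F a) : 0 < F b := by
  by_contra! hb
  obtain ⟨c, hc, hmin⟩ := isCompact_Icc.exists_isMinOn (nonempty_Icc.2 hab.le) hF
  have hcb : F c ≤ F b := hmin (right_mem_Icc.2 hab.le)
  obtain ⟨c', hc', hle⟩ : ∃ c' ∈ Ioc a b, ∀ z ∈ Icc a b, F c' ≤ F z := by
    rcases hc.1.eq_or_lt with rfl | h
    · exact ⟨b, right_mem_Ioc.2 hab, fun z hz => (hb.trans ha).trans (hmin hz)⟩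
    · exact ⟨c, ⟨h, hc.2⟩, fun z hz => hmin hz⟩
  have hneg : F c' ≤ 0 := (hle b (right_mem_Icc.2 hab.le)).trans hb
  obtain ⟨z, hz, hlt⟩ := exists_lt_left_of_hasDerivAt_pos (hd c' hc')
    (h0 c' hc' hneg) hc'.1
  exact absurd (hle z ⟨hz.1.le, hz.2.le.trans hc'.2⟩) (not_le.2 hlt)

/-- The total mass of the point with largest coordinate `z` and remaining coordinates on the
lower branch, for the field with coordinates `(u, v)`. As `z` varies these points form a path; here
coordinates are those of `β ν`, so the stationary probability vectors on the path are its points of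
mass `β`. -/
noncomputable def mass (u v z : ℝ) : ℝ := low (ell z + u) + low (ell z + v) + z

/-- For `1 < z` this has the sign of the derivative of `mass u v`; it is nonnegative exactly
where the Hessian of the free energy on the simplex is positive semidefinite. -/
noncomputable def gap (u v z : ℝ) : ℝ := z / (z - 1) - odds (ell z + u) - odds (ell z + v)

/-- Up to a positive factor, the derivative of `gap` at its zeros, as a polynomial in the odds of
the two smaller coordinates. -/
def foldPoly (p q : ℝ) : ℝ := 4 * (p ^ 2 + p * q + q ^ 2) - 3 * (p * q * (p + q))

variable {u v z : ℝ}

theorem ell_add_le (hz : 0 < z) (hu : u ≤ 0) : ell z + u ≤ -1 := by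
  linarith [ell_le_neg_one hz]

theorem ell_add_lt (hz : 0 < z) (h1 : z ≠ 1) (hu : u ≤ 0) : ell z + u < -1 := by
  linarith [ell_lt_neg_one hz h1]

theorem hasDerivAt_low_path (hz : 0 < z) (h1 : z ≠ 1) (hu : u ≤ 0) :
    HasDerivAt (fun z => low (ell z + u)) (odds (ell z + u) * (1 / z - 1)) z :=
  HasDerivAt.comp z (h₂ := low) (hasDerivAt_low (ell_add_lt hz h1 hu)) ((hasDerivAt_ell hz.ne').add_const u)

theorem hasDerivAt_odds_path (hz : 0 < z) (h1 : z ≠ 1) (hu : u ≤ 0) :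
    HasDerivAt (fun z => odds (ell z + u))
      (odds (ell z + u) * (1 + odds (ell z + u)) ^ 2 * (1 / z - 1)) z :=
  HasDerivAt.comp z (h₂ := odds) (hasDerivAt_odds (ell_add_lt hz h1 hu))
    ((hasDerivAt_ell hz.ne').add_const u)

theorem hasDerivAt_mass (hz : 0 < z) (h1 : z ≠ 1) (hu : u ≤ 0) (hv : v ≤ 0) :
    HasDerivAt (mass u v)
      (odds (ell z + u) * (1 / z - 1) + odds (ell z + v) * (1 / z - 1) + 1) z :=
  ((hasDerivAt_low_path hz h1 hu).add (hasDerivAt_low_path hz h1 hv)).add (hasDerivAt_id z)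

theorem hasDerivAt_mass_of_one_lt (hz : 1 < z) (hu : u ≤ 0) (hv : v ≤ 0) :
    HasDerivAt (mass u v) ((z - 1) / z * gap u v z) z := by
  refine (hasDerivAt_mass (by linarith) hz.ne' hu hv).congr_deriv ?_
  have h0 : z ≠ 0 := by linarith
  have h1 : z - 1 ≠ 0 := by linarith
  unfold gap; field_simp; ring

theorem continuousOn_mass : ContinuousOn (mass u v) (Ioi 0) :=
  ((continuous_low.comp_continuousOn (continuousOn_ell.add continuousOn_const)).add
    (continuous_low.comp_continuousOn (continuousOn_ell.add continuousOn_const))).add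
    continuousOn_id

theorem mass_strictMonoOn_Ioc : StrictMonoOn (mass u v) (Ioc 0 1) := by
  intro z hz z' hz' h
  have h1 := (ell_strictMonoOn hz hz' h).le
  have h2 := low_mono (add_le_add_left h1 u)
  have h3 := low_mono (add_le_add_left h1 v)
  unfold mass; linarith

theorem mass_lt_mass {u' v' : ℝ} (hz : 1 < z) (hu : u ≤ u') (hv : v ≤ v')
    (hne : u < u' ∨ v < v') (hu0 : u' ≤ 0) (hv0 : v' ≤ 0) : mass u v z < mass u' v' z := by
  have h1 := low_mono (add_le_add_right hu (ell z))
  have h2 := low_mono (add_le_add_right hv (ell z))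
  have hz0 : 0 < z := by linarith
  unfold mass
  rcases hne with h | h
  · have := low_lt_low (add_lt_add_right h (ell z)) (ell_add_lt hz0 hz.ne' (hu.trans hu0))
    linarith
  · have := low_lt_low (add_lt_add_right h (ell z)) (ell_add_lt hz0 hz.ne' (hv.trans hv0))
    linarith

theorem gap_le_gap {u' v' : ℝ} (hz : 1 < z) (hu : u ≤ u') (hv : v ≤ v')
    (hu0 : u' ≤ 0) (hv0 : v' ≤ 0) : gap u' v' z ≤ gap u v z := by
  have hz0 : 0 < z := by linarith
  have h1 := odds_le_odds (add_le_add_right hu (ell z)) (ell_add_lt hz0 hz.ne' hu0)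
  have h2 := odds_le_odds (add_le_add_right hv (ell z)) (ell_add_lt hz0 hz.ne' hv0)
  unfold gap; linarith

theorem hasDerivAt_gap (hz : 1 < z) (hu : u ≤ 0) (hv : v ≤ 0) :
    HasDerivAt (gap u v) ((z - 1) / z *
      (odds (ell z + u) * (1 + odds (ell z + u)) ^ 2
        + odds (ell z + v) * (1 + odds (ell z + v)) ^ 2
        - z / (z - 1) * (z / (z - 1) - 1) ^ 2)) z := by
  have h0 : z ≠ 0 := by linarith
  have h1 : z - 1 ≠ 0 := by linarith
  have hq : HasDerivAt (fun z : ℝ => z / (z - 1)) ((1 * (z - 1) - z * 1) / (z - 1) ^ 2) z :=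
    (hasDerivAt_id z).div ((hasDerivAt_id z).sub_const 1) h1
  refine ((hq.sub (hasDerivAt_odds_path (by linarith) hz.ne' hu)).sub
    (hasDerivAt_odds_path (by linarith) hz.ne' hv)).congr_deriv ?_
  field_simp
  ring

/-- The sign of `foldPoly` along a path changes at most once, from negative to positive: modulo
`foldPoly` itself, its logarithmic derivative is `-27 p q (p + q)`. -/
theorem foldPoly_pos {z' : ℝ} (hz : 1 < z) (hzz : z < z') (hu : u ≤ 0) (hv : v ≤ 0)
    (h : 0 ≤ foldPoly (odds (ell z + u)) (odds (ell z + v))) :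
    0 < foldPoly (odds (ell z' + u)) (odds (ell z' + v)) := by
  set f : ℝ → ℝ := fun z => odds (ell z + u) with hf
  set g : ℝ → ℝ := fun z => odds (ell z + v) with hg
  refine pos_of_deriv_pos_of_eq_zero (F := fun z => foldPoly (f z) (g z)) (F' := fun z =>
    (1 / z - 1) * ((8 * f z + 4 * g z - 6 * f z * g z - 3 * g z ^ 2) * (f z * (1 + f z) ^ 2) +
      (4 * f z + 8 * g z - 3 * f z ^ 2 - 6 * f z * g z) * (g z * (1 + g z) ^ 2)))
    hzz ?_ ?_ h
  · intro t ht
    have ht1 : 1 < t := hz.trans_le ht.1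
    have hp : HasDerivAt f (f t * (1 + f t) ^ 2 * (1 / t - 1)) t :=
      hasDerivAt_odds_path (by linarith) ht1.ne' hu
    have hq : HasDerivAt g (g t * (1 + g t) ^ 2 * (1 / t - 1)) t :=
      hasDerivAt_odds_path (by linarith) ht1.ne' hv
    refine (((((hp.pow 2).add (hp.mul hq)).add (hq.pow 2)).const_mul 4).sub
      (((hp.mul hq).mul (hp.add hq)).const_mul 3)).congr_deriv ?_
    simp only [Pi.add_apply, Pi.mul_apply]
    push_cast
    ring
  · intro t ht h0
    have ht1 : 1 < t := hz.trans_le ht.1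
    have hp : 0 < f t := odds_pos (ell_add_lt (by linarith) ht1.ne' hu)
    have hq : 0 < g t := odds_pos (ell_add_lt (by linarith) ht1.ne' hv)
    have ht2 : 1 / t - 1 < 0 := by
      rw [sub_neg, div_lt_one (by linarith)]; exact ht1
    refine mul_pos_of_neg_of_neg ht2 ?_
    have key : ∀ p q : ℝ, foldPoly p q = 0 →
        (8 * p + 4 * q - 6 * p * q - 3 * q ^ 2) * (p * (1 + p) ^ 2) +
        (4 * p + 8 * q - 3 * p ^ 2 - 6 * p * q) * (q * (1 + q) ^ 2) = -27 * (p * q * (p + q)) := by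
      intro p q hE
      unfold foldPoly at hE
      grind
    have h1 := key _ _ h0
    rw [h1]
    have := mul_pos (mul_pos hp hq) (add_pos hp hq)
    linarith

theorem four_thirds_lt_of_foldPoly_neg {p q : ℝ} (hp : 0 < p) (hpq : p ≤ q)
    (h : foldPoly p q < 0) : 4 / 3 < p := by
  by_contra! hle
  unfold foldPoly at h
  nlinarith [mul_nonneg (mul_nonneg (sub_nonneg.2 hle) (hp.le.trans hpq))
    (add_pos_of_pos_of_nonneg hp (hp.le.trans hpq)).le, sq_nonneg p]

theorem odds_path_bounds (huv : u ≤ v) (hv : v ≤ 0) (hz : 1 < z) :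
    0 < odds (ell z + u) ∧ odds (ell z + u) ≤ odds (ell z + v) ∧
      0 < (z - 1) / z ∧ 1 < z / (z - 1) := by
  refine ⟨odds_pos (ell_add_lt (by linarith) hz.ne' (huv.trans hv)),
    odds_le_odds (add_le_add_right huv _) (ell_add_lt (by linarith) hz.ne' hv),
    div_pos (by linarith) (by linarith), ?_⟩
  rw [lt_div_iff₀ (by linarith)]; linarith

/-- Once `foldPoly` is nonnegative, `gap` can cross zero only upwards. -/
theorem gap_pos_of_foldPoly_nonneg {a m : ℝ} (huv : u ≤ v) (hv : v ≤ 0) (ha : 1 < a)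
    (ham : a < m) (hga : 0 ≤ gap u v a)
    (hE : 0 ≤ foldPoly (odds (ell a + u)) (odds (ell a + v))) : 0 < gap u v m := by
  have hu := huv.trans hv
  refine pos_of_deriv_pos_of_nonpos (F := gap u v) ham
    (fun t ht => (hasDerivAt_gap (ha.trans_le ht.1) hu hv).continuousAt.continuousWithinAt)
    (fun t ht => hasDerivAt_gap (ha.trans ht.1) hu hv) (fun t ht h => ?_) hga
  obtain ⟨hp, hpq, hc, hq⟩ := odds_path_bounds huv hv (ha.trans ht.1)
  have hEt := foldPoly_pos ha ht.1 hu hv hE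
  refine mul_pos hc ?_
  unfold gap at h
  generalize odds (ell t + u) = p at *
  generalize odds (ell t + v) = q at *
  generalize t / (t - 1) = r at *
  unfold foldPoly at hEt
  -- Replacing `r` by the larger `p + q` turns the derivative of `gap` into `foldPoly p q`.
  have : r * (r - 1) ^ 2 ≤ (p + q) * (p + q - 1) ^ 2 := by
    have : r ≤ p + q := by linarith
    gcongr
    · linarith
  nlinarith

/-- As long as `foldPoly` is negative, `gap` can cross zero only downwards. -/
theorem gap_neg_of_foldPoly_neg {m b : ℝ} (huv : u ≤ v) (hv : v ≤ 0) (hm : 1 < m)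
    (hmb : m < b) (hgm : gap u v m ≤ 0)
    (hE : foldPoly (odds (ell b + u)) (odds (ell b + v)) < 0) : gap u v b < 0 := by
  have hu := huv.trans hv
  have hEneg : ∀ t ∈ Icc m b, foldPoly (odds (ell t + u)) (odds (ell t + v)) < 0 := by
    intro t ht
    by_contra! h
    rcases ht.2.eq_or_lt with rfl | h'
    · linarith
    · linarith [foldPoly_pos (hm.trans_le ht.1) h' hu hv h]
  rw [← neg_pos]
  refine pos_of_deriv_pos_of_nonpos (F := fun t => -gap u v t) hmb
    (fun t ht => (hasDerivAt_gap (hm.trans_le ht.1) hu hv).neg.continuousAt.continuousWithinAt)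
    (fun t ht => (hasDerivAt_gap (hm.trans ht.1) hu hv).neg) (fun t ht h => ?_)
    (by linarith)
  obtain ⟨hp, hpq, hc, hq⟩ := odds_path_bounds huv hv (hm.trans ht.1)
  have hEt := hEneg t (Ioc_subset_Icc_self ht)
  have hp43 := four_thirds_lt_of_foldPoly_neg hp hpq hEt
  rw [neg_pos]
  refine mul_neg_of_pos_of_neg hc ?_
  unfold gap at h
  generalize odds (ell t + u) = p at *
  generalize odds (ell t + v) = q at *
  generalize t / (t - 1) = r at *
  unfold foldPoly at hEt
  have : (p + q) * (p + q - 1) ^ 2 ≤ r * (r - 1) ^ 2 := by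
    have : p + q ≤ r := by linarith
    gcongr
    · linarith
  nlinarith

/-- The unstable part of a path is an interval. -/
theorem gap_neg_of_mem_Icc {m₁ m₂ b : ℝ} (huv : u ≤ v) (hv : v ≤ 0) (h1 : 1 < m₁)
    (hm₁ : gap u v m₁ < 0) (hm₂ : gap u v m₂ < 0) (hb₁ : m₁ ≤ b) (hb₂ : b ≤ m₂) :
    gap u v b < 0 := by
  by_contra! hb
  have hb₁' : m₁ < b := hb₁.lt_of_ne (by rintro rfl; linarith)
  have hb₂' : b < m₂ := hb₂.lt_of_ne (by rintro rfl; linarith)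
  rcases le_or_gt 0 (foldPoly (odds (ell b + u)) (odds (ell b + v))) with hE | hE
  · linarith [gap_pos_of_foldPoly_nonneg huv hv (h1.trans hb₁') hb₂' hb hE]
  · linarith [gap_neg_of_foldPoly_neg huv hv h1 hb₁' hm₁.le hE]

/-- If an unstable point follows the stable point `a`, then the smallest coordinate at `a` is
large. -/
theorem odds_gt_of_gap_neg {a m : ℝ} (huv : u ≤ v) (hv : v ≤ 0) (ha : 1 < a) (ham : a < m)
    (hga : 0 ≤ gap u v a) (hgm : gap u v m < 0) : 4 / 3 < odds (ell a + u) := by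
  rcases le_or_gt 0 (foldPoly (odds (ell a + u)) (odds (ell a + v))) with hE | hE
  · linarith [gap_pos_of_foldPoly_nonneg huv hv ha ham hga hE]
  · obtain ⟨hp, hpq, -, -⟩ := odds_path_bounds huv hv ha
    exact four_thirds_lt_of_foldPoly_neg hp hpq hE

/-- A path that returns to the same mass has an unstable point in between. -/
theorem exists_gap_neg {a b : ℝ} (huv : u ≤ v) (hv : v ≤ 0) (ha : 0 < a) (hab : a < b)
    (hS : mass u v b ≤ mass u v a) : ∃ m, 1 < m ∧ m ∈ Ioo a b ∧ gap u v m < 0 := by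
  have hu := huv.trans hv
  by_contra! hcon
  have hb1 : 1 < b := by
    by_contra! hb
    exact absurd (mass_strictMonoOn_Ioc (u := u) (v := v) ⟨ha, hab.le.trans hb⟩
      ⟨ha.trans hab, hb⟩ hab) (not_lt.2 hS)
  set c := max a 1 with hc
  have hc1 : 1 ≤ c := le_max_right _ _
  have hcb : c < b := max_lt hab hb1
  have hac : mass u v a ≤ mass u v c := by
    rcases le_total a 1 with h | h
    · rw [hc, max_eq_right h]
      exact mass_strictMonoOn_Ioc.monotoneOn ⟨ha, h⟩ ⟨one_pos, le_rfl⟩ h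
    · rw [hc, max_eq_left h]
  have hgap : ∀ t ∈ Ioo c b, 0 ≤ gap u v t := fun t ht =>
    hcon t (hc1.trans_lt ht.1) ⟨(le_max_left _ _).trans_lt ht.1, ht.2⟩
  have hder : ∀ t ∈ Ioo c b, HasDerivAt (mass u v) ((t - 1) / t * gap u v t) t := fun t ht =>
    hasDerivAt_mass_of_one_lt (hc1.trans_lt ht.1) hu hv
  have hmono : MonotoneOn (mass u v) (Icc c b) := by
    refine monotoneOn_of_deriv_nonneg (convex_Icc c b)
      (continuousOn_mass.mono fun t ht => one_pos.trans_le (hc1.trans ht.1)) ?_ ?_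
    · rw [interior_Icc]
      exact fun t ht => (hder t ht).differentiableAt.differentiableWithinAt
    · rw [interior_Icc]
      intro t ht
      rw [(hder t ht).deriv]
      have h1 : 1 < t := hc1.trans_lt ht.1
      exact mul_nonneg (div_nonneg (by linarith) (by linarith)) (hgap t ht)
  -- the mass would be constant on `[c, b]`, so `gap` and then `foldPoly` would vanish there
  have hconst : ∀ t ∈ Icc c b, mass u v t = mass u v c := by
    intro t ht
    have h1 := hmono (left_mem_Icc.2 hcb.le) ht ht.1
    have h2 := hmono ht (right_mem_Icc.2 hcb.le) ht.2
    linarith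
  have hgap0 : ∀ t ∈ Ioo c b, gap u v t = 0 := by
    intro t ht
    have h1 : 1 < t := hc1.trans_lt ht.1
    have hev : mass u v =ᶠ[𝓝 t] fun _ => mass u v c := by
      filter_upwards [Ioo_mem_nhds ht.1 ht.2] with s hs using hconst s (Ioo_subset_Icc_self hs)
    have := (hder t ht).unique ((hasDerivAt_const t (mass u v c)).congr_of_eventuallyEq hev)
    rcases mul_eq_zero.1 this with h | h
    · exact absurd h (div_pos (by linarith) (by linarith)).ne'
    · exact h
  obtain ⟨t, ht⟩ : (Ioo c b).Nonempty := nonempty_Ioo.2 hcb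
  obtain ⟨t', ht'⟩ : (Ioo t b).Nonempty := nonempty_Ioo.2 ht.2
  have h1 : 1 < t := hc1.trans_lt ht.1
  rcases le_or_gt 0 (foldPoly (odds (ell t + u)) (odds (ell t + v))) with hE | hE
  · have := gap_pos_of_foldPoly_nonneg huv hv h1 ht'.1 (hgap0 t ht).ge hE
    linarith [hgap0 t' ⟨ht.1.trans ht'.1, ht'.2⟩]
  · obtain ⟨t'', ht''⟩ : (Ioo c t).Nonempty := nonempty_Ioo.2 ht.1
    have h2 : 1 < t'' := hc1.trans_lt ht''.1
    have := gap_neg_of_foldPoly_neg huv hv h2 ht''.2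
      (hgap0 t'' ⟨ht''.1, ht''.2.trans ht.2⟩).le hE
    linarith [hgap0 t ht]

end

section

variable {β u v z : ℝ}

theorem low_gt_of_odds_gt {w : ℝ} (hw : w < -1) (h : 4 / 3 < odds w) : 4 / 7 < low w := by
  have h1 := low_lt_one hw
  unfold odds at h
  rw [lt_div_iff₀ (by linarith)] at h
  linarith

theorem low_lt_of_odds_lt {w : ℝ} (hw : w < -1) (h : odds w < 4 / 3) : low w < 4 / 7 := by
  have h1 := low_lt_one hw
  unfold odds at h
  rw [div_lt_iff₀ (by linarith)] at h
  linarith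

/-- On the symmetry axis `v = 0` a stable point with `1 < z` has a small first coordinate. -/
theorem low_lt_of_gap_nonneg_axis (hz : 1 < z) (hu : u ≤ 0) (hg : 0 ≤ gap u 0 z) :
    low (ell z + u) < 4 / 7 := by
  have hz0 : 0 < z := by linarith
  refine low_lt_of_odds_lt (ell_add_lt hz0 hz.ne' hu) ?_
  have hl := ell_lt_neg_one hz0 hz.ne'
  have hx1 := low_lt_one hl
  have hx := low_pos (ell z)
  have h4 := four_lt_conj hx (hx1.trans hz) (ell_low hl.le)
  unfold gap at hg
  rw [add_zero] at hg
  have : z / (z - 1) - odds (ell z) < 4 / 3 := by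
    unfold odds
    rw [div_sub_div _ _ (by linarith) (by linarith), div_lt_div_iff₀
      (mul_pos (by linarith) (by linarith)) (by norm_num)]
    nlinarith
  linarith

/-- Unstable points have mass above `18 / 7`. For given `z` and given odds sum, the mass is
smallest when the second coordinate is as large as possible, that is, conjugate to `z`. -/
theorem mass_gt_of_gap_nonpos (hz : 1 < z) (huv : u ≤ v) (hv : v ≤ 0) (hg : gap u v z ≤ 0) :
    18 / 7 < mass u v z := by
  have hz0 : 0 < z := by linarith
  have hu := huv.trans hv
  have hl := ell_lt_neg_one hz0 hz.ne'
  have hx1 := low_lt_one hl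
  have hx := low_pos (ell z)
  have hxz := hx1.trans hz
  have hc := ell_low hl.le
  have hd := two_lt_conj_add hx hxz hc
  have hm := conj_mul_le_one hx hxz hc
  have hs := conj_add_le hx hxz hc
  have hlu := ell_add_lt hz0 hz.ne' hu
  have hlv := ell_add_lt hz0 hz.ne' hv
  have hP1 := one_add_odds hlu
  have hP2 := one_add_odds hlv
  have hP := one_add_odds hl
  have h12 := odds_le_odds (add_le_add_right huv (ell z)) hlv
  have h2 : odds (ell z + v) ≤ odds (ell z) := odds_le_odds (by linarith) hl
  have hx1' := low_lt_one hlu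
  have hx2' := low_lt_one hlv
  have hp0 := odds_pos hlu
  unfold gap at hg
  unfold mass
  set x := low (ell z)
  set x₁ := low (ell z + u)
  set x₂ := low (ell z + v)
  set P₁ := 1 + odds (ell z + u) with hP₁
  set P₂ := 1 + odds (ell z + v) with hP₂
  set P := 1 + odds (ell z) with hPP
  set M := (z - 1) * (1 - x) with hM
  have hM0 : 0 < M := mul_pos (by linarith) (by linarith)
  -- Instability means `P₁ + P₂ ≥ T`, and `mass` is `2 - 1 / P₁ - 1 / P₂ + z`.
  set T := z / (z - 1) + 2 with hT
  have hA : T - P = (3 * M - (x + z - 2)) / M := by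
    have h1 : z - 1 ≠ 0 := by linarith
    have h3 : 1 - x ≠ 0 := by linarith
    rw [hT, hP, hM]; field_simp; ring
  have hA0 : 0 < T - P := by rw [hA]; exact div_pos (by nlinarith) hM0
  have hP₁0 : 0 < P₁ := by linarith
  have hP₂0 : 0 < P₂ := by linarith
  have hP0 : 0 < P := by linarith
  have hx₁ : x₁ = 1 - 1 / P₁ := by rw [hP1]; simp
  have hx₂ : x₂ = 1 - 1 / P₂ := by rw [hP2]; simp
  have hxP : x = 1 - 1 / P := by rw [hP]; simp
  have hTP : 0 < T - P₂ := by linarith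
  have h5 : 1 / P₁ ≤ 1 / (T - P₂) := one_div_le_one_div_of_le hTP (by linarith)
  have h6 : 1 / (T - P₂) + 1 / P₂ ≤ 1 / (T - P) + 1 / P := by
    rw [div_add_div _ _ hTP.ne' hP₂0.ne', div_add_div _ _ hA0.ne' hP0.ne',
      show 1 * P₂ + (T - P₂) * 1 = T by ring, show 1 * P + (T - P) * 1 = T by ring]
    refine div_le_div_of_nonneg_left (by linarith) (mul_pos hA0 hP0) ?_
    nlinarith [mul_nonneg (sub_nonneg.2 (show P₂ ≤ P by linarith))
      (show 0 ≤ P + P₂ - T by linarith)]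
  have h7 : 1 / (T - P) < x + z - 2 + 3 / 7 := by
    rw [hA, one_div_div, div_lt_iff₀ (by nlinarith)]
    have h8 : x + z - 2 ≤ M := by nlinarith
    have h9 : 4 * M = (z - x) ^ 2 - (x + z - 2) ^ 2 := by rw [hM]; ring
    have h10 : 0 < x + z - 2 := by linarith
    have h11 := mul_le_mul_of_nonneg_left h8 h10.le
    have h12 := mul_pos h10 h10
    have h13 : 6 * (x + z - 2) - (x + z - 2) * (x + z - 2) ≤ 4 * M := by
      rw [h9]; linarith [sq (x + z - 2)]
    clear_value M
    generalize x + z - 2 = d at *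
    have h14 : (d + 3 / 7) * (3 * M - d) = 3 * (d * M) - d * d + 9 / 7 * M - 3 / 7 * d := by ring
    rw [h14]; linarith
  linarith

/-- For `β ≤ 18 / 7` the mass takes the value `β` at most once along a path. -/
theorem lt_mass_of_le (hβ : β ≤ 18 / 7) (huv : u ≤ v) (hv : v ≤ 0) {a b : ℝ} (ha : 0 < a)
    (hab : a < b) (hm : β ≤ mass u v a) : β < mass u v b := by
  rcases le_or_gt b 1 with hb | hb
  · exact hm.trans_lt (mass_strictMonoOn_Ioc ⟨ha, hab.le.trans hb⟩ ⟨ha.trans hab, hb⟩ hab)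
  have hac : mass u v a ≤ mass u v (max a 1) := by
    rcases le_total a 1 with h | h
    · rw [max_eq_right h]
      exact mass_strictMonoOn_Ioc.monotoneOn ⟨ha, h⟩ ⟨one_pos, le_rfl⟩ h
    · rw [max_eq_left h]
  rw [← sub_pos]
  refine pos_of_deriv_pos_of_nonpos (F := fun z => mass u v z - β) (a := max a 1)
    (F' := fun t => (t - 1) / t * gap u v t) (max_lt hab hb)
    ((continuousOn_mass.mono fun t ht => ha.trans_le ((le_max_left _ _).trans ht.1)).sub
      continuousOn_const) (fun t ht => ?_) (fun t ht h => ?_) (by linarith)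
  · exact (hasDerivAt_mass_of_one_lt ((le_max_right _ _).trans_lt ht.1)
      (huv.trans hv) hv).sub_const β
  · have h1 : 1 < t := (le_max_right _ _).trans_lt ht.1
    refine mul_pos (div_pos (by linarith) (by linarith)) ?_
    by_contra! hg
    linarith [mass_gt_of_gap_nonpos h1 huv hv hg]

/-- The largest coordinate `z = β ν 2` of a local minimizer in the closed fundamental cell, for
the field with coordinates `(u, v)`, satisfies these necessary conditions. -/
structure IsCandidate (β u v z : ℝ) : Prop where
  pos : 0 < z
  mass_eq : mass u v z = β
  gap_nonneg : 1 < z → 0 ≤ gap u v z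

theorem IsCandidate.exists_gap_neg {a b : ℝ} (huv : u ≤ v) (hv : v ≤ 0)
    (ha : IsCandidate β u v a) (hb : IsCandidate β u v b) (hab : a < b) :
    ∃ m, 1 < m ∧ m ∈ Ioo a b ∧ gap u v m < 0 :=
  PottsField.exists_gap_neg huv hv ha.pos hab (by rw [ha.mass_eq, hb.mass_eq])

/-- There are at most two candidates. -/
theorem IsCandidate.not_lt_lt {a b c : ℝ} (huv : u ≤ v) (hv : v ≤ 0)
    (ha : IsCandidate β u v a) (hb : IsCandidate β u v b) (hc : IsCandidate β u v c)
    (hab : a < b) (hbc : b < c) : False := by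
  obtain ⟨m, hm1, hm, hgm⟩ := ha.exists_gap_neg huv hv hb hab
  obtain ⟨n, hn1, hn, hgn⟩ := hb.exists_gap_neg huv hv hc hbc
  have := gap_neg_of_mem_Icc huv hv hm1 hgm hgn hm.2.le hn.1.le
  linarith [hb.gap_nonneg (hm1.trans hm.2)]

theorem ell_lt_of_mass_eq {a b : ℝ} (ha : 0 < a) (hab : a < b)
    (h : mass u v a = mass u v b) : 1 < b ∧ ell b < ell a := by
  have hlt : ell b < ell a := by
    by_contra! hle
    have h1 := low_mono (add_le_add_left hle u)
    have h2 := low_mono (add_le_add_left hle v)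
    unfold mass at h; linarith
  refine ⟨?_, hlt⟩
  by_contra! hb
  exact absurd (ell_strictMonoOn ⟨ha, hab.le.trans hb⟩ ⟨ha.trans hab, hb⟩ hab) (not_lt.2 hlt.le)

/-- Of two points of the same mass on a path, the one with larger `z` has smaller remaining
coordinates. -/
theorem low_lt_low_of_mass_eq {a b w : ℝ} (ha : 0 < a) (hab : a < b)
    (h : mass u v a = mass u v b) (hw : w ≤ 0) : low (ell b + w) < low (ell a + w) := by
  obtain ⟨hb, hlt⟩ := ell_lt_of_mass_eq ha hab h
  exact low_lt_low (by linarith) (ell_add_lt (by linarith) hb.ne' hw)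

/-- The first coordinate of the lower of two candidates is large if both exceed `1`. -/
theorem IsCandidate.low_gt_of_one_lt {a b : ℝ} (huv : u ≤ v) (hv : v ≤ 0)
    (ha : IsCandidate β u v a) (hb : IsCandidate β u v b) (hab : a < b) (ha1 : 1 < a) :
    4 / 7 < low (ell a + u) := by
  obtain ⟨m, -, hm, hgm⟩ := ha.exists_gap_neg huv hv hb hab
  exact low_gt_of_odds_gt (ell_add_lt (by linarith) ha1.ne' (huv.trans hv))
    (odds_gt_of_gap_neg huv hv ha1 hm.1 (ha.gap_nonneg ha1) hgm)

/-- The Lagrangian of the free energy along a path. At points of mass `β` it agrees with the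
rescaled free energy up to a constant. -/
noncomputable def pathEnergy (β u v z : ℝ) : ℝ :=
  (low (ell z + u) ^ 2 / 2 - low (ell z + u)) + (low (ell z + v) ^ 2 / 2 - low (ell z + v)) +
    (z ^ 2 / 2 - z) + β * ell z

theorem hasDerivAt_pathEnergy (hz : 0 < z) (h1 : z ≠ 1) (hu : u ≤ 0) (hv : v ≤ 0) :
    HasDerivAt (pathEnergy β u v) ((1 - 1 / z) * (mass u v z - β)) z := by
  have hlow : ∀ w : ℝ, w ≤ 0 → HasDerivAt (fun z => low (ell z + w) ^ 2 / 2 - low (ell z + w))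
      (-low (ell z + w) * (1 / z - 1)) z := by
    intro w hw
    have hd := hasDerivAt_low_path hz h1 hw
    refine (((hd.pow 2).div_const 2).sub hd).congr_deriv ?_
    have := low_lt_one (ell_add_lt hz h1 hw)
    have h3 : 1 - low (ell z + w) ≠ 0 := by linarith
    unfold odds; field_simp; ring
  refine ((((hlow u hu).add (hlow v hv)).add ((((hasDerivAt_id z).pow 2).div_const 2).sub
    (hasDerivAt_id z))).add ((hasDerivAt_ell hz.ne').const_mul β)).congr_deriv ?_
  have := hz.ne'
  unfold mass
  simp only [id]
  field_simp; ring

theorem continuousOn_pathEnergy : ContinuousOn (pathEnergy β u v) (Ioi 0) := by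
  have hlow : ∀ w : ℝ, ContinuousOn (fun z => low (ell z + w)) (Ioi 0) := fun w =>
    continuous_low.comp_continuousOn (continuousOn_ell.add continuousOn_const)
  have h1 := hlow u
  have h2 := hlow v
  have h3 := continuousOn_ell
  unfold pathEnergy
  fun_prop

/-- Between two candidates of equal energy the path has a strict saddle. Rolle's theorem for
`pathEnergy` gives a point of mass `β` in between, and it is unstable since otherwise it would be a
third candidate. -/
theorem IsCandidate.exists_saddle {a b : ℝ} (huv : u ≤ v) (hv : v ≤ 0)
    (ha : IsCandidate β u v a) (hb : IsCandidate β u v b) (hab : a < b)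
    (hH : pathEnergy β u v a = pathEnergy β u v b) :
    ∃ m, 1 < m ∧ m ∈ Ioo a b ∧ mass u v m = β ∧ gap u v m < 0 := by
  have hu := huv.trans hv
  obtain ⟨hb1, hlt⟩ := ell_lt_of_mass_eq ha.pos hab (by rw [ha.mass_eq, hb.mass_eq])
  suffices h : ∃ m, 1 < m ∧ m ∈ Ioo a b ∧ mass u v m = β by
    obtain ⟨m, hm1, hm, hmβ⟩ := h
    refine ⟨m, hm1, hm, hmβ, ?_⟩
    by_contra! hg
    exact ha.not_lt_lt huv hv ⟨by linarith, hmβ, fun _ => hg⟩ hb hm.1 hm.2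
  rcases le_or_gt 1 a with ha1 | ha1
  · obtain ⟨m, hm, hm0⟩ := exists_hasDerivAt_eq_zero hab
      (continuousOn_pathEnergy.mono fun t ht => ha.pos.trans_le ht.1) hH
      (fun t ht => hasDerivAt_pathEnergy (ha.pos.trans ht.1) (ha1.trans_lt ht.1).ne' hu hv)
    have hm1 : 1 < m := ha1.trans_lt hm.1
    refine ⟨m, hm1, hm, ?_⟩
    rcases mul_eq_zero.1 hm0 with h | h
    · have : 1 / m < 1 := by rw [div_lt_one (by linarith)]; exact hm1
      linarith
    · linarith
  · -- Below `1` the factor `1 - 1 / z` has the wrong sign. The point `c`, conjugate to `a`, has the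
    -- same small coordinates but larger mass and energy, so the mean value theorem applies from `c`.
    obtain ⟨c, hc, hca⟩ := intermediate_value_Icc' hb1.le
      (continuousOn_ell.mono fun t ht => one_pos.trans_le ht.1)
      (show ell a ∈ Icc (ell b) (ell 1) from
        ⟨hlt.le, by rw [ell_one]; exact ell_le_neg_one ha.pos⟩)
    have hc1 : 1 < c := hc.1.lt_of_ne (by
      rintro rfl
      rw [ell_one] at hca
      linarith [ell_lt_neg_one ha.pos ha1.ne])
    have hcb : c < b := hc.2.lt_of_ne (by rintro rfl; linarith)
    have hsum := two_lt_conj_add ha.pos (ha1.trans hc1) hca.symm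
    have hHc : pathEnergy β u v a < pathEnergy β u v c := by
      unfold pathEnergy; rw [hca]; nlinarith
    have hmc : β < mass u v c := by
      rw [← ha.mass_eq]; unfold mass; rw [hca]; linarith
    obtain ⟨ξ, hξ, hξ'⟩ := exists_hasDerivAt_eq_slope (pathEnergy β u v) _ hcb
      (continuousOn_pathEnergy.mono fun t ht => (one_pos.trans hc1).trans_le ht.1)
      (fun t ht => hasDerivAt_pathEnergy ((one_pos.trans hc1).trans ht.1)
        (hc1.trans ht.1).ne' hu hv)
    have hξ1 : 1 < ξ := hc1.trans hξ.1
    have hmξ : mass u v ξ < β := by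
      by_contra! h
      have h1 : 1 / ξ ≤ 1 := by rw [div_le_one (by linarith)]; exact hξ1.le
      have h2 : 0 ≤ (1 - 1 / ξ) * (mass u v ξ - β) :=
        mul_nonneg (by linarith) (by linarith)
      have h3 : (pathEnergy β u v b - pathEnergy β u v c) / (b - c) < 0 :=
        div_neg_of_neg_of_pos (by linarith) (by linarith)
      linarith
    obtain ⟨m, hm, hmβ⟩ := intermediate_value_Icc' hξ.1.le
      (continuousOn_mass.mono fun t ht => (one_pos.trans hc1).trans_le ht.1)
      (show β ∈ Icc (mass u v ξ) (mass u v c) from ⟨hmξ.le, hmc.le⟩)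
    exact ⟨m, hc1.trans_le hm.1, ⟨ha1.trans (hc1.trans_le hm.1), hm.2.trans_lt hξ.2⟩, hmβ⟩

end

section

variable {β u v : ℝ} {ν : Fin 3 → ℝ}

/-! ### Necessary conditions for local minimizers -/

/-- The free energy for the field with coordinates `y = (u, v)`, without the additive constant
that depends on the field only. It is affine in `y`. -/
noncomputable def tiltedEnergy (β : ℝ) (y : ℝ × ℝ) (ν : Fin 3 → ℝ) : ℝ :=
  -(1 / 2) * β * ∑ i, ν i * ν i + ∑ i, ν i * Real.log (ν i) - (y.1 * ν 0 + y.2 * ν 1)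

theorem fieldOfUV_pos (u v : ℝ) (i : Fin 3) : 0 < fieldOfUV u v i := by
  unfold fieldOfUV
  fin_cases i <;> simp <;> positivity

theorem log_fieldOfUV (u v : ℝ) (i : Fin 3) :
    Real.log (fieldOfUV u v i) = ![u, v, 0] i - Real.log (Real.exp u + Real.exp v + 1) := by
  unfold fieldOfUV
  have hZ : Real.exp u + Real.exp v + 1 ≠ 0 := by positivity
  fin_cases i <;> simp [Real.log_div, hZ]

theorem freeEnergy_fieldOfUV (hν : ν ∈ stdSimplex ℝ (Fin 3)) :
    freeEnergy β (fieldOfUV u v) ν =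
      tiltedEnergy β (u, v) ν + Real.log (Real.exp u + Real.exp v + 1) := by
  have h : ∀ i, ν i * Real.log (ν i / fieldOfUV u v i) = ν i * Real.log (ν i) -
      ν i * (![u, v, 0] i - Real.log (Real.exp u + Real.exp v + 1)) := by
    intro i
    rcases eq_or_ne (ν i) 0 with h | h
    · simp [h]
    · rw [Real.log_div h (fieldOfUV_pos u v i).ne', log_fieldOfUV]; ring
  have hs := hν.2
  unfold freeEnergy tiltedEnergy
  simp only [h]
  simp only [Fin.sum_univ_three] at hs ⊢
  simp
  linear_combination Real.log (Real.exp u + Real.exp v + 1) * hs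

theorem mem_globalMinimizers_iff : ν ∈ globalMinimizers β (fieldOfUV u v) ↔
    ν ∈ stdSimplex ℝ (Fin 3) ∧
      ∀ μ ∈ stdSimplex ℝ (Fin 3), tiltedEnergy β (u, v) ν ≤ tiltedEnergy β (u, v) μ := by
  unfold globalMinimizers
  refine and_congr_right fun hν => forall₂_congr fun μ hμ => ?_
  simp only [mem_ofPred_eq]
  rw [freeEnergy_fieldOfUV hν, freeEnergy_fieldOfUV hμ, add_le_add_iff_right]

theorem mem_localMinimizers_iff : ν ∈ localMinimizers β (fieldOfUV u v) ↔
    ν ∈ stdSimplex ℝ (Fin 3) ∧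
      IsLocalMinOn (tiltedEnergy β (u, v)) (stdSimplex ℝ (Fin 3)) ν := by
  unfold localMinimizers
  refine and_congr_right fun hν => ?_
  refine eventually_congr ?_
  filter_upwards [self_mem_nhdsWithin] with μ hμ
  rw [freeEnergy_fieldOfUV hν, freeEnergy_fieldOfUV hμ, add_le_add_iff_right]

theorem continuous_tiltedEnergy :
    Continuous fun p : (ℝ × ℝ) × (Fin 3 → ℝ) => tiltedEnergy β p.1 p.2 := by
  have h : ∀ i : Fin 3, Continuous fun p : (ℝ × ℝ) × (Fin 3 → ℝ) =>
      p.2 i * Real.log (p.2 i) := fun i =>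
    Real.continuous_mul_log.comp ((continuous_apply i).comp continuous_snd)
  unfold tiltedEnergy
  have h2 := continuous_finsetSum Finset.univ fun i _ => h i
  fun_prop

/-- The second order necessary condition, for a function given with its derivative `G`. -/
theorem second_order_of_isLocalMin {g G : ℝ → ℝ} {G' : ℝ} (hmin : IsLocalMin g 0)
    (hg : ∀ᶠ t in 𝓝 0, HasDerivAt g (G t) t) (hG : HasDerivAt G G' 0) : G 0 = 0 ∧ 0 ≤ G' := by
  have h0 : G 0 = 0 := hmin.hasDerivAt_eq_zero hg.self_of_nhds
  refine ⟨h0, ?_⟩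
  by_contra! hneg
  have hd : deriv g =ᶠ[𝓝 0] G := hg.mono fun t ht => ht.deriv
  have hmax : IsLocalMax g 0 := by
    refine isLocalMax_of_deriv_deriv_neg ?_ (by rw [hd.eq_of_nhds, h0])
      hg.self_of_nhds.continuousAt
    rw [hd.deriv_eq, hG.deriv]
    exact hneg
  have hconst : g =ᶠ[𝓝 0] fun _ => g 0 := by
    filter_upwards [hmin, hmax] with t h1 h2 using le_antisymm h2 h1
  have hG0 : G =ᶠ[𝓝 0] fun _ => (0 : ℝ) := by
    filter_upwards [hg, hconst.eventuallyEq_nhds] with t h1 h2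
    exact h1.unique ((hasDerivAt_const t (g 0)).congr_of_eventuallyEq h2)
  have := hG.unique ((hasDerivAt_const (0 : ℝ) (0 : ℝ)).congr_of_eventuallyEq hG0)
  linarith

theorem add_smul_mem_stdSimplex {δ : Fin 3 → ℝ} (hν : ν ∈ stdSimplex ℝ (Fin 3))
    (hδ : ∑ i, δ i = 0) {t : ℝ} (h : ∀ i, 0 ≤ ν i + t * δ i) :
    (fun i => ν i + t * δ i) ∈ stdSimplex ℝ (Fin 3) := by
  refine ⟨h, ?_⟩
  rw [Finset.sum_add_distrib, ← Finset.mul_sum, hδ, hν.2]; simp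

/-- Local minimizers lie in the interior of the simplex, because the entropy has slope `-∞` at
the boundary. -/
theorem pos_of_isLocalMinOn (hν : ν ∈ stdSimplex ℝ (Fin 3)) {y : ℝ × ℝ}
    (h : IsLocalMinOn (tiltedEnergy β y) (stdSimplex ℝ (Fin 3)) ν) (i : Fin 3) : 0 < ν i := by
  by_contra! hi
  have hi0 : ν i = 0 := le_antisymm hi (hν.1 i)
  obtain ⟨j, hj⟩ : ∃ j, 0 < ν j := by
    by_contra! hall
    have := hν.2
    rw [Finset.sum_eq_zero fun k _ => le_antisymm (hall k) (hν.1 k)] at this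
    exact zero_ne_one this
  have hij : i ≠ j := by rintro rfl; linarith
  set δ : Fin 3 → ℝ := fun k => (if k = i then 1 else 0) - (if k = j then 1 else 0) with hδ
  have hδ0 : ∑ k, δ k = 0 := by simp [hδ]
  have hδi : δ i = 1 := by simp [hδ, hij]
  have hδj : δ j = -1 := by simp [hδ, hij.symm]
  have hδk : ∀ k, k ≠ i → k ≠ j → δ k = 0 := fun k h1 h2 => by simp [hδ, h1, h2]
  -- the part of the energy that is differentiable along the segment
  set r : ℝ → ℝ := fun t => -(1 / 2) * β * ∑ k, (ν k + t * δ k) * (ν k + t * δ k) +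
    ∑ k ∈ Finset.univ.erase i, (ν k + t * δ k) * Real.log (ν k + t * δ k) -
      (y.1 * (ν 0 + t * δ 0) + y.2 * (ν 1 + t * δ 1)) with hr
  have hlin : ∀ k, DifferentiableAt ℝ (fun t => ν k + t * δ k) 0 := fun k => by fun_prop
  have hent : ∀ k ∈ Finset.univ.erase i, DifferentiableAt ℝ
      (fun t => (ν k + t * δ k) * Real.log (ν k + t * δ k)) 0 := by
    intro k hk
    by_cases hkj : k = j
    · subst hkj
      refine (hlin k).mul ((hlin k).log ?_)
      simpa using hj.ne'
    · simp [hδk k (Finset.ne_of_mem_erase hk) hkj]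
  have hrd : DifferentiableAt ℝ r 0 := by
    have h1 := DifferentiableAt.fun_sum hent
    have h2 : DifferentiableAt ℝ
        (fun t => ∑ k, (ν k + t * δ k) * (ν k + t * δ k)) 0 := by fun_prop
    exact ((h2.const_mul _).add h1).sub (by fun_prop)
  have hE : ∀ t, tiltedEnergy β y (fun k => ν k + t * δ k) = r t + t * Real.log t := by
    intro t
    have := Finset.add_sum_erase Finset.univ
      (fun k => (ν k + t * δ k) * Real.log (ν k + t * δ k)) (Finset.mem_univ i)
    simp only [hi0, hδi, zero_add, mul_one] at this
    unfold tiltedEnergy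
    rw [← this, hr]; ring
  have hcont : Tendsto (fun t : ℝ => fun k => ν k + t * δ k) (𝓝[>] 0)
      (𝓝[stdSimplex ℝ (Fin 3)] ν) := by
    refine tendsto_nhdsWithin_iff.2 ⟨?_, ?_⟩
    · have : Continuous fun t : ℝ => fun k => ν k + t * δ k := by fun_prop
      have := this.tendsto 0
      simp only [zero_mul, add_zero] at this
      exact this.mono_left nhdsWithin_le_nhds
    · filter_upwards [self_mem_nhdsWithin, mem_nhdsWithin_of_mem_nhds (gt_mem_nhds hj)]
        with t ht htj
      have ht0 : 0 < t := ht
      refine add_smul_mem_stdSimplex hν hδ0 fun k => ?_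
      by_cases hki : k = i
      · subst hki; rw [hδi]; linarith
      by_cases hkj : k = j
      · subst hkj; rw [hδj]; linarith
      rw [hδk k hki hkj]; linarith [hν.1 k]
  have hev := hcont.eventually h
  have hslope : Tendsto (fun t => slope r 0 t + Real.log t) (𝓝[>] 0) atBot :=
    ((hasDerivAt_iff_tendsto_slope.1 hrd.hasDerivAt).mono_left
      (nhdsWithin_mono _ fun t ht => ne_of_gt ht)).add_atBot Real.tendsto_log_nhdsGT_zero
  obtain ⟨t, ht, ht1, ht0⟩ := (hev.and ((hslope.eventually_lt_atBot 0).and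
    self_mem_nhdsWithin)).exists
  have ht0' : (0 : ℝ) < t := ht0
  have hE0 : tiltedEnergy β y ν = r 0 := by
    have := hE 0
    simpa using this
  rw [hE, hE0] at ht
  rw [slope_def_field, sub_zero] at ht1
  have : (r t - r 0) / t * t = r t - r 0 := by field_simp
  nlinarith

/-- First and second order conditions at an interior local minimizer, in a direction `δ`. -/
theorem second_order_of_isLocalMinOn (hν : ν ∈ stdSimplex ℝ (Fin 3)) {y : ℝ × ℝ}
    (h : IsLocalMinOn (tiltedEnergy β y) (stdSimplex ℝ (Fin 3)) ν) (hpos : ∀ i, 0 < ν i)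
    {δ : Fin 3 → ℝ} (hδ : ∑ i, δ i = 0) :
    ∑ i, δ i * (Real.log (ν i) - β * ν i) - (y.1 * δ 0 + y.2 * δ 1) = 0 ∧
      0 ≤ ∑ i, δ i ^ 2 * (1 / ν i - β) := by
  have hcts : Continuous fun t : ℝ => fun k => ν k + t * δ k := by fun_prop
  have hpos' : ∀ᶠ t : ℝ in 𝓝 0, ∀ i, 0 < ν i + t * δ i := by
    rw [eventually_all]
    intro i
    have : Continuous fun t : ℝ => ν i + t * δ i := by fun_prop
    exact this.continuousAt.eventually (lt_mem_nhds (by simpa using hpos i))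
  have hcont : Tendsto (fun t : ℝ => fun k => ν k + t * δ k) (𝓝 0)
      (𝓝[stdSimplex ℝ (Fin 3)] ν) := by
    refine tendsto_nhdsWithin_iff.2 ⟨?_, ?_⟩
    · have := hcts.tendsto 0
      simpa only [zero_mul, add_zero] using this
    · filter_upwards [hpos'] with t ht
      exact add_smul_mem_stdSimplex hν hδ fun k => (ht k).le
  have hmin : IsLocalMin (fun t : ℝ => tiltedEnergy β y fun k => ν k + t * δ k) 0 := by
    have := hcont.eventually h
    unfold IsLocalMin IsMinFilter
    simpa only [zero_mul, add_zero] using this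
  have hlin : ∀ (k : Fin 3) (t : ℝ), HasDerivAt (fun t => ν k + t * δ k) (δ k) t := by
    intro k t
    simpa using ((hasDerivAt_id t).mul_const (δ k)).const_add (ν k)
  have hg : ∀ᶠ t in 𝓝 (0 : ℝ), HasDerivAt
      (fun t : ℝ => tiltedEnergy β y fun k => ν k + t * δ k)
      (∑ i, δ i * (Real.log (ν i + t * δ i) - β * (ν i + t * δ i))
        - (y.1 * δ 0 + y.2 * δ 1)) t := by
    filter_upwards [hpos'] with t ht
    have h1 := HasDerivAt.fun_sum (u := Finset.univ)
      fun (k : Fin 3) (_ : k ∈ Finset.univ) => (hlin k t).mul (hlin k t)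
    have h2 := HasDerivAt.fun_sum (u := Finset.univ)
      fun (k : Fin 3) (_ : k ∈ Finset.univ) => (hlin k t).mul ((hlin k t).log (ht k).ne')
    refine (((h1.const_mul (-(1 / 2) * β)).add h2).sub
      (((hlin 0 t).const_mul y.1).add ((hlin 1 t).const_mul y.2))).congr_deriv ?_
    have h3 : ∀ k, (ν k + t * δ k) * (δ k / (ν k + t * δ k)) = δ k := fun k => by
      have := (ht k).ne'
      field_simp
    simp only [h3, Fin.sum_univ_three] at hδ ⊢
    linear_combination hδ
  have hG : HasDerivAt (fun t : ℝ => ∑ i, δ i * (Real.log (ν i + t * δ i)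
      - β * (ν i + t * δ i)) - (y.1 * δ 0 + y.2 * δ 1))
      (∑ i, δ i ^ 2 * (1 / ν i - β)) 0 := by
    have h2 := HasDerivAt.fun_sum (u := Finset.univ) fun (k : Fin 3) (_ : k ∈ Finset.univ) =>
      (((hlin k 0).log (by simpa using (hpos k).ne')).sub
        ((hlin k 0).const_mul β)).const_mul (δ k)
    refine (h2.sub_const _).congr_deriv ?_
    refine Finset.sum_congr rfl fun k _ => ?_
    have := (hpos k).ne'
    simp only [zero_mul, add_zero]
    field_simp
  have := second_order_of_isLocalMin hmin hg hG
  simpa only [zero_mul, add_zero] using this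

/-- A local minimizer in the closed fundamental cell is determined by its largest coordinate,
which is a candidate. -/
theorem candidate_of_mem_localMinimizers (hβ : 0 < β)
    (hν : ν ∈ localMinimizers β (fieldOfUV u v) ∩ cell) (hu : u ≤ 0) (hv : v ≤ 0) :
    IsCandidate β u v (β * ν 2) ∧ β * ν 0 = low (ell (β * ν 2) + u) ∧
      β * ν 1 = low (ell (β * ν 2) + v) := by
  obtain ⟨hloc, hc01, hc12⟩ := hν
  rw [mem_localMinimizers_iff] at hloc
  obtain ⟨hs, hmin⟩ := hloc
  have hpos := pos_of_isLocalMinOn hs hmin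
  have hso := fun {δ : Fin 3 → ℝ} hδ => second_order_of_isLocalMinOn (δ := δ) hs hmin hpos hδ
  have hell : ∀ i, ell (β * ν i) = Real.log β + (Real.log (ν i) - β * ν i) := fun i => by
    unfold ell; rw [Real.log_mul hβ.ne' (hpos i).ne']; ring
  have hx : ∀ i, 0 < β * ν i := fun i => mul_pos hβ (hpos i)
  have h0 : ell (β * ν 0) = ell (β * ν 2) + u := by
    have := (hso (δ := ![1, 0, -1]) (by simp [Fin.sum_univ_three])).1
    simp [Fin.sum_univ_three] at this
    rw [hell, hell]; linarith
  obtain ⟨h1', h1''⟩ := hso (δ := ![0, 1, -1]) (by simp [Fin.sum_univ_three])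
  have h1 : ell (β * ν 1) = ell (β * ν 2) + v := by
    simp [Fin.sum_univ_three] at h1'
    rw [hell, hell]; linarith
  have hx1 : β * ν 1 ≤ 1 := by
    simp [Fin.sum_univ_three] at h1''
    have h3 : (ν 2)⁻¹ ≤ (ν 1)⁻¹ := inv_anti₀ (hpos 1) hc12
    have h4 : β ≤ (ν 1)⁻¹ := by linarith
    rwa [le_inv_comm₀ hβ (hpos 1), ← one_div, le_div_iff₀ hβ, mul_comm] at h4
  have hx0 : β * ν 0 ≤ 1 := (mul_le_mul_of_nonneg_left hc01 hβ.le).trans hx1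
  have e0 : β * ν 0 = low (ell (β * ν 2) + u) := by rw [← h0, low_ell (hx 0) hx0]
  have e1 : β * ν 1 = low (ell (β * ν 2) + v) := by rw [← h1, low_ell (hx 1) hx1]
  refine ⟨⟨hx 2, ?_, fun hz => ?_⟩, e0, e1⟩
  · unfold mass
    rw [← e0, ← e1]
    have := hs.2
    rw [Fin.sum_univ_three] at this
    linear_combination β * this
  · -- test the Hessian in the direction given by the odds
    have l0 := low_lt_one (ell_add_lt (hx 2) hz.ne' hu)
    have l1 := low_lt_one (ell_add_lt (hx 2) hz.ne' hv)
    have hp := odds_pos (ell_add_lt (hx 2) hz.ne' hu)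
    have hq := odds_pos (ell_add_lt (hx 2) hz.ne' hv)
    have d0 : odds (ell (β * ν 2) + u) ^ 2 * (1 / ν 0 - β) =
        β * odds (ell (β * ν 2) + u) := by
      unfold odds
      rw [← e0] at l0 ⊢
      have n1 := (hpos 0).ne'
      have n2 : 1 - β * ν 0 ≠ 0 := by linarith
      field_simp
    have d1 : odds (ell (β * ν 2) + v) ^ 2 * (1 / ν 1 - β) =
        β * odds (ell (β * ν 2) + v) := by
      unfold odds
      rw [← e1] at l1 ⊢
      have n1 := (hpos 1).ne'
      have n2 : 1 - β * ν 1 ≠ 0 := by linarith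
      field_simp
    unfold gap
    generalize odds (ell (β * ν 2) + u) = p at *
    generalize odds (ell (β * ν 2) + v) = q at *
    have := (hso (δ := ![p, q, -(p + q)]) (by simp [Fin.sum_univ_three])).2
    simp only [Fin.sum_univ_three, Matrix.cons_val_zero, Matrix.cons_val_one,
      Matrix.cons_val] at this
    rw [d0, d1] at this
    have n2 := (hpos 2).ne'
    have n3 : β * ν 2 - 1 ≠ 0 := by linarith
    have e2 : (-(p + q)) ^ 2 * (1 / ν 2 - β) =
        -(β * (p + q) ^ 2 * ((β * ν 2 - 1) / (β * ν 2))) := by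
      field_simp; ring
    rw [e2] at this
    have h5 : 0 ≤ β * (p + q) * (1 - (p + q) * ((β * ν 2 - 1) / (β * ν 2))) := by linarith
    have h6 := nonneg_of_mul_nonneg_right h5 (mul_pos hβ (add_pos hp hq))
    have h7 : (p + q) * ((β * ν 2 - 1) / (β * ν 2)) ≤ 1 := by linarith
    rw [← mul_div_assoc, div_le_one (hx 2), ← le_div_iff₀ (by linarith)] at h7
    linarith

/-- On points of the path of mass `β`, the free energy is `pathEnergy`, up to scaling and an
additive constant. -/
theorem tiltedEnergy_eq_pathEnergy (hβ : 0 < β) (hu : u ≤ 0) (hv : v ≤ 0) (h2 : 0 < ν 2)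
    (hm : mass u v (β * ν 2) = β) (e0 : β * ν 0 = low (ell (β * ν 2) + u))
    (e1 : β * ν 1 = low (ell (β * ν 2) + v)) :
    β * tiltedEnergy β (u, v) ν = pathEnergy β u v (β * ν 2) + β - β * Real.log β := by
  have hz : 0 < β * ν 2 := mul_pos hβ h2
  have hpos : ∀ w : ℝ, 0 < low w := low_pos
  have h0 : 0 < ν 0 := pos_of_mul_pos_right (by rw [e0]; exact hpos _) hβ.le
  have h1 : 0 < ν 1 := pos_of_mul_pos_right (by rw [e1]; exact hpos _) hβ.le
  have l0 : ell (β * ν 0) = ell (β * ν 2) + u := by rw [e0, ell_low (ell_add_le hz hu)]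
  have l1 : ell (β * ν 1) = ell (β * ν 2) + v := by rw [e1, ell_low (ell_add_le hz hv)]
  have hm' : β * ν 0 + β * ν 1 + β * ν 2 = β := by rw [e0, e1]; exact hm
  unfold pathEnergy tiltedEnergy
  rw [← e0, ← e1]
  unfold ell at l0 l1 ⊢
  rw [Real.log_mul hβ.ne' h0.ne', Real.log_mul hβ.ne' h2.ne'] at l0
  rw [Real.log_mul hβ.ne' h1.ne', Real.log_mul hβ.ne' h2.ne'] at l1
  rw [Real.log_mul hβ.ne' h2.ne']
  simp only [Fin.sum_univ_three]
  linear_combination β * ν 0 * l0 + β * ν 1 * l1 +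
    (Real.log (ν 2) - β * ν 2 + 1) * hm'

end

section

variable {β u v : ℝ} {ν μ : Fin 3 → ℝ}

/-! ### Reduction to the closed fundamental cell -/

/-- The probability vectors in the closed fundamental cell. -/
def sortedSimplex : Set (Fin 3 → ℝ) := stdSimplex ℝ (Fin 3) ∩ cell

/-- The minimizers of the free energy on `C`, for the field with coordinates `y`. -/
def minimizersOn (β : ℝ) (C : Set (Fin 3 → ℝ)) (y : ℝ × ℝ) : Set (Fin 3 → ℝ) :=
  {ν | ν ∈ C ∧ ∀ μ ∈ C, tiltedEnergy β y ν ≤ tiltedEnergy β y μ}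

theorem isClosed_cell : IsClosed cell :=
  (isClosed_le (continuous_apply 0) (continuous_apply 1)).inter
    (isClosed_le (continuous_apply 1) (continuous_apply 2))

theorem isCompact_sortedSimplex : IsCompact sortedSimplex :=
  (isCompact_stdSimplex ℝ (Fin 3)).inter_right isClosed_cell

theorem continuous_tiltedEnergy_right (y : ℝ × ℝ) : Continuous (tiltedEnergy β y) :=
  continuous_tiltedEnergy.comp (Continuous.prodMk_right y)

theorem minimizersOn_nonempty {C : Set (Fin 3 → ℝ)} (hC : IsCompact C) (hne : C.Nonempty)
    (y : ℝ × ℝ) : (minimizersOn β C y).Nonempty := by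
  obtain ⟨ν, hν, h⟩ := hC.exists_isMinOn hne (continuous_tiltedEnergy_right y).continuousOn
  exact ⟨ν, hν, fun μ hμ => h hμ⟩

/-- The minimizers depend upper semicontinuously on the field. -/
theorem isClosed_setOf_minimizersOn_inter {C A : Set (Fin 3 → ℝ)} (hC : IsCompact C)
    (hA : IsClosed A) : IsClosed {y | (minimizersOn β C y ∩ A).Nonempty} := by
  have : CompactSpace C := isCompact_iff_compactSpace.1 hC
  have hcl : IsClosed {p : (ℝ × ℝ) × C | p.2.1 ∈ A ∧
      ∀ μ ∈ C, tiltedEnergy β p.1 p.2.1 ≤ tiltedEnergy β p.1 μ} := by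
    refine IsClosed.and (hA.preimage (continuous_subtype_val.comp continuous_snd)) ?_
    simp only [ofPred_forall]
    refine isClosed_iInter fun μ => isClosed_iInter fun _ => isClosed_le ?_ ?_
    · exact continuous_tiltedEnergy.comp
        (continuous_fst.prodMk (continuous_subtype_val.comp continuous_snd))
    · exact continuous_tiltedEnergy.comp (continuous_fst.prodMk continuous_const)
  convert isClosedMap_fst_of_compactSpace _ hcl using 1
  ext y
  constructor
  · rintro ⟨ν, ⟨hν, hmin⟩, hA⟩
    exact ⟨(y, ⟨ν, hν⟩), ⟨hA, hmin⟩, rfl⟩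
  · rintro ⟨⟨y', ν⟩, ⟨hA, hmin⟩, rfl⟩
    exact ⟨ν, ⟨ν.2, hmin⟩, hA⟩

theorem tiltedEnergy_eq (β : ℝ) (y : ℝ × ℝ) (ν : Fin 3 → ℝ) : tiltedEnergy β y ν =
    -(1 / 2) * β * ∑ i, ν i * ν i + ∑ i, ν i * Real.log (ν i) -
      ∑ i, ν i * ![y.1, y.2, 0] i := by
  unfold tiltedEnergy
  simp [Fin.sum_univ_three, mul_comm]

theorem tiltedEnergy_comp_perm (β : ℝ) (y : ℝ × ℝ) (ν : Fin 3 → ℝ) (σ : Equiv.Perm (Fin 3)) :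
    tiltedEnergy β y (ν ∘ σ) =
    -(1 / 2) * β * ∑ i, ν i * ν i + ∑ i, ν i * Real.log (ν i) -
      ∑ i, ν (σ i) * ![y.1, y.2, 0] i := by
  rw [tiltedEnergy_eq]
  have h1 := Equiv.sum_comp σ fun i => ν i * ν i
  have h2 := Equiv.sum_comp σ fun i => ν i * Real.log (ν i)
  simp only [Function.comp_apply] at *
  rw [h1, h2]

theorem comp_perm_mem_stdSimplex (σ : Equiv.Perm (Fin 3)) (hν : ν ∈ stdSimplex ℝ (Fin 3)) :
    ν ∘ σ ∈ stdSimplex ℝ (Fin 3) :=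
  ⟨fun i => hν.1 (σ i), by rw [← hν.2]; exact Equiv.sum_comp σ ν⟩

theorem mem_cell_iff_monotone : ν ∈ cell ↔ Monotone ν := by
  rw [Fin.monotone_iff_le_succ]
  simp [cell, Fin.forall_fin_two]

theorem monotone_field (huv : u ≤ v) (hv : v ≤ 0) : Monotone ![u, v, 0] :=
  mem_cell_iff_monotone.1 ⟨huv, hv⟩

/-- Sorting a probability vector does not increase the free energy if the field is sorted. -/
theorem tiltedEnergy_comp_sort_le (huv : u ≤ v) (hv : v ≤ 0) (ν : Fin 3 → ℝ) :
    tiltedEnergy β (u, v) (ν ∘ Tuple.sort ν) ≤ tiltedEnergy β (u, v) ν := by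
  have h := ((Tuple.monotone_sort ν).monovary (monotone_field huv hv)).sum_comp_perm_mul_le_sum_mul
    (σ := (Tuple.sort ν)⁻¹)
  simp only [Function.comp_apply, Equiv.Perm.inv_def, Equiv.apply_symm_apply] at h
  rw [tiltedEnergy_comp_perm, tiltedEnergy_eq]
  linarith

theorem comp_sort_mem_sortedSimplex (hν : ν ∈ stdSimplex ℝ (Fin 3)) :
    ν ∘ Tuple.sort ν ∈ sortedSimplex :=
  ⟨comp_perm_mem_stdSimplex _ hν, mem_cell_iff_monotone.2 (Tuple.monotone_sort ν)⟩

theorem sortedSimplex_nonempty : sortedSimplex.Nonempty :=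
  ⟨_, comp_sort_mem_sortedSimplex (ν := Pi.single 0 1) (single_mem_stdSimplex ℝ 0)⟩

theorem mem_minimizersOn_sortedSimplex (huv : u ≤ v) (hv : v ≤ 0) :
    ν ∈ minimizersOn β sortedSimplex (u, v) ↔
      ν ∈ globalMinimizers β (fieldOfUV u v) ∧ ν ∈ cell := by
  rw [mem_globalMinimizers_iff]
  constructor
  · rintro ⟨⟨hs, hc⟩, h⟩
    exact ⟨⟨hs, fun μ hμ => (h _ (comp_sort_mem_sortedSimplex hμ)).trans
      (tiltedEnergy_comp_sort_le huv hv μ)⟩, hc⟩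
  · rintro ⟨⟨hs, h⟩, hc⟩
    exact ⟨⟨hs, hc⟩, fun μ hμ => h μ hμ.1⟩

theorem mem_localMinimizers_of_mem_minimizersOn (huv : u ≤ v) (hv : v ≤ 0)
    (hν : ν ∈ minimizersOn β sortedSimplex (u, v)) :
    ν ∈ localMinimizers β (fieldOfUV u v) ∩ cell := by
  obtain ⟨h, hc⟩ := (mem_minimizersOn_sortedSimplex huv hv).1 hν
  exact ⟨⟨h.1, h.2.localize⟩, hc⟩

/-- A global minimizer is ordered like the field. -/
theorem monovary_of_mem_globalMinimizers (huv : u ≤ v) (hv : v ≤ 0)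
    (hν : ν ∈ globalMinimizers β (fieldOfUV u v)) : Monovary ν ![u, v, 0] := by
  rw [mem_globalMinimizers_iff] at hν
  have h := (Tuple.monotone_sort ν).monovary (monotone_field huv hv)
  have h1 := h.sum_comp_perm_mul_eq_sum_mul_iff (σ := (Tuple.sort ν)⁻¹)
  have h2 := hν.2 _ (comp_perm_mem_stdSimplex (Tuple.sort ν) hν.1)
  have h3 := tiltedEnergy_comp_sort_le (β := β) huv hv ν
  rw [tiltedEnergy_comp_perm, tiltedEnergy_eq] at h2 h3
  have h4 : (ν ∘ Tuple.sort ν) ∘ ⇑(Tuple.sort ν)⁻¹ = ν := by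
    ext i; simp
  rw [h4] at h1
  refine h1.1 ?_
  simp only [Function.comp_apply, Equiv.Perm.inv_def, Equiv.apply_symm_apply]
  linarith

theorem freeEnergy_comp_perm (α ν : Fin 3 → ℝ) (σ : Equiv.Perm (Fin 3)) :
    freeEnergy β (α ∘ σ) (ν ∘ σ) = freeEnergy β α ν := by
  unfold freeEnergy
  have h1 := Equiv.sum_comp σ fun i => ν i * ν i
  have h2 := Equiv.sum_comp σ fun i => ν i * Real.log (ν i / α i)
  simp only [Function.comp_apply] at *
  rw [h1, h2]

theorem comp_perm_mem_globalMinimizers {α : Fin 3 → ℝ} (σ : Equiv.Perm (Fin 3))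
    (h : ν ∈ globalMinimizers β α) : ν ∘ σ ∈ globalMinimizers β (α ∘ σ) := by
  refine ⟨comp_perm_mem_stdSimplex σ h.1, fun μ hμ => ?_⟩
  have h2 : (μ ∘ ⇑σ⁻¹) ∘ ⇑σ = μ := by ext i; simp
  have h3 := h.2 (comp_perm_mem_stdSimplex σ⁻¹ hμ)
  simp only [mem_ofPred_eq] at h3 ⊢
  rw [freeEnergy_comp_perm, ← h2, freeEnergy_comp_perm]
  exact h3

theorem globalMinimizers_comp_perm (α : Fin 3 → ℝ) (σ : Equiv.Perm (Fin 3)) :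
    globalMinimizers β (α ∘ σ) = (fun ν => ν ∘ σ) '' globalMinimizers β α := by
  ext ν
  constructor
  · intro h
    refine ⟨ν ∘ ⇑σ⁻¹, ?_, by ext i; simp⟩
    have := comp_perm_mem_globalMinimizers σ⁻¹ h
    have h2 : (α ∘ ⇑σ) ∘ ⇑σ⁻¹ = α := by ext i; simp
    rwa [h2] at this
  · rintro ⟨μ, hμ, rfl⟩
    exact comp_perm_mem_globalMinimizers σ hμ

theorem ncard_globalMinimizers_comp_perm (α : Fin 3 → ℝ) (σ : Equiv.Perm (Fin 3)) :
    (globalMinimizers β (α ∘ σ)).ncard = (globalMinimizers β α).ncard := by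
  rw [globalMinimizers_comp_perm]
  exact ncard_image_of_injective _ σ.surjective.injective_comp_right

/-! ### Minimizers in the closed fundamental cell -/

theorem pos_of_mem_localMinimizers (hν : ν ∈ localMinimizers β (fieldOfUV u v)) (i : Fin 3) :
    0 < ν i := by
  rw [mem_localMinimizers_iff] at hν
  exact pos_of_isLocalMinOn hν.1 hν.2 i

theorem eq_of_apply_two_eq (hβ : 0 < β) (hu : u ≤ 0) (hv : v ≤ 0)
    (hν : ν ∈ localMinimizers β (fieldOfUV u v) ∩ cell)
    (hμ : μ ∈ localMinimizers β (fieldOfUV u v) ∩ cell) (h : ν 2 = μ 2) : ν = μ := by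
  obtain ⟨-, h0, h1⟩ := candidate_of_mem_localMinimizers hβ hν hu hv
  obtain ⟨-, h0', h1'⟩ := candidate_of_mem_localMinimizers hβ hμ hu hv
  rw [h] at h0 h1
  ext i
  fin_cases i
  · exact mul_left_cancel₀ hβ.ne' (h0.trans h0'.symm)
  · exact mul_left_cancel₀ hβ.ne' (h1.trans h1'.symm)
  · exact h

/-- Of two local minimizers in the cell, the one with the larger last coordinate has both other
coordinates smaller. -/
theorem lt_of_apply_two_lt (hβ : 0 < β) (hu : u ≤ 0) (hv : v ≤ 0)
    (hν : ν ∈ localMinimizers β (fieldOfUV u v) ∩ cell)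
    (hμ : μ ∈ localMinimizers β (fieldOfUV u v) ∩ cell) (h : μ 2 < ν 2) :
    ν 0 < μ 0 ∧ ν 1 < μ 1 ∧ 1 < β * ν 2 := by
  obtain ⟨hc, h0, h1⟩ := candidate_of_mem_localMinimizers hβ hν hu hv
  obtain ⟨hc', h0', h1'⟩ := candidate_of_mem_localMinimizers hβ hμ hu hv
  have hlt : β * μ 2 < β * ν 2 := mul_lt_mul_of_pos_left h hβ
  have hm : mass u v (β * μ 2) = mass u v (β * ν 2) := by rw [hc.mass_eq, hc'.mass_eq]
  refine ⟨?_, ?_, (ell_lt_of_mass_eq hc'.pos hlt hm).1⟩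
  · have := low_lt_low_of_mass_eq hc'.pos hlt hm hu
    rw [← h0, ← h0'] at this
    exact lt_of_mul_lt_mul_left this hβ.le
  · have := low_lt_low_of_mass_eq hc'.pos hlt hm hv
    rw [← h1, ← h1'] at this
    exact lt_of_mul_lt_mul_left this hβ.le

/-- There are at most two local minimizers in the cell. -/
theorem eq_or_eq_of_mem_localMinimizers (hβ : 0 < β) (huv : u ≤ v) (hv : v ≤ 0)
    {a b c : Fin 3 → ℝ} (ha : a ∈ localMinimizers β (fieldOfUV u v) ∩ cell)
    (hb : b ∈ localMinimizers β (fieldOfUV u v) ∩ cell)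
    (hc : c ∈ localMinimizers β (fieldOfUV u v) ∩ cell) (hab : a ≠ b) : c = a ∨ c = b := by
  have hu := huv.trans hv
  have key : ∀ {a b c : Fin 3 → ℝ}, a ∈ localMinimizers β (fieldOfUV u v) ∩ cell →
      b ∈ localMinimizers β (fieldOfUV u v) ∩ cell →
      c ∈ localMinimizers β (fieldOfUV u v) ∩ cell → a 2 < b 2 → b 2 < c 2 → False :=
    fun ha hb hc h1 h2 =>
      (candidate_of_mem_localMinimizers hβ ha hu hv).1.not_lt_lt huv hv
        (candidate_of_mem_localMinimizers hβ hb hu hv).1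
        (candidate_of_mem_localMinimizers hβ hc hu hv).1
        (mul_lt_mul_of_pos_left h1 hβ) (mul_lt_mul_of_pos_left h2 hβ)
  have hne : ∀ {a b : Fin 3 → ℝ}, a ∈ localMinimizers β (fieldOfUV u v) ∩ cell →
      b ∈ localMinimizers β (fieldOfUV u v) ∩ cell → a ≠ b → a 2 ≠ b 2 :=
    fun ha hb h1 h2 => h1 (eq_of_apply_two_eq hβ hu hv ha hb h2)
  by_contra! hcon
  rcases lt_or_gt_of_ne (hne ha hb hab) with h1 | h1 <;>
  rcases lt_or_gt_of_ne (hne hc ha hcon.1) with h2 | h2 <;>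
  rcases lt_or_gt_of_ne (hne hc hb hcon.2) with h3 | h3 <;>
  first
    | linarith
    | exact key ha hb hc ‹_› ‹_›
    | exact key ha hc hb ‹_› ‹_›
    | exact key hb ha hc ‹_› ‹_›
    | exact key hb hc ha ‹_› ‹_›
    | exact key hc ha hb ‹_› ‹_›
    | exact key hc hb ha ‹_› ‹_›

/-- Between two coexisting minimizers the path contains a strict saddle. -/
theorem exists_saddle (hβ : 0 < β) (huv : u ≤ v) (hv : v ≤ 0)
    (hν : ν ∈ minimizersOn β sortedSimplex (u, v))
    (hμ : μ ∈ minimizersOn β sortedSimplex (u, v)) (h : μ 2 < ν 2) :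
    ∃ m, 1 < m ∧ β * μ 2 < m ∧ m < β * ν 2 ∧ mass u v m = β ∧ gap u v m < 0 := by
  have hu := huv.trans hv
  have hν' := mem_localMinimizers_of_mem_minimizersOn huv hv hν
  have hμ' := mem_localMinimizers_of_mem_minimizersOn huv hv hμ
  obtain ⟨hc, h0, h1⟩ := candidate_of_mem_localMinimizers hβ hν' hu hv
  obtain ⟨hc', h0', h1'⟩ := candidate_of_mem_localMinimizers hβ hμ' hu hv
  have e := tiltedEnergy_eq_pathEnergy hβ hu hv (pos_of_mem_localMinimizers hν'.1 2)
    hc.mass_eq h0 h1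
  have e' := tiltedEnergy_eq_pathEnergy hβ hu hv (pos_of_mem_localMinimizers hμ'.1 2)
    hc'.mass_eq h0' h1'
  have heq : tiltedEnergy β (u, v) ν = tiltedEnergy β (u, v) μ :=
    le_antisymm (hν.2 μ hμ.1) (hμ.2 ν hν.1)
  rw [heq] at e
  obtain ⟨m, h1, h2, h3, h4⟩ := hc'.exists_saddle huv hv hc
    (mul_lt_mul_of_pos_left h hβ) (by linarith)
  exact ⟨m, h1, h2.1, h2.2, h3, h4⟩

/-! ### Counting global minimizers -/

/-- For fields with a unique largest component all global minimizers are in the cell. -/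
theorem globalMinimizers_eq_of_neg (hβ : 0 < β) (huv : u ≤ v) (hv : v < 0) :
    globalMinimizers β (fieldOfUV u v) = minimizersOn β sortedSimplex (u, v) := by
  ext ν
  rw [mem_minimizersOn_sortedSimplex huv hv.le]
  refine ⟨fun h => ⟨h, ?_⟩, fun h => h.1⟩
  have hm := monovary_of_mem_globalMinimizers huv hv.le h
  have h12 : ν 1 ≤ ν 2 := hm (i := 1) (j := 2) (by simpa using hv)
  refine ⟨?_, h12⟩
  rcases huv.lt_or_eq with huv' | rfl
  · exact hm (i := 0) (j := 1) (by simpa using huv')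
  · by_contra! hlt
    have h02 : ν 0 ≤ ν 2 := hm (i := 0) (j := 2) (by simpa using hv)
    have hf : fieldOfUV u u ∘ Equiv.swap 0 1 = fieldOfUV u u := by
      ext i; fin_cases i <;> simp [fieldOfUV, Equiv.swap_apply_def]
    have h1 := comp_perm_mem_globalMinimizers (Equiv.swap 0 1) h
    rw [hf] at h1
    have h2 := (mem_minimizersOn_sortedSimplex (β := β) huv hv.le).2 ⟨h1, by
      constructor
      · simpa [Equiv.swap_apply_def] using hlt.le
      · simpa [Equiv.swap_apply_def] using h02⟩
    obtain ⟨-, e0, e1⟩ := candidate_of_mem_localMinimizers hβ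
      (mem_localMinimizers_of_mem_minimizersOn huv hv.le h2) hv.le hv.le
    have := mul_left_cancel₀ hβ.ne' (e0.trans e1.symm)
    simp at this
    linarith

/-- For fields with two equal largest components, the global minimizers are those in the cell
and their mirror images. -/
theorem globalMinimizers_eq_of_axis (hu : u < 0) :
    globalMinimizers β (fieldOfUV u 0) = minimizersOn β sortedSimplex (u, 0) ∪
      (fun ν => ν ∘ Equiv.swap 1 2) '' minimizersOn β sortedSimplex (u, 0) := by
  have hf : fieldOfUV u 0 ∘ Equiv.swap 1 2 = fieldOfUV u 0 := by
    ext i; fin_cases i <;> simp [fieldOfUV, Equiv.swap_apply_def]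
  ext ν
  constructor
  · intro h
    have hm := monovary_of_mem_globalMinimizers hu.le le_rfl h
    have h01 : ν 0 ≤ ν 1 := hm (i := 0) (j := 1) (by simpa using hu)
    have h02 : ν 0 ≤ ν 2 := hm (i := 0) (j := 2) (by simpa using hu)
    rcases le_total (ν 1) (ν 2) with h12 | h12
    · exact Or.inl ((mem_minimizersOn_sortedSimplex hu.le le_rfl).2 ⟨h, h01, h12⟩)
    · refine Or.inr ⟨ν ∘ Equiv.swap 1 2, (mem_minimizersOn_sortedSimplex hu.le le_rfl).2
        ⟨?_, ?_⟩, by ext i; simp⟩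
      · have := comp_perm_mem_globalMinimizers (Equiv.swap 1 2) h
        rwa [hf] at this
      · constructor
        · simpa [Equiv.swap_apply_def] using h02
        · simpa [Equiv.swap_apply_def] using h12
  · rintro (h | ⟨μ, h, rfl⟩)
    · exact ((mem_minimizersOn_sortedSimplex hu.le le_rfl).1 h).1
    · have := comp_perm_mem_globalMinimizers (Equiv.swap 1 2)
        ((mem_minimizersOn_sortedSimplex hu.le le_rfl).1 h).1
      rwa [hf] at this

/-- For the uniform field, the global minimizers are the images of those in the cell. -/
theorem globalMinimizers_eq_of_zero :
    globalMinimizers β (fieldOfUV 0 0) = {ν | ∃ σ : Equiv.Perm (Fin 3),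
      ∃ μ ∈ minimizersOn β sortedSimplex (0, 0), ν = μ ∘ σ} := by
  have hf : ∀ σ : Equiv.Perm (Fin 3), fieldOfUV 0 0 ∘ σ = fieldOfUV 0 0 := by
    have : fieldOfUV 0 0 = fun _ => 1 / (1 + 1 + 1) := by
      ext i; fin_cases i <;> simp [fieldOfUV]
    intro σ; rw [this]; rfl
  ext ν
  constructor
  · intro h
    refine ⟨(Tuple.sort ν)⁻¹, ν ∘ Tuple.sort ν, (mem_minimizersOn_sortedSimplex le_rfl le_rfl).2
      ⟨?_, mem_cell_iff_monotone.2 (Tuple.monotone_sort ν)⟩, by ext i; simp⟩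
    have := comp_perm_mem_globalMinimizers (Tuple.sort ν) h
    rwa [hf] at this
  · rintro ⟨σ, μ, hμ, rfl⟩
    have := comp_perm_mem_globalMinimizers σ
      ((mem_minimizersOn_sortedSimplex le_rfl le_rfl).1 hμ).1
    rwa [hf] at this

end

section

variable {β u v : ℝ} {ν μ : Fin 3 → ℝ}

/-! ### Switching between phases -/

/-- The global minimizers in the closed fundamental cell, for the field with coordinates `y` in
the wedge `y.1 ≤ y.2 ≤ 0`. -/
abbrev groundStates (β : ℝ) (y : ℝ × ℝ) : Set (Fin 3 → ℝ) := minimizersOn β sortedSimplex y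

theorem groundStates_nonempty (y : ℝ × ℝ) : (groundStates β y).Nonempty :=
  minimizersOn_nonempty isCompact_sortedSimplex sortedSimplex_nonempty y

theorem isClosed_setOf_le_apply (m : ℝ) (i : Fin 3) : IsClosed {ν : Fin 3 → ℝ | m ≤ β * ν i} :=
  isClosed_le continuous_const (continuous_const.mul (continuous_apply i))

theorem isClosed_setOf_apply_le (m : ℝ) (i : Fin 3) : IsClosed {ν : Fin 3 → ℝ | β * ν i ≤ m} :=
  isClosed_le (continuous_const.mul (continuous_apply i)) continuous_const

/-- Along a path on which a functional `ℓ` of the minimizers `M s` is monotone, phases with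
smaller `ℓ` do not reappear after a phase `L` with larger `ℓ` has been present. -/
theorem notMem_of_switch {X : Type*} {M : ℝ → Set X} {U L : Set X} {ℓ : X → ℝ}
    (hcov : ∀ s ∈ Icc (0 : ℝ) 1, (M s ∩ U).Nonempty ∨ (M s ∩ L).Nonempty)
    (hU : ∀ c, IsClosed {s | (M s ∩ (U ∩ {x | c ≤ ℓ x})).Nonempty})
    (hL : ∀ c, IsClosed {s | (M s ∩ (L ∩ {x | ℓ x ≤ c})).Nonempty})
    (hmono : ∀ s ∈ Icc (0 : ℝ) 1, ∀ t ∈ Icc (0 : ℝ) 1, s < t →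
      ∀ a ∈ M s, ∀ b ∈ M t, ℓ a ≤ ℓ b)
    (hcomp : ∀ s ∈ Icc (0 : ℝ) 1, ∀ a ∈ M s ∩ U, ∀ b ∈ M s ∩ L, ℓ a < ℓ b)
    (h0 : (M 0 ∩ L).Nonempty) : ∀ a ∈ M 1, a ∉ U := by
  intro a₁ ha₁ hU₁
  obtain ⟨μ₀, hμ₀⟩ := h0
  have hT : IsCompact (Icc (0 : ℝ) 1 ∩ {s | (M s ∩ (U ∩ {x | ℓ μ₀ ≤ ℓ x})).Nonempty}) :=
    isCompact_Icc.inter_right (hU _)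
  have h1 : (1 : ℝ) ∈ Icc (0 : ℝ) 1 := right_mem_Icc.2 zero_le_one
  have h0' : (0 : ℝ) ∈ Icc (0 : ℝ) 1 := left_mem_Icc.2 zero_le_one
  obtain ⟨s, ⟨hs, a, ha, haU, hal⟩, hleast⟩ := hT.exists_isLeast
    ⟨1, h1, a₁, ha₁, hU₁, hmono 0 h0' 1 h1 one_pos _ hμ₀.1 _ ha₁⟩
  simp only [mem_ofPred_eq] at hal
  have hs0 : 0 < s := hs.1.lt_of_ne (by
    rintro rfl
    linarith [hcomp 0 h0' a ⟨ha, haU⟩ μ₀ hμ₀])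
  have hsub : Ioo 0 s ⊆ {t | (M t ∩ (L ∩ {x | ℓ x ≤ ℓ a})).Nonempty} := by
    intro t ht
    have htI : t ∈ Icc (0 : ℝ) 1 := ⟨ht.1.le, ht.2.le.trans hs.2⟩
    rcases hcov t htI with ⟨b, hb, hbU⟩ | ⟨b, hb, hbL⟩
    · have := hleast ⟨htI, b, hb, hbU, hmono 0 h0' t htI ht.1 _ hμ₀.1 _ hb⟩
      linarith [ht.2]
    · exact ⟨b, hb, hbL, hmono t htI s hs ht.2 _ hb _ ha⟩
  have hmem : s ∈ closure (Ioo 0 s) := by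
    rw [closure_Ioo hs0.ne]; exact right_mem_Icc.2 hs0.le
  obtain ⟨b, hb, hbL, hbl⟩ := closure_minimal hsub (hL _) hmem
  simp only [mem_ofPred_eq] at hbl
  linarith [hcomp s hs a ⟨ha, haU⟩ b ⟨hb, hbL⟩]

/-- Minimizers for two fields are monotone in the direction of the field. -/
theorem groundStates_monotone {y y' : ℝ × ℝ} {a b : Fin 3 → ℝ} (ha : a ∈ groundStates β y)
    (hb : b ∈ groundStates β y') :
    0 ≤ (y'.1 - y.1) * (b 0 - a 0) + (y'.2 - y.2) * (b 1 - a 1) := by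
  have h1 := ha.2 b hb.1
  have h2 := hb.2 a ha.1
  unfold tiltedEnergy at h1 h2
  linarith

/-- `notMem_of_switch` for ground states along a segment of fields from `(u, v)` in direction
`(e₁, e₂)`. -/
theorem notMem_of_switch_segment {e₁ e₂ : ℝ} {U L : Set (Fin 3 → ℝ)} (hU : IsClosed U)
    (hL : IsClosed L)
    (hcov : ∀ s ∈ Icc (0 : ℝ) 1, ∀ a ∈ groundStates β (u + s * e₁, v + s * e₂), a ∈ U ∨ a ∈ L)
    (hcomp : ∀ s ∈ Icc (0 : ℝ) 1, ∀ a ∈ groundStates β (u + s * e₁, v + s * e₂),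
      ∀ b ∈ groundStates β (u + s * e₁, v + s * e₂), a ∈ U → b ∈ L →
        e₁ * a 0 + e₂ * a 1 < e₁ * b 0 + e₂ * b 1)
    (h0 : (groundStates β (u, v) ∩ L).Nonempty) :
    ∀ a ∈ groundStates β (u + e₁, v + e₂), a ∉ U := by
  have hγ : Continuous fun s : ℝ => (u + s * e₁, v + s * e₂) := by fun_prop
  have hℓ : Continuous fun x : Fin 3 → ℝ => e₁ * x 0 + e₂ * x 1 := by fun_prop
  have := notMem_of_switch (M := fun s => groundStates β (u + s * e₁, v + s * e₂)) (U := U)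
    (L := L) (ℓ := fun x => e₁ * x 0 + e₂ * x 1) ?_ ?_ ?_ ?_ ?_ ?_
  · simpa using this
  · intro s hs
    obtain ⟨a, ha⟩ := groundStates_nonempty (β := β) (u + s * e₁, v + s * e₂)
    exact (hcov s hs a ha).imp (fun h => ⟨a, ha, h⟩) (fun h => ⟨a, ha, h⟩)
  · intro c
    exact (isClosed_setOf_minimizersOn_inter isCompact_sortedSimplex
      (hU.inter (isClosed_le continuous_const hℓ))).preimage hγ
  · intro c
    exact (isClosed_setOf_minimizersOn_inter isCompact_sortedSimplex
      (hL.inter (isClosed_le hℓ continuous_const))).preimage hγ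
  · intro s _ t _ hst a ha b hb
    have := groundStates_monotone ha hb
    simp only at this ⊢
    have h2 : 0 ≤ (t - s) * ((e₁ * b 0 + e₂ * b 1) - (e₁ * a 0 + e₂ * a 1)) := by linarith
    have := nonneg_of_mul_nonneg_right h2 (by linarith)
    linarith
  · intro s hs a ha b hb
    exact hcomp s hs a ha.1 b hb.1 ha.2 hb.2
  · simpa using h0

/-- A point of the path that does not have mass `β`, or is unstable, is not a minimizer. -/
theorem mul_apply_two_ne (hβ : 0 < β) (huv : u ≤ v) (hv : v ≤ 0) {m : ℝ} (hm : 1 < m)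
    (h : mass u v m ≠ β ∨ gap u v m < 0) (hν : ν ∈ groundStates β (u, v)) : β * ν 2 ≠ m := by
  rintro rfl
  obtain ⟨hc, -, -⟩ := candidate_of_mem_localMinimizers hβ
    (mem_localMinimizers_of_mem_minimizersOn huv hv hν) (huv.trans hv) hv
  rcases h with h | h
  · exact h hc.mass_eq
  · linarith [hc.gap_nonneg hm]

theorem lt_of_groundStates_lt (hβ : 0 < β) (huv : u ≤ v) (hv : v ≤ 0)
    (hν : ν ∈ groundStates β (u, v)) (hμ : μ ∈ groundStates β (u, v)) (h : μ 2 < ν 2) :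
    ν 0 < μ 0 ∧ ν 1 < μ 1 ∧ 1 < β * ν 2 :=
  lt_of_apply_two_lt hβ (huv.trans hv) hv (mem_localMinimizers_of_mem_minimizersOn huv hv hν)
    (mem_localMinimizers_of_mem_minimizersOn huv hv hμ) h

section Switch

variable {u' v' m : ℝ}

/-- Increasing the field from a point with saddle `m` selects the phases below the saddle: the
saddle value `m` has mass different from `β` for all larger fields, hence separates the phases. -/
theorem lt_saddle_of_le (hβ : 0 < β) (huv : u ≤ v) (hm : 1 < m) (hmass : mass u v m = β)
    (hgap : gap u v m < 0) (hu : u ≤ u') (hv : v ≤ v') (hne : u < u' ∨ v < v')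
    (huv' : u' ≤ v') (hv' : v' ≤ 0) (hμ : μ ∈ groundStates β (u, v)) (hμm : β * μ 2 ≤ m)
    (hν : ν ∈ groundStates β (u', v')) : β * ν 2 < m := by
  have hv0 := hv.trans hv'
  have hsep : ∀ s ∈ Icc (0 : ℝ) 1, ∀ a ∈ groundStates β (u + s * (u' - u), v + s * (v' - v)),
      u + s * (u' - u) ≤ v + s * (v' - v) ∧ v + s * (v' - v) ≤ 0 ∧ β * a 2 ≠ m := by
    intro s hs a ha
    have h1 : u + s * (u' - u) ≤ v + s * (v' - v) := by nlinarith [hs.1, hs.2]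
    have h2 : v + s * (v' - v) ≤ 0 := by nlinarith [hs.1, hs.2]
    refine ⟨h1, h2, mul_apply_two_ne hβ h1 h2 hm ?_ ha⟩
    rcases hs.1.eq_or_lt with rfl | hs0
    · right; simpa using hgap
    · left
      refine (hmass.symm.trans_lt (mass_lt_mass hm ?_ ?_ ?_ (h1.trans h2) h2)).ne'
      · nlinarith
      · nlinarith
      · exact hne.imp (fun h => by nlinarith) (fun h => by nlinarith)
  have := notMem_of_switch_segment (β := β) (u := u) (v := v) (e₁ := u' - u) (e₂ := v' - v)
    (U := {x | m ≤ β * x 2}) (L := {x | β * x 2 ≤ m}) (isClosed_setOf_le_apply m 2)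
    (isClosed_setOf_apply_le m 2) (fun s _ a _ => le_total m (β * a 2)) ?_ ⟨μ, hμ, hμm⟩ ν
    (by simpa using hν)
  · simpa using this
  · intro s hs a ha b hb haU hbL
    obtain ⟨h1, h2, hb2⟩ := hsep s hs b hb
    have hlt : b 2 < a 2 := lt_of_mul_lt_mul_left
      ((lt_of_le_of_ne hbL hb2).trans_le haU) hβ.le
    obtain ⟨h3, h4, -⟩ := lt_of_groundStates_lt hβ h1 h2 ha hb hlt
    rcases hne with h | h <;> nlinarith

/-- Decreasing the field from a point with saddle `m` selects the phases above the saddle. -/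
theorem saddle_lt_of_le (hβ : 0 < β) (huv : u ≤ v) (hv0 : v ≤ 0) (hm : 1 < m)
    (hmass : mass u v m = β)
    (hgap : gap u v m < 0) (hu : u' ≤ u) (hv : v' ≤ v) (hne : u' < u ∨ v' < v)
    (huv' : u' ≤ v') (hν : ν ∈ groundStates β (u, v)) (hνm : m ≤ β * ν 2)
    (hμ : μ ∈ groundStates β (u', v')) : m < β * μ 2 := by
  have hsep : ∀ s ∈ Icc (0 : ℝ) 1, ∀ a ∈ groundStates β (u + s * (u' - u), v + s * (v' - v)),
      u + s * (u' - u) ≤ v + s * (v' - v) ∧ v + s * (v' - v) ≤ 0 ∧ β * a 2 ≠ m := by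
    intro s hs a ha
    have h1 : u + s * (u' - u) ≤ v + s * (v' - v) := by nlinarith [hs.1, hs.2]
    have h2 : v + s * (v' - v) ≤ 0 := by nlinarith [hs.1, hs.2]
    refine ⟨h1, h2, mul_apply_two_ne hβ h1 h2 hm ?_ ha⟩
    rcases hs.1.eq_or_lt with rfl | hs0
    · right; simpa using hgap
    · left
      refine ((mass_lt_mass hm ?_ ?_ ?_ (huv.trans hv0) hv0).trans_eq hmass).ne
      · nlinarith
      · nlinarith
      · exact hne.imp (fun h => by nlinarith) (fun h => by nlinarith)
  have := notMem_of_switch_segment (β := β) (u := u) (v := v) (e₁ := u' - u) (e₂ := v' - v)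
    (L := {x | m ≤ β * x 2}) (U := {x | β * x 2 ≤ m}) (isClosed_setOf_apply_le m 2)
    (isClosed_setOf_le_apply m 2) (fun s _ a _ => le_total (β * a 2) m) ?_ ⟨ν, hν, hνm⟩ μ
    (by simpa using hμ)
  · simpa using this
  · intro s hs b hb a ha hbL haU
    obtain ⟨h1, h2, hb2⟩ := hsep s hs b hb
    have hlt : b 2 < a 2 := lt_of_mul_lt_mul_left
      ((lt_of_le_of_ne hbL hb2).trans_le haU) hβ.le
    obtain ⟨h3, h4, -⟩ := lt_of_groundStates_lt hβ h1 h2 ha hb hlt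
    rcases hne with h | h <;> nlinarith

end Switch

/-- If the minimizers along a path are covered by two closed sets and both sets occur, they occur
together somewhere. -/
theorem exists_mem_both {γ : ℝ → ℝ × ℝ} (hγ : Continuous γ) {a b : ℝ} (hab : a ≤ b)
    {A B : Set (Fin 3 → ℝ)} (hA : IsClosed A) (hB : IsClosed B)
    (hcov : ∀ t ∈ Icc a b, ∀ ν ∈ groundStates β (γ t), ν ∈ A ∨ ν ∈ B)
    (ha : (groundStates β (γ a) ∩ A).Nonempty) (hb : (groundStates β (γ b) ∩ B).Nonempty) :
    ∃ t ∈ Icc a b, (groundStates β (γ t) ∩ A).Nonempty ∧ (groundStates β (γ t) ∩ B).Nonempty := by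
  have hA' := (isClosed_setOf_minimizersOn_inter (β := β) isCompact_sortedSimplex hA).preimage hγ
  have hB' := (isClosed_setOf_minimizersOn_inter (β := β) isCompact_sortedSimplex hB).preimage hγ
  obtain ⟨t, ht, h1, h2⟩ := isPreconnected_closed_iff.1 (isPreconnected_Icc (a := a) (b := b))
    _ _ hA' hB' (fun t ht => by
      obtain ⟨ν, hν⟩ := groundStates_nonempty (β := β) (γ t)
      exact (hcov t ht ν hν).imp (fun h => ⟨ν, hν, h⟩) (fun h => ⟨ν, hν, h⟩))
    ⟨a, left_mem_Icc.2 hab, ha⟩ ⟨b, right_mem_Icc.2 hab, hb⟩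
  exact ⟨t, ht, h1, h2⟩

/-! ### The coexistence set -/

/-- The fields, in coordinates `(u, v)` in the wedge `u ≤ v ≤ 0`, with several global minimizers
in the closed fundamental cell. -/
def Coexist (β u v : ℝ) : Prop := u ≤ v ∧ v ≤ 0 ∧ (groundStates β (u, v)).Nontrivial

/-- `m` is a strict saddle that separates two coexisting global minimizers. -/
structure IsSaddle (β u v m : ℝ) : Prop where
  wedge_left : u ≤ v
  wedge_right : v ≤ 0
  one_lt : 1 < m
  mass_eq : mass u v m = β
  gap_neg : gap u v m < 0
  upper : ∃ ν ∈ groundStates β (u, v), m < β * ν 2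
  lower : ∃ μ ∈ groundStates β (u, v), β * μ 2 < m

theorem apply_two_ne (hβ : 0 < β) (huv : u ≤ v) (hv : v ≤ 0) (hν : ν ∈ groundStates β (u, v))
    (hμ : μ ∈ groundStates β (u, v)) (h : ν ≠ μ) : ν 2 ≠ μ 2 := fun h2 =>
  h (eq_of_apply_two_eq hβ (huv.trans hv) hv (mem_localMinimizers_of_mem_minimizersOn huv hv hν)
    (mem_localMinimizers_of_mem_minimizersOn huv hv hμ) h2)

theorem Coexist.exists_isSaddle (hβ : 0 < β) (h : Coexist β u v) : ∃ m, IsSaddle β u v m := by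
  obtain ⟨huv, hv, a, ha, b, hb, hab⟩ := h
  have key : ∀ {a b : Fin 3 → ℝ}, a ∈ groundStates β (u, v) → b ∈ groundStates β (u, v) →
      a 2 < b 2 → ∃ m, IsSaddle β u v m := by
    intro a b ha hb hlt
    obtain ⟨m, h1, h2, h3, h4, h5⟩ := exists_saddle hβ huv hv hb ha hlt
    exact ⟨m, huv, hv, h1, h4, h5, ⟨b, hb, h3⟩, ⟨a, ha, h2⟩⟩
  rcases lt_or_gt_of_ne (apply_two_ne hβ huv hv ha hb hab) with h | h
  · exact key ha hb h
  · exact key hb ha h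

theorem coexist_of_separated {m : ℝ} (huv : u ≤ v) (hv : v ≤ 0)
    (h1 : ∃ ν ∈ groundStates β (u, v), m < β * ν 2)
    (h2 : ∃ μ ∈ groundStates β (u, v), β * μ 2 < m) : Coexist β u v := by
  obtain ⟨ν, hν, hνm⟩ := h1
  obtain ⟨μ, hμ, hμm⟩ := h2
  exact ⟨huv, hv, ν, hν, μ, hμ, by rintro rfl; linarith⟩

/-- No two different points of the coexistence set are comparable. -/
theorem Coexist.antichain (hβ : 0 < β) {u' v' : ℝ} (h : Coexist β u v) (h' : Coexist β u' v')
    (hu : u ≤ u') (hv : v ≤ v') : u = u' ∧ v = v' := by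
  by_contra hne
  have hne' : u < u' ∨ v < v' := by
    by_contra! hcon
    exact hne ⟨le_antisymm hu hcon.1, le_antisymm hv hcon.2⟩
  obtain ⟨m, hm⟩ := h.exists_isSaddle hβ
  obtain ⟨m', hm'⟩ := h'.exists_isSaddle hβ
  obtain ⟨μ, hμ, hμm⟩ := hm.lower
  obtain ⟨b, hb, hbm⟩ := hm'.upper
  have hu' := hm'.wedge_left.trans hm'.wedge_right
  have h1 := lt_saddle_of_le hβ hm.wedge_left hm.one_lt hm.mass_eq hm.gap_neg hu hv hne'
    hm'.wedge_left hm'.wedge_right hμ hμm.le hb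
  have h2 := (gap_le_gap hm.one_lt hu hv hu' hm'.wedge_right).trans_lt hm.gap_neg
  have h3 := gap_neg_of_mem_Icc hm'.wedge_left hm'.wedge_right hm'.one_lt hm'.gap_neg h2
    hbm.le h1.le
  have h4 := (candidate_of_mem_localMinimizers hβ (mem_localMinimizers_of_mem_minimizersOn
    hm'.wedge_left hm'.wedge_right hb) hu' hm'.wedge_right).1.gap_nonneg (hm'.one_lt.trans hbm)
  linarith

theorem Coexist.right_unique (hβ : 0 < β) {v' : ℝ} (h : Coexist β u v) (h' : Coexist β u v') :
    v = v' := by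
  rcases le_total v v' with hv | hv
  · exact (h.antichain hβ h' le_rfl hv).2
  · exact (h'.antichain hβ h le_rfl hv).2.symm

theorem Coexist.lt_of_lt (hβ : 0 < β) {u' v' : ℝ} (h : Coexist β u v) (h' : Coexist β u' v')
    (hu : u < u') : v' < v := by
  by_contra! hv
  exact hu.ne (h.antichain hβ h' hu.le hv).1

/-- Moving a saddle along a vertical line: if `m` is never the largest coordinate of a minimizer
on the segment, and minimizers lie above `m` at the bottom and below `m` at the top, then phases
above and below `m` coexist somewhere. -/
theorem exists_separated_vertical {m v₁ v₂ : ℝ} (hv : v₁ ≤ v₂)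
    (hm : ∀ v ∈ Icc v₁ v₂, ∀ ν ∈ groundStates β (u, v), β * ν 2 ≠ m)
    (h1 : ∀ ν ∈ groundStates β (u, v₁), m ≤ β * ν 2)
    (h2 : ∀ ν ∈ groundStates β (u, v₂), β * ν 2 ≤ m) :
    ∃ v ∈ Icc v₁ v₂, (∃ ν ∈ groundStates β (u, v), m < β * ν 2) ∧
      ∃ μ ∈ groundStates β (u, v), β * μ 2 < m := by
  obtain ⟨a, ha⟩ := groundStates_nonempty (β := β) (u, v₁)
  obtain ⟨b, hb⟩ := groundStates_nonempty (β := β) (u, v₂)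
  obtain ⟨v, hv, ⟨ν, hν, hνm⟩, μ, hμ, hμm⟩ := exists_mem_both (β := β) (γ := fun v => (u, v))
    (by fun_prop) hv (A := {x | m ≤ β * x 2}) (B := {x | β * x 2 ≤ m})
    (isClosed_setOf_le_apply m 2) (isClosed_setOf_apply_le m 2)
    (fun _ _ x _ => le_total m (β * x 2)) ⟨a, ha, h1 a ha⟩ ⟨b, hb, h2 b hb⟩
  exact ⟨v, hv, ⟨ν, hν, lt_of_le_of_ne hνm (hm v hv ν hν).symm⟩,
    ⟨μ, hμ, lt_of_le_of_ne hμm (hm v hv μ hμ)⟩⟩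

/-- Spreading the two lower coordinates at fixed mass makes a path point less stable, because
the odds are a convex function of the coordinate. -/
theorem gap_le_of_mass_eq {m u₁ v₁ : ℝ} (hm : 1 < m) (hu : u ≤ u₁) (huv : u₁ ≤ v₁) (hv : v₁ ≤ v)
    (hv0 : v ≤ 0) (h : mass u v m = mass u₁ v₁ m) : gap u v m ≤ gap u₁ v₁ m := by
  have hm0 : 0 < m := by linarith
  have l1 := low_mono (add_le_add_right hu (ell m))
  have l2 := low_mono (add_le_add_right huv (ell m))
  have l3 := low_mono (add_le_add_right hv (ell m))
  have k : low (ell m + v) < 1 := low_lt_one (ell_add_lt hm0 hm.ne' hv0)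
  have k0 := low_pos (ell m + u)
  unfold mass at h
  unfold gap odds
  generalize low (ell m + u) = x at *
  generalize low (ell m + v) = y at *
  generalize low (ell m + u₁) = x₁ at *
  generalize low (ell m + v₁) = y₁ at *
  have hs : x + y = x₁ + y₁ := by linarith
  have key : x₁ / (1 - x₁) + y₁ / (1 - y₁) ≤ x / (1 - x) + y / (1 - y) := by
    have hP : x * y ≤ x₁ * y₁ := by
      obtain rfl : y = x₁ + y₁ - x := by linarith
      nlinarith [mul_nonneg (sub_nonneg.2 l1) (show 0 ≤ y₁ - x by linarith)]
    rw [div_add_div _ _ (by linarith) (by linarith), div_add_div _ _ (by linarith) (by linarith),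
      div_le_div_iff₀ (mul_pos (by linarith) (by linarith))
        (mul_pos (by linarith) (by linarith))]
    have e1 : x₁ * (1 - y₁) + (1 - x₁) * y₁ = (x + y) - 2 * (x₁ * y₁) := by rw [hs]; ring
    have e2 : x * (1 - y) + (1 - x) * y = (x + y) - 2 * (x * y) := by ring
    have e3 : (1 - x₁) * (1 - y₁) = 1 - (x + y) + x₁ * y₁ := by rw [hs]; ring
    have e4 : (1 - x) * (1 - y) = 1 - (x + y) + x * y := by ring
    rw [e1, e2, e3, e4]
    have : x + y < 2 := by linarith
    nlinarith
  linarith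

/-- The coexistence set over the abscissas to the left of one of its points is complete as long
as only phases with `β ν 2 ≤ 1` occur on the axis `v = 0`. -/
theorem Coexist.exists_left (hβ : 0 < β) {u₁ v₁ : ℝ} (h : Coexist β u₁ v₁) (hu : u < u₁)
    (haxis : ∀ ν ∈ groundStates β (u, 0), β * ν 2 ≤ 1) : ∃ v, Coexist β u v := by
  obtain ⟨m, hm⟩ := h.exists_isSaddle hβ
  obtain ⟨a, ha, ham⟩ := hm.upper
  have huv₁ := hm.wedge_left
  have hv₁ := hm.wedge_right
  obtain ⟨v, hv, h1, h2⟩ := exists_separated_vertical (β := β) (u := u) (m := m) hv₁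
    (fun v hv ν hν => by
      have huv : u ≤ v := hu.le.trans (huv₁.trans hv.1)
      refine mul_apply_two_ne hβ huv hv.2 hm.one_lt ?_ hν
      by_cases hmass : mass u v m = β
      · right
        exact (gap_le_of_mass_eq hm.one_lt hu.le huv₁ hv.1 hv.2
          (hmass.trans hm.mass_eq.symm)).trans_lt hm.gap_neg
      · exact Or.inl hmass)
    (fun ν hν => (saddle_lt_of_le hβ huv₁ hv₁ hm.one_lt hm.mass_eq hm.gap_neg hu.le le_rfl
      (Or.inl hu) (hu.le.trans huv₁) ha ham.le hν).le)
    (fun ν hν => (haxis ν hν).trans hm.one_lt.le)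
  exact ⟨v, coexist_of_separated (hu.le.trans (huv₁.trans hv.1)) hv.2 h1 h2⟩

theorem eventually_gap_neg {m : ℝ} (hm : 1 < m) (hu : u ≤ 0) (hv : v ≤ 0)
    (h : gap u v m < 0) : ∀ᶠ y : ℝ × ℝ in 𝓝 (u, v), gap y.1 y.2 m < 0 := by
  have hm0 : 0 < m := by linarith
  have hc : ContinuousAt (fun y : ℝ × ℝ => gap y.1 y.2 m) (u, v) := by
    have h1 : ContinuousAt (fun y : ℝ × ℝ => odds (ell m + y.1)) (u, v) :=
      ContinuousAt.comp (f := fun y : ℝ × ℝ => ell m + y.1)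
        (continuousAt_odds (ell_add_lt hm0 hm.ne' hu)) (by fun_prop)
    have h2 : ContinuousAt (fun y : ℝ × ℝ => odds (ell m + y.2)) (u, v) :=
      ContinuousAt.comp (f := fun y : ℝ × ℝ => ell m + y.2)
        (continuousAt_odds (ell_add_lt hm0 hm.ne' hv)) (by fun_prop)
    exact (continuousAt_const.sub h1).sub h2
  exact hc.eventually (gt_mem_nhds h)

theorem IsSaddle.exists_box {m : ℝ} (h : IsSaddle β u v m) : ∃ r > 0, ∀ u' v', |u' - u| < r →
    |v' - v| < r → gap u' v' m < 0 := by
  obtain ⟨r, hr, h⟩ := Metric.eventually_nhds_iff.1 (eventually_gap_neg h.one_lt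
    (h.wedge_left.trans h.wedge_right) h.wedge_right h.gap_neg)
  refine ⟨r, hr, fun u' v' h1 h2 => h (y := (u', v')) ?_⟩
  rw [Prod.dist_eq, max_lt_iff]
  exact ⟨h1, h2⟩

theorem eventually_forall_lt {m w : ℝ} (h : ∀ ν ∈ groundStates β (u, w), β * ν 2 < m) :
    ∃ ε > 0, ∀ u', |u' - u| < ε → ∀ ν ∈ groundStates β (u', w), β * ν 2 < m := by
  have hγ : Continuous fun t : ℝ => (t, w) := by fun_prop
  have hcl := (isClosed_setOf_minimizersOn_inter (β := β) isCompact_sortedSimplex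
    (isClosed_setOf_le_apply (β := β) m 2)).preimage hγ
  obtain ⟨ε, hε, hε'⟩ := Metric.isOpen_iff.1 hcl.isOpen_compl u (by
    rintro ⟨ν, hν, hνm⟩
    exact absurd (h ν hν) (not_lt.2 hνm))
  refine ⟨ε, hε, fun u' hu' ν hν => ?_⟩
  by_contra! hcon
  exact hε' (show u' ∈ Metric.ball u ε from hu') ⟨ν, hν, hcon⟩

theorem eventually_forall_gt {m w : ℝ} (h : ∀ ν ∈ groundStates β (u, w), m < β * ν 2) :
    ∃ ε > 0, ∀ u', |u' - u| < ε → ∀ ν ∈ groundStates β (u', w), m < β * ν 2 := by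
  have hγ : Continuous fun t : ℝ => (t, w) := by fun_prop
  have hcl := (isClosed_setOf_minimizersOn_inter (β := β) isCompact_sortedSimplex
    (isClosed_setOf_apply_le (β := β) m 2)).preimage hγ
  obtain ⟨ε, hε, hε'⟩ := Metric.isOpen_iff.1 hcl.isOpen_compl u (by
    rintro ⟨ν, hν, hνm⟩
    exact absurd (h ν hν) (not_lt.2 hνm))
  refine ⟨ε, hε, fun u' hu' ν hν => ?_⟩
  by_contra! hcon
  exact hε' (show u' ∈ Metric.ball u ε from hu') ⟨ν, hν, hcon⟩

/-- Near a coexistence point off the diagonal, coexistence continues to the right. -/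
theorem IsSaddle.exists_right (hβ : 0 < β) {m : ℝ} (h : IsSaddle β u v m) (huv : u < v)
    {η : ℝ} (hη : 0 < η) : ∃ ε > 0, ∀ u', u < u' → u' < u + ε → ∃ v' ∈ Icc (v - η) v, u' ≤ v' ∧
      (∃ ν ∈ groundStates β (u', v'), m < β * ν 2) ∧
      ∃ μ ∈ groundStates β (u', v'), β * μ 2 < m := by
  obtain ⟨r, hr, hbox⟩ := h.exists_box
  obtain ⟨a, ha, ham⟩ := h.upper
  obtain ⟨b, hb, hbm⟩ := h.lower
  set ρ := min (min η ((v - u) / 2)) (r / 2) with hρ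
  have hρ0 : 0 < ρ := lt_min (lt_min hη (by linarith)) (by linarith)
  have hρη : ρ ≤ η := (min_le_left _ _).trans (min_le_left _ _)
  have hρu : ρ ≤ (v - u) / 2 := (min_le_left _ _).trans (min_le_right _ _)
  have hρr : ρ ≤ r / 2 := min_le_right _ _
  obtain ⟨ε, hε, hε'⟩ := eventually_forall_gt (β := β) (u := u) (m := m) (w := v - ρ)
    (fun ν hν => saddle_lt_of_le hβ huv.le h.wedge_right h.one_lt h.mass_eq h.gap_neg le_rfl
      (by linarith) (Or.inr (by linarith)) (by linarith) ha ham.le hν)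
  refine ⟨min ε (min ρ r), lt_min hε (lt_min hρ0 hr), fun u' hu hu' => ?_⟩
  have h1 : u' < u + ε := hu'.trans_le (by linarith [min_le_left ε (min ρ r)])
  have h2 : u' < u + ρ := hu'.trans_le (by
    linarith [(min_le_right ε (min ρ r)).trans (min_le_left ρ r)])
  have h3 : u' < u + r := hu'.trans_le (by
    linarith [(min_le_right ε (min ρ r)).trans (min_le_right ρ r)])
  obtain ⟨v', hv', h4, h5⟩ := exists_separated_vertical (β := β) (u := u') (m := m)
    (v₁ := v - ρ) (v₂ := v) (by linarith)
    (fun w hw ν hν => mul_apply_two_ne hβ (by linarith [hw.1]) (hw.2.trans h.wedge_right)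
      h.one_lt (Or.inr (hbox u' w (by rw [abs_lt]; constructor <;> linarith)
        (by rw [abs_lt]; constructor <;> linarith [hw.1, hw.2]))) hν)
    (fun ν hν => (hε' u' (by rw [abs_lt]; constructor <;> linarith) ν hν).le)
    (fun ν hν => (lt_saddle_of_le hβ huv.le h.one_lt h.mass_eq h.gap_neg hu.le le_rfl
      (Or.inl hu) (by linarith) h.wedge_right hb hbm.le hν).le)
  exact ⟨v', ⟨by linarith [hv'.1], hv'.2⟩, by linarith [hv'.1], h4, h5⟩

/-- Near a coexistence point off the axis, coexistence continues to the left. -/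
theorem IsSaddle.exists_left (hβ : 0 < β) {m : ℝ} (h : IsSaddle β u v m) (hv : v < 0)
    {η : ℝ} (hη : 0 < η) : ∃ ε > 0, ∀ u', u - ε < u' → u' < u → ∃ v' ∈ Icc v (v + η), u' ≤ v' ∧
      v' ≤ 0 ∧ (∃ ν ∈ groundStates β (u', v'), m < β * ν 2) ∧
      ∃ μ ∈ groundStates β (u', v'), β * μ 2 < m := by
  obtain ⟨r, hr, hbox⟩ := h.exists_box
  obtain ⟨a, ha, ham⟩ := h.upper
  obtain ⟨b, hb, hbm⟩ := h.lower
  have huv := h.wedge_left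
  set ρ := min (min η (-v)) (r / 2) with hρ
  have hρ0 : 0 < ρ := lt_min (lt_min hη (by linarith)) (by linarith)
  have hρη : ρ ≤ η := (min_le_left _ _).trans (min_le_left _ _)
  have hρu : ρ ≤ -v := (min_le_left _ _).trans (min_le_right _ _)
  have hρr : ρ ≤ r / 2 := min_le_right _ _
  obtain ⟨ε, hε, hε'⟩ := eventually_forall_lt (β := β) (u := u) (m := m) (w := v + ρ)
    (fun ν hν => lt_saddle_of_le hβ huv h.one_lt h.mass_eq h.gap_neg le_rfl
      (by linarith) (Or.inr (by linarith)) (by linarith) (by linarith) hb hbm.le hν)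
  refine ⟨min ε r, lt_min hε hr, fun u' hu' hu => ?_⟩
  have h1 : u - ε < u' := lt_of_le_of_lt (by linarith [min_le_left ε r]) hu'
  have h3 : u - r < u' := lt_of_le_of_lt (by linarith [min_le_right ε r]) hu'
  obtain ⟨v', hv', h4, h5⟩ := exists_separated_vertical (β := β) (u := u') (m := m)
    (v₁ := v) (v₂ := v + ρ) (by linarith)
    (fun w hw ν hν => mul_apply_two_ne hβ (by linarith [hw.1]) (by linarith [hw.2])
      h.one_lt (Or.inr (hbox u' w (by rw [abs_lt]; constructor <;> linarith)
        (by rw [abs_lt]; constructor <;> linarith [hw.1, hw.2]))) hν)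
    (fun ν hν => (saddle_lt_of_le hβ huv h.wedge_right h.one_lt h.mass_eq h.gap_neg hu.le le_rfl
      (Or.inl hu) (by linarith) ha ham.le hν).le)
    (fun ν hν => (hε' u' (by rw [abs_lt]; constructor <;> linarith) ν hν).le)
  exact ⟨v', ⟨hv'.1, by linarith [hv'.2]⟩, by linarith [hv'.1], by linarith [hv'.2], h4, h5⟩

/-- The coexistence set is locally the graph of a continuous function, and the saddle of one of
its points separates the phases at nearby points. -/
theorem IsSaddle.exists_nhds (hβ : 0 < β) {m : ℝ} (h : IsSaddle β u v m) {η : ℝ} (hη : 0 < η) :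
    ∃ ε > 0, ∀ u' v', Coexist β u' v' → |u' - u| < ε → |v' - v| ≤ η ∧
      (∃ ν ∈ groundStates β (u', v'), m < β * ν 2) ∧
      ∃ μ ∈ groundStates β (u', v'), β * μ 2 < m := by
  have hco : Coexist β u v := coexist_of_separated h.wedge_left h.wedge_right h.upper h.lower
  obtain ⟨ε₁, hε₁, hr⟩ : ∃ ε > 0, ∀ u' v', Coexist β u' v' → u < u' → u' < u + ε →
      |v' - v| ≤ η ∧ (∃ ν ∈ groundStates β (u', v'), m < β * ν 2) ∧
      ∃ μ ∈ groundStates β (u', v'), β * μ 2 < m := by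
    rcases h.wedge_left.eq_or_lt with huv | huv
    · refine ⟨1, one_pos, fun u' v' h' hu _ => ?_⟩
      linarith [hco.lt_of_lt hβ h' hu, h'.1]
    · obtain ⟨ε, hε, hR⟩ := h.exists_right hβ huv hη
      refine ⟨ε, hε, fun u' v' h' hu hu' => ?_⟩
      obtain ⟨w, hw, huw, h1, h2⟩ := hR u' hu hu'
      obtain rfl := h'.right_unique hβ
        (coexist_of_separated huw (hw.2.trans h.wedge_right) h1 h2)
      exact ⟨by rw [abs_le]; constructor <;> linarith [hw.1, hw.2], h1, h2⟩
  obtain ⟨ε₂, hε₂, hl⟩ : ∃ ε > 0, ∀ u' v', Coexist β u' v' → u - ε < u' → u' < u →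
      |v' - v| ≤ η ∧ (∃ ν ∈ groundStates β (u', v'), m < β * ν 2) ∧
      ∃ μ ∈ groundStates β (u', v'), β * μ 2 < m := by
    rcases h.wedge_right.eq_or_lt with hv | hv
    · refine ⟨1, one_pos, fun u' v' h' _ hu => ?_⟩
      linarith [h'.lt_of_lt hβ hco hu, h'.2.1]
    · obtain ⟨ε, hε, hL⟩ := h.exists_left hβ hv hη
      refine ⟨ε, hε, fun u' v' h' hu' hu => ?_⟩
      obtain ⟨w, hw, huw, hw0, h1, h2⟩ := hL u' hu' hu
      obtain rfl := h'.right_unique hβ (coexist_of_separated huw hw0 h1 h2)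
      exact ⟨by rw [abs_le]; constructor <;> linarith [hw.1, hw.2], h1, h2⟩
  refine ⟨min ε₁ ε₂, lt_min hε₁ hε₂, fun u' v' h' hu => ?_⟩
  obtain ⟨hu1, hu2⟩ := abs_lt.1 hu
  have := min_le_left ε₁ ε₂
  have := min_le_right ε₁ ε₂
  rcases lt_trichotomy u' u with hlt | rfl | hlt
  · exact hl u' v' h' (by linarith) hlt
  · obtain rfl := hco.right_unique hβ h'
    exact ⟨by simpa using hη.le, h.upper, h.lower⟩
  · exact hr u' v' h' hlt (by linarith)

end

section

variable {β u v : ℝ} {ν μ : Fin 3 → ℝ}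

/-! ### The differential equation of the coexistence curve -/

/-- A function whose increments lie between `(y - x) * g y` and `(y - x) * h y` is differentiable
if `g` and `h` have a common limit. -/
theorem hasDerivWithinAt_of_between {f g h : ℝ → ℝ} {s : Set ℝ} {x d : ℝ}
    (hg : Tendsto g (𝓝[s \ {x}] x) (𝓝 d)) (hh : Tendsto h (𝓝[s \ {x}] x) (𝓝 d))
    (hb : ∀ᶠ y in 𝓝[s \ {x}] x, (y - x) * g y ≤ f y - f x ∧ f y - f x ≤ (y - x) * h y) :
    HasDerivWithinAt f d s x := by
  rw [hasDerivWithinAt_iff_tendsto_slope]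
  have h1 := hg.min hh
  have h2 := hg.max hh
  rw [min_self] at h1
  rw [max_self] at h2
  have hne : ∀ᶠ y in 𝓝[s \ {x}] x, y ≠ x :=
    eventually_mem_nhdsWithin.mono fun y hy => hy.2
  refine tendsto_of_tendsto_of_tendsto_of_le_of_le' h1 h2 ?_ ?_
  · filter_upwards [hb, hne] with y hy hyx
    rw [slope_def_field]
    rcases lt_or_gt_of_ne hyx with hlt | hlt
    · refine (min_le_right _ _).trans ?_
      rw [le_div_iff_of_neg (by linarith)]
      linarith [hy.2]
    · refine (min_le_left _ _).trans ?_
      rw [le_div_iff₀ (by linarith)]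
      linarith [hy.1]
  · filter_upwards [hb, hne] with y hy hyx
    rw [slope_def_field]
    rcases lt_or_gt_of_ne hyx with hlt | hlt
    · refine le_trans ?_ (le_max_left _ _)
      rw [div_le_iff_of_neg (by linarith)]
      linarith [hy.1]
    · refine le_trans ?_ (le_max_right _ _)
      rw [div_le_iff₀ (by linarith)]
      linarith [hy.2]

/-- Minimizers over a compact set converge to a minimizer that is unique in the limit. -/
theorem tendsto_of_minimizersOn {ι : Type*} {l : Filter ι} {γ : ι → ℝ × ℝ} {x : ι → Fin 3 → ℝ}
    {C A : Set (Fin 3 → ℝ)} (hC : IsCompact C) (hA : IsClosed A) {y : ℝ × ℝ} {a : Fin 3 → ℝ}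
    (hγ : Tendsto γ l (𝓝 y)) (hx : ∀ᶠ t in l, x t ∈ minimizersOn β C (γ t) ∩ A)
    (huniq : ∀ b ∈ minimizersOn β C y ∩ A, b = a) : Tendsto x l (𝓝 a) := by
  rw [tendsto_nhds]
  intro U hU ha
  have hcl := isClosed_setOf_minimizersOn_inter (β := β) hC (hA.inter hU.isClosed_compl)
  have hy : y ∉ {y | (minimizersOn β C y ∩ (A ∩ Uᶜ)).Nonempty} := by
    rintro ⟨b, hb, hbA, hbU⟩
    exact hbU (huniq b ⟨hb, hbA⟩ ▸ ha)
  filter_upwards [hγ (hcl.isOpen_compl.mem_nhds hy), hx] with t ht hxt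
  by_contra h
  exact ht ⟨x t, hxt.1, hxt.2, h⟩

theorem groundStates_eq_or_eq (hβ : 0 < β) (huv : u ≤ v) (hv : v ≤ 0) {a b c : Fin 3 → ℝ}
    (ha : a ∈ groundStates β (u, v)) (hb : b ∈ groundStates β (u, v))
    (hc : c ∈ groundStates β (u, v)) (hab : a ≠ b) : c = a ∨ c = b :=
  eq_or_eq_of_mem_localMinimizers hβ huv hv (mem_localMinimizers_of_mem_minimizersOn huv hv ha)
    (mem_localMinimizers_of_mem_minimizersOn huv hv hb)
    (mem_localMinimizers_of_mem_minimizersOn huv hv hc) hab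

/-- A graph of fields with two coexisting phases is differentiable, with the slope required by
equality of the two energies: minimality of the phases at one field bounds the increments of the
graph by those of the tilt at the other. -/
theorem hasDerivWithinAt_of_coexist (hβ : 0 < β) {I : Set ℝ} {w : ℝ → ℝ}
    (hI : ∀ s ∈ I, Coexist β s (w s)) (hu : u ∈ I) (hν : ν ∈ groundStates β (u, w u))
    (hμ : μ ∈ groundStates β (u, w u)) (h : μ 2 < ν 2) :
    HasDerivWithinAt w (-((ν 0 - μ 0) / (ν 1 - μ 1))) I u := by
  obtain ⟨huv, hv, -⟩ := hI u hu
  obtain ⟨m, hm⟩ := (hI u hu).exists_isSaddle hβ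
  have hne : ν ≠ μ := by rintro rfl; exact h.false
  have hord := lt_of_groundStates_lt hβ huv hv hν hμ h
  have hup : ∀ b ∈ groundStates β (u, w u) ∩ {x | m ≤ β * x 2}, b = ν := by
    rintro b ⟨hb, hbm⟩
    rcases groundStates_eq_or_eq hβ huv hv hν hμ hb hne with h' | rfl
    · exact h'
    · obtain ⟨c, hc, hcm⟩ := hm.lower
      simp only [mem_ofPred_eq] at hbm
      rcases groundStates_eq_or_eq hβ huv hv hν hμ hc hne with rfl | rfl
      · nlinarith
      · linarith
  have hlow : ∀ b ∈ groundStates β (u, w u) ∩ {x | β * x 2 ≤ m}, b = μ := by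
    rintro b ⟨hb, hbm⟩
    rcases groundStates_eq_or_eq hβ huv hv hν hμ hb hne with rfl | h'
    · obtain ⟨c, hc, hcm⟩ := hm.upper
      simp only [mem_ofPred_eq] at hbm
      rcases groundStates_eq_or_eq hβ huv hv hν hμ hc hne with rfl | rfl
      · linarith
      · nlinarith
    · exact h'
  have hcont : Tendsto (fun s => (s, w s)) (𝓝[I \ {u}] u) (𝓝 (u, w u)) := by
    refine Tendsto.prodMk_nhds (tendsto_id.mono_left nhdsWithin_le_nhds) ?_
    rw [Metric.tendsto_nhds]
    intro η hη
    obtain ⟨ε, hε, hs⟩ := hm.exists_nhds hβ (half_pos hη)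
    filter_upwards [nhdsWithin_le_nhds (Metric.ball_mem_nhds u hε), self_mem_nhdsWithin]
      with s h1 h2
    rw [Metric.mem_ball, Real.dist_eq] at h1
    rw [Real.dist_eq]
    linarith [(hs s (w s) (hI s h2.1) h1).1]
  have hsep : ∀ᶠ s in 𝓝[I \ {u}] u, (∃ a ∈ groundStates β (s, w s), m < β * a 2) ∧
      ∃ a ∈ groundStates β (s, w s), β * a 2 < m := by
    obtain ⟨ε, hε, hs⟩ := hm.exists_nhds hβ one_pos
    filter_upwards [nhdsWithin_le_nhds (Metric.ball_mem_nhds u hε), self_mem_nhdsWithin]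
      with s h1 h2
    rw [Metric.mem_ball, Real.dist_eq] at h1
    exact (hs s (w s) (hI s h2.1) h1).2
  have hN : ∀ s, ∃ a, (∃ a ∈ groundStates β (s, w s), m < β * a 2) →
      a ∈ groundStates β (s, w s) ∩ {x | m ≤ β * x 2} := by
    intro s
    by_cases h : ∃ a ∈ groundStates β (s, w s), m < β * a 2
    · obtain ⟨a, ha, ham⟩ := h
      exact ⟨a, fun _ => ⟨ha, ham.le⟩⟩
    · exact ⟨0, fun h' => absurd h' h⟩
  have hM : ∀ s, ∃ a, (∃ a ∈ groundStates β (s, w s), β * a 2 < m) →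
      a ∈ groundStates β (s, w s) ∩ {x | β * x 2 ≤ m} := by
    intro s
    by_cases h : ∃ a ∈ groundStates β (s, w s), β * a 2 < m
    · obtain ⟨a, ha, ham⟩ := h
      exact ⟨a, fun _ => ⟨ha, ham.le⟩⟩
    · exact ⟨0, fun h' => absurd h' h⟩
  -- `N s` and `M s` are upper and lower phases at `s`; they converge to `ν` and `μ`.
  choose N hN using hN
  choose M hM using hM
  have tN : Tendsto N (𝓝[I \ {u}] u) (𝓝 ν) :=
    tendsto_of_minimizersOn isCompact_sortedSimplex (isClosed_setOf_le_apply m 2) hcont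
      (hsep.mono fun s hs => hN s hs.1) hup
  have tM : Tendsto M (𝓝[I \ {u}] u) (𝓝 μ) :=
    tendsto_of_minimizersOn isCompact_sortedSimplex (isClosed_setOf_apply_le m 2) hcont
      (hsep.mono fun s hs => hM s hs.2) hlow
  have tN' := tendsto_pi_nhds.1 tN
  have tM' := tendsto_pi_nhds.1 tM
  refine hasDerivWithinAt_of_between (g := fun s => -((ν 0 - M s 0) / (ν 1 - M s 1)))
    (h := fun s => -((N s 0 - μ 0) / (N s 1 - μ 1))) ?_ ?_ ?_
  · exact (((tendsto_const_nhds.sub (tM' 0))).div (tendsto_const_nhds.sub (tM' 1))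
      (by linarith [hord.2.1])).neg
  · exact ((((tN' 0).sub tendsto_const_nhds)).div ((tN' 1).sub tendsto_const_nhds)
      (by linarith [hord.2.1])).neg
  · filter_upwards [hsep, (tN' 1).eventually_lt_const hord.2.1,
      (tM' 1).eventually_const_lt hord.2.1] with s hs h1 h2
    have e1 := groundStates_monotone hμ (hN s hs.1).1
    have e2 := groundStates_monotone hν (hM s hs.2).1
    simp only at e1 e2
    constructor
    · rw [mul_neg, ← mul_div_assoc, neg_le_iff_add_nonneg', ← sub_nonneg]
      have : 0 < M s 1 - ν 1 := by linarith
      have key : (s - u) * (ν 0 - M s 0) / (ν 1 - M s 1) + (w s - w u) =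
          ((s - u) * (M s 0 - ν 0) + (w s - w u) * (M s 1 - ν 1)) / (M s 1 - ν 1) := by
        have h3 : ν 1 - M s 1 ≠ 0 := by linarith
        field_simp
        ring
      rw [key, sub_zero]
      positivity
    · have : 0 < μ 1 - N s 1 := by linarith
      have key : (s - u) * -((N s 0 - μ 0) / (N s 1 - μ 1)) - (w s - w u) =
          ((s - u) * (N s 0 - μ 0) + (w s - w u) * (N s 1 - μ 1)) / (μ 1 - N s 1) := by
        have h3 : N s 1 - μ 1 ≠ 0 := by linarith
        field_simp
        ring
      rw [← sub_nonneg, key]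
      positivity

/-- A field with two phases and `gap u v m < 0` has a phase strictly on each side of `m`. -/
theorem Coexist.separated (hβ : 0 < β) (h : Coexist β u v) {m : ℝ} (hm : 1 < m)
    (hgap : gap u v m < 0) : (∃ ν ∈ groundStates β (u, v), m < β * ν 2) ∧
      ∃ μ ∈ groundStates β (u, v), β * μ 2 < m := by
  obtain ⟨n, hn⟩ := h.exists_isSaddle hβ
  obtain ⟨huv, hv, -⟩ := h
  obtain ⟨a, ha, ham⟩ := hn.upper
  obtain ⟨b, hb, hbm⟩ := hn.lower
  have ca := (candidate_of_mem_localMinimizers hβ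
    (mem_localMinimizers_of_mem_minimizersOn huv hv ha) (huv.trans hv) hv).1
  have cb := (candidate_of_mem_localMinimizers hβ
    (mem_localMinimizers_of_mem_minimizersOn huv hv hb) (huv.trans hv) hv).1
  refine ⟨⟨a, ha, ?_⟩, b, hb, ?_⟩
  · by_contra! hle
    linarith [ca.gap_nonneg (hn.one_lt.trans ham),
      gap_neg_of_mem_Icc huv hv hn.one_lt hn.gap_neg hgap ham.le hle]
  · by_contra! hle
    linarith [cb.gap_nonneg (hm.trans_le hle),
      gap_neg_of_mem_Icc huv hv hm hgap hn.gap_neg hle hbm.le]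

/-- A minimizer over part of the sorted simplex is a local minimizer on the whole simplex if the
sorted versions of all nearby points belong to that part. -/
theorem mem_localMinimizers_of_eventually (huv : u ≤ v) (hv : v ≤ 0) {A : Set (Fin 3 → ℝ)}
    (hν : ν ∈ minimizersOn β (sortedSimplex ∩ A) (u, v))
    (hA : ∀ᶠ x in 𝓝 ν, x ∘ Tuple.sort x ∈ A) : ν ∈ localMinimizers β (fieldOfUV u v) ∩ cell := by
  refine ⟨mem_localMinimizers_iff.2 ⟨hν.1.1.1, ?_⟩, hν.1.1.2⟩
  filter_upwards [nhdsWithin_le_nhds hA, self_mem_nhdsWithin] with x hx hxs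
  exact (hν.2 _ ⟨comp_sort_mem_sortedSimplex hxs, hx⟩).trans (tiltedEnergy_comp_sort_le huv hv x)

theorem mem_localMinimizers_of_lt (hβ : 0 < β) (huv : u ≤ v) (hv : v ≤ 0) {m : ℝ}
    (hν : ν ∈ minimizersOn β (sortedSimplex ∩ {x | m ≤ β * x 2}) (u, v)) (h : m < β * ν 2) :
    ν ∈ localMinimizers β (fieldOfUV u v) ∩ cell := by
  refine mem_localMinimizers_of_eventually huv hv hν ?_
  have hc : Continuous fun x : Fin 3 → ℝ => β * x 2 := by fun_prop
  filter_upwards [hc.continuousAt.eventually_const_lt h] with x hx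
  have h1 : x 2 ≤ (x ∘ Tuple.sort x) 2 := by
    have := Tuple.monotone_sort x (show (Tuple.sort x).symm 2 ≤ 2 from Fin.le_last _)
    simpa using this
  exact hx.le.trans (mul_le_mul_of_nonneg_left h1 hβ.le)

theorem mem_localMinimizers_of_gt (hβ : 0 < β) (huv : u ≤ v) (hv : v ≤ 0) {m : ℝ}
    (hν : ν ∈ minimizersOn β (sortedSimplex ∩ {x | β * x 2 ≤ m}) (u, v)) (h : β * ν 2 < m) :
    ν ∈ localMinimizers β (fieldOfUV u v) ∩ cell := by
  refine mem_localMinimizers_of_eventually huv hv hν ?_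
  have hc : ∀ i, ∀ᶠ x : Fin 3 → ℝ in 𝓝 ν, β * x i < m := by
    intro i
    have hc : Continuous fun x : Fin 3 → ℝ => β * x i := by fun_prop
    refine hc.continuousAt.eventually_lt_const (lt_of_le_of_lt ?_ h)
    exact mul_le_mul_of_nonneg_left (mem_cell_iff_monotone.1 hν.1.1.2 (Fin.le_last i)) hβ.le
  filter_upwards [eventually_all.2 hc] with x hx
  exact (hx _).le

/-- The minimal energy over a set has the derivative given by differentiating the tilt at the
minimizer, wherever the minimizer is unique. -/
theorem hasDerivWithinAt_minimum {C : Set (Fin 3 → ℝ)} (hC : IsCompact C) {J : Set ℝ}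
    {w : ℝ → ℝ} {w' x : ℝ} (hw : HasDerivWithinAt w w' J x) (hx : x ∈ J) {a : ℝ → Fin 3 → ℝ}
    (ha : ∀ t ∈ J, a t ∈ minimizersOn β C (t, w t))
    (huniq : ∀ b ∈ minimizersOn β C (x, w x), b = a x) :
    HasDerivWithinAt (fun t => tiltedEnergy β (t, w t) (a t)) (-(a x 0 + w' * a x 1)) J x := by
  have hcont : Tendsto (fun s => (s, w s)) (𝓝[J \ {x}] x) (𝓝 (x, w x)) :=
    Tendsto.prodMk_nhds (tendsto_id.mono_left nhdsWithin_le_nhds)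
      (hw.continuousWithinAt.mono_left (nhdsWithin_mono _ sdiff_subset))
  have hmem : ∀ᶠ t in 𝓝[J \ {x}] x, t ∈ J \ {x} := self_mem_nhdsWithin
  have ta := tendsto_pi_nhds.1 <| tendsto_of_minimizersOn hC isClosed_univ hcont
    (hmem.mono fun t ht => ⟨ha t ht.1, mem_univ _⟩) (fun b hb => huniq b hb.1)
  have tw := hasDerivWithinAt_iff_tendsto_slope.1 hw
  refine hasDerivWithinAt_of_between (g := fun t => -(a t 0 + slope w x t * a t 1))
    (h := fun t => -(a x 0 + slope w x t * a x 1)) ((ta 0).add (tw.mul (ta 1))).neg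
    (tendsto_const_nhds.add (tw.mul tendsto_const_nhds)).neg ?_
  filter_upwards [hmem] with t ht
  have h1 := (ha t ht.1).2 (a x) (ha x hx).1
  have h2 := (ha x hx).2 (a t) (ha t ht.1).1
  have hs : (t - x) * slope w x t = w t - w x := by
    have := sub_smul_slope w x t
    simpa [vsub_eq_sub] using this
  unfold tiltedEnergy at h1 h2 ⊢
  simp only at h1 h2 ⊢
  constructor
  · linear_combination h2 - a t 1 * hs
  · linear_combination h1 + a x 1 * hs

end

section

variable {β u v : ℝ} {ν μ : Fin 3 → ℝ}

/-- Along a solution of the differential equation coexistence is a closed condition. -/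
theorem IsMaxwellSolution.eventually_not_coexist (hβ : 0 < β) {u₀ v₀ : ℝ} {J : Set ℝ} {w : ℝ → ℝ}
    (h : IsMaxwellSolution β u₀ v₀ J w) (hwedge : ∀ x ∈ J, x ≤ w x ∧ w x ≤ 0) {x : ℝ} (hx : x ∈ J)
    (hnot : ¬ Coexist β x (w x)) : ∀ᶠ y in 𝓝[J] x, ¬ Coexist β y (w y) := by
  obtain ⟨huv, hv⟩ := hwedge x hx
  obtain ⟨N, M, hNM, hne, hd⟩ := h.ode x hx
  have hN : N ∈ localMinimizers β (fieldOfUV x (w x)) ∩ cell := hNM ▸ mem_insert N {M}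
  have hM : M ∈ localMinimizers β (fieldOfUV x (w x)) ∩ cell :=
    hNM ▸ mem_insert_of_mem N (mem_singleton M)
  have cN := (candidate_of_mem_localMinimizers hβ hN (huv.trans hv) hv).1
  have cM := (candidate_of_mem_localMinimizers hβ hM (huv.trans hv) hv).1
  obtain ⟨m, hm, hgap⟩ : ∃ m, 1 < m ∧ gap x (w x) m < 0 := by
    have h2 : N 2 ≠ M 2 := fun h2 =>
      hne (congrFun (eq_of_apply_two_eq hβ (huv.trans hv) hv hN hM h2) 1)
    rcases lt_or_gt_of_ne h2 with hlt | hlt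
    · obtain ⟨m, h1, -, h3⟩ := cN.exists_gap_neg huv hv cM (mul_lt_mul_of_pos_left hlt hβ)
      exact ⟨m, h1, h3⟩
    · obtain ⟨m, h1, -, h3⟩ := cM.exists_gap_neg huv hv cN (mul_lt_mul_of_pos_left hlt hβ)
      exact ⟨m, h1, h3⟩
  have hcont : Tendsto (fun s => (s, w s)) (𝓝[J] x) (𝓝 (x, w x)) :=
    Tendsto.prodMk_nhds (tendsto_id.mono_left nhdsWithin_le_nhds) hd.continuousWithinAt
  have hgap' := hcont.eventually (eventually_gap_neg hm (huv.trans hv) hv hgap)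
  by_contra hfr
  have hfr' : ∃ᶠ y in 𝓝[J] x, Coexist β y (w y) := by
    rwa [Filter.Frequently]
  have hsep := (hfr'.and_eventually hgap').mono fun y hy => hy.1.separated hβ hm hy.2
  have hU : (groundStates β (x, w x) ∩ {z | m ≤ β * z 2}).Nonempty :=
    (isClosed_setOf_minimizersOn_inter isCompact_sortedSimplex
      (isClosed_setOf_le_apply m 2)).mem_of_frequently_of_tendsto
      (hsep.mono fun y hy => by obtain ⟨⟨a, ha, h1⟩, -⟩ := hy; exact ⟨a, ha, h1.le⟩) hcont
  have hL : (groundStates β (x, w x) ∩ {z | β * z 2 ≤ m}).Nonempty :=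
    (isClosed_setOf_minimizersOn_inter isCompact_sortedSimplex
      (isClosed_setOf_apply_le m 2)).mem_of_frequently_of_tendsto
      (hsep.mono fun y hy => by obtain ⟨-, a, ha, h1⟩ := hy; exact ⟨a, ha, h1.le⟩) hcont
  obtain ⟨a, ha, ham⟩ := hU
  obtain ⟨b, hb, hbm⟩ := hL
  exact hnot (coexist_of_separated huv hv
    ⟨a, ha, lt_of_le_of_ne ham (mul_apply_two_ne hβ huv hv hm (Or.inr hgap) ha).symm⟩
    ⟨b, hb, lt_of_le_of_ne hbm (mul_apply_two_ne hβ huv hv hm (Or.inr hgap) hb)⟩)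

/-- Along a solution of the differential equation coexistence is an open condition: the difference
of the energies of the two phases is constant. -/
theorem IsMaxwellSolution.eventually_coexist (hβ : 0 < β) {u₀ v₀ : ℝ} {J : Set ℝ} {w : ℝ → ℝ}
    (h : IsMaxwellSolution β u₀ v₀ J w) (hwedge : ∀ x ∈ J, x ≤ w x ∧ w x ≤ 0) {x : ℝ} (hx : x ∈ J)
    (hco : Coexist β x (w x)) : ∀ᶠ y in 𝓝[J] x, Coexist β y (w y) := by
  obtain ⟨m, hm⟩ := hco.exists_isSaddle hβ
  obtain ⟨ν, hν, hνm⟩ := hm.upper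
  obtain ⟨μ, hμ, hμm⟩ := hm.lower
  have hUc : IsCompact (sortedSimplex ∩ {z | m ≤ β * z 2}) :=
    isCompact_sortedSimplex.inter_right (isClosed_setOf_le_apply m 2)
  have hLc : IsCompact (sortedSimplex ∩ {z | β * z 2 ≤ m}) :=
    isCompact_sortedSimplex.inter_right (isClosed_setOf_apply_le m 2)
  have hUne : ∀ y, (minimizersOn β (sortedSimplex ∩ {z | m ≤ β * z 2}) y).Nonempty :=
    minimizersOn_nonempty hUc ⟨ν, hν.1, hνm.le⟩
  have hLne : ∀ y, (minimizersOn β (sortedSimplex ∩ {z | β * z 2 ≤ m}) y).Nonempty :=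
    minimizersOn_nonempty hLc ⟨μ, hμ.1, hμm.le⟩
  have hcont : Tendsto (fun s => (s, w s)) (𝓝[J] x) (𝓝 (x, w x)) := by
    obtain ⟨_, _, _, _, hd⟩ := h.ode x hx
    exact Tendsto.prodMk_nhds (tendsto_id.mono_left nhdsWithin_le_nhds) hd.continuousWithinAt
  -- At `x` the minimizers on the two sides of the saddle are global, hence off the saddle.
  have hUx : ∀ a ∈ minimizersOn β (sortedSimplex ∩ {z | m ≤ β * z 2}) (x, w x), m < β * a 2 := by
    intro a ha
    have hag : a ∈ groundStates β (x, w x) :=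
      ⟨ha.1.1, fun b hb => (ha.2 ν ⟨hν.1, hνm.le⟩).trans (hν.2 b hb)⟩
    exact lt_of_le_of_ne ha.1.2 (mul_apply_two_ne hβ hm.wedge_left hm.wedge_right hm.one_lt
      (Or.inr hm.gap_neg) hag).symm
  have hLx : ∀ a ∈ minimizersOn β (sortedSimplex ∩ {z | β * z 2 ≤ m}) (x, w x), β * a 2 < m := by
    intro a ha
    have hag : a ∈ groundStates β (x, w x) :=
      ⟨ha.1.1, fun b hb => (ha.2 μ ⟨hμ.1, hμm.le⟩).trans (hμ.2 b hb)⟩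
    exact lt_of_le_of_ne ha.1.2 (mul_apply_two_ne hβ hm.wedge_left hm.wedge_right hm.one_lt
      (Or.inr hm.gap_neg) hag)
  have hUev : ∀ᶠ s in 𝓝[J] x, ∀ a ∈ minimizersOn β (sortedSimplex ∩ {z | m ≤ β * z 2}) (s, w s),
      m < β * a 2 := by
    have hcl := isClosed_setOf_minimizersOn_inter (β := β) hUc (isClosed_setOf_apply_le (β := β) m 2)
    have := hcont.eventually (hcl.isOpen_compl.mem_nhds fun ⟨a, ha, h'⟩ => (hUx a ha).not_ge h')
    filter_upwards [this] with s hs a ha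
    by_contra! hle
    exact hs ⟨a, ha, hle⟩
  have hLev : ∀ᶠ s in 𝓝[J] x, ∀ a ∈ minimizersOn β (sortedSimplex ∩ {z | β * z 2 ≤ m}) (s, w s),
      β * a 2 < m := by
    have hcl := isClosed_setOf_minimizersOn_inter (β := β) hLc (isClosed_setOf_le_apply (β := β) m 2)
    have := hcont.eventually (hcl.isOpen_compl.mem_nhds fun ⟨a, ha, h'⟩ => (hLx a ha).not_ge h')
    filter_upwards [this] with s hs a ha
    by_contra! hle
    exact hs ⟨a, ha, hle⟩
  obtain ⟨r, hr, hball⟩ := Metric.mem_nhdsWithin_iff.1 (hUev.and hLev)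
  choose a ha using fun s => hUne (s, w s)
  choose b hb using fun s => hLne (s, w s)
  set K := Metric.ball x r ∩ J with hK
  have hKJ : K ⊆ J := inter_subset_right
  have hKconv : Convex ℝ K := (convex_ball x r).inter h.interval.convex
  have hxK : x ∈ K := ⟨Metric.mem_ball_self hr, hx⟩
  have hloc : ∀ s ∈ K,
      (∀ c ∈ minimizersOn β (sortedSimplex ∩ {z | m ≤ β * z 2}) (s, w s),
        c ∈ localMinimizers β (fieldOfUV s (w s)) ∩ cell) ∧
      ∀ c ∈ minimizersOn β (sortedSimplex ∩ {z | β * z 2 ≤ m}) (s, w s),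
        c ∈ localMinimizers β (fieldOfUV s (w s)) ∩ cell := by
    intro s hs
    obtain ⟨h1, h2⟩ := hwedge s (hKJ hs)
    exact ⟨fun c hc => mem_localMinimizers_of_lt hβ h1 h2 hc ((hball hs).1 c hc),
      fun c hc => mem_localMinimizers_of_gt hβ h1 h2 hc ((hball hs).2 c hc)⟩
  have hlt : ∀ s ∈ K, m < β * a s 2 ∧ β * b s 2 < m := fun s hs =>
    ⟨(hball hs).1 _ (ha s), (hball hs).2 _ (hb s)⟩
  have huniq : ∀ s ∈ K,
      (∀ c ∈ minimizersOn β (sortedSimplex ∩ {z | m ≤ β * z 2}) (s, w s), c = a s) ∧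
      ∀ c ∈ minimizersOn β (sortedSimplex ∩ {z | β * z 2 ≤ m}) (s, w s), c = b s := by
    intro s hs
    obtain ⟨h1, h2⟩ := hwedge s (hKJ hs)
    have hne : a s ≠ b s := fun he => by
      have := hlt s hs
      rw [he] at this
      linarith
    constructor
    · intro c hc
      refine (eq_or_eq_of_mem_localMinimizers hβ h1 h2 ((hloc s hs).1 _ (ha s))
        ((hloc s hs).2 _ (hb s)) ((hloc s hs).1 c hc) hne).resolve_right ?_
      rintro rfl
      linarith [(hlt s hs).2, (hball hs).1 _ hc]
    · intro c hc
      refine (eq_or_eq_of_mem_localMinimizers hβ h1 h2 ((hloc s hs).1 _ (ha s))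
        ((hloc s hs).2 _ (hb s)) ((hloc s hs).2 c hc) hne).resolve_left ?_
      rintro rfl
      linarith [(hlt s hs).1, (hball hs).2 _ hc]
  -- The slope prescribed by the differential equation makes the two tilts change equally.
  have hderiv : ∀ s ∈ K, HasDerivWithinAt
      (fun t => tiltedEnergy β (t, w t) (a t) - tiltedEnergy β (t, w t) (b t)) 0 K s := by
    intro s hs
    obtain ⟨N, M, hNM, hne, hd⟩ := h.ode s (hKJ hs)
    have hne1 : N 1 - M 1 ≠ 0 := sub_ne_zero.2 hne
    have hd' := hd.mono hKJ
    have hmemA : a s ∈ ({N, M} : Set (Fin 3 → ℝ)) := hNM ▸ (hloc s hs).1 _ (ha s)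
    have hmemB : b s ∈ ({N, M} : Set (Fin 3 → ℝ)) := hNM ▸ (hloc s hs).2 _ (hb s)
    have hlts := hlt s hs
    have := (hasDerivWithinAt_minimum hUc hd' hs (fun t _ => ha t) (huniq s hs).1).sub
      (hasDerivWithinAt_minimum hLc hd' hs (fun t _ => hb t) (huniq s hs).2)
    refine this.congr_deriv ?_
    rcases hmemA with hA | hA <;> rcases hmemB with hB | hB <;>
      rw [hA, hB] at hlts ⊢
    · linarith
    · field_simp; ring
    · field_simp; ring
    · linarith
  have hx0 : tiltedEnergy β (x, w x) (a x) - tiltedEnergy β (x, w x) (b x) = 0 := by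
    have h1 := (ha x).2 ν ⟨hν.1, hνm.le⟩
    have h2 := (hb x).2 μ ⟨hμ.1, hμm.le⟩
    have h3 := hν.2 _ (hb x).1.1
    have h4 := hμ.2 _ (ha x).1.1
    linarith
  filter_upwards [Metric.mem_nhdsWithin_iff.2 ⟨r, hr, subset_rfl⟩] with s (hs : s ∈ K)
  have h0 := hKconv.norm_image_sub_le_of_norm_hasDerivWithin_le (C := 0) hderiv
    (fun _ _ => norm_zero.le) hxK hs
  rw [zero_mul, hx0, sub_zero, norm_le_zero_iff] at h0
  obtain ⟨h1, h2⟩ := hwedge s (hKJ hs)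
  have hall : ∀ c ∈ sortedSimplex, tiltedEnergy β (s, w s) (a s) ≤ tiltedEnergy β (s, w s) c := by
    intro c hc
    rcases le_total m (β * c 2) with hcm | hcm
    · exact (ha s).2 c ⟨hc, hcm⟩
    · linarith [(hb s).2 c ⟨hc, hcm⟩]
  exact coexist_of_separated h1 h2 ⟨a s, ⟨(ha s).1.1, hall⟩, (hlt s hs).1⟩
    ⟨b s, ⟨(hb s).1.1, fun c hc => by linarith [hall c hc]⟩, (hlt s hs).2⟩

theorem fieldOfUV_mem_cell_iff : fieldOfUV u v ∈ cell ↔ u ≤ v ∧ v ≤ 0 := by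
  have hZ : 0 < Real.exp u + Real.exp v + 1 := by positivity
  change Real.exp u / _ ≤ Real.exp v / _ ∧ Real.exp v / _ ≤ 1 / _ ↔ _
  rw [div_le_div_iff_of_pos_right hZ, div_le_div_iff_of_pos_right hZ, Real.exp_le_exp,
    Real.exp_le_one_iff]

/-- A solution that starts at a coexistence point stays in the coexistence set. -/
theorem IsMaxwellSolution.coexist (hβ : 0 < β) {u₀ v₀ : ℝ} {J : Set ℝ} {w : ℝ → ℝ}
    (h : IsMaxwellSolution β u₀ v₀ J w) (h0 : Coexist β u₀ v₀) {x : ℝ} (hx : x ∈ J) :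
    Coexist β x (w x) := by
  have hwedge : ∀ x ∈ J, x ≤ w x ∧ w x ≤ 0 := fun x hx =>
    fieldOfUV_mem_cell_iff.1 (h.mem_cell x hx)
  refine h.interval.isPreconnected.induction₂'
    (fun x y => Coexist β x (w x) → Coexist β y (w y)) (fun x hx => ?_)
    (fun x y z _ _ _ h1 h2 hc => h2 (h1 hc)) h.isLeast.1 hx (h.initial.symm ▸ h0)
  by_cases hc : Coexist β x (w x)
  · exact (h.eventually_coexist hβ hwedge hx hc).mono fun y hy => ⟨fun _ => hy, fun _ => hc⟩
  · exact (h.eventually_not_coexist hβ hwedge hx hc).mono fun y hy =>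
      ⟨fun h' => absurd h' hc, fun h' => absurd h' hy⟩

/-- The first coordinates of the fields with two coexisting phases. -/
def coexistDomain (β : ℝ) : Set ℝ := {u | ∃ v, Coexist β u v}

open Classical in
/-- The second coordinate of the field with first coordinate `u` and two coexisting phases, and `0`
where there is none. -/
noncomputable def coexistCurve (β u : ℝ) : ℝ :=
  if h : ∃ v, Coexist β u v then h.choose else 0

theorem coexist_coexistCurve (h : u ∈ coexistDomain β) : Coexist β u (coexistCurve β u) := by
  have h' : ∃ v, Coexist β u v := h
  rw [coexistCurve, dif_pos h']
  exact h'.choose_spec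

theorem Coexist.eq_coexistCurve (hβ : 0 < β) (h : Coexist β u v) : v = coexistCurve β u :=
  h.right_unique hβ (coexist_coexistCurve ⟨v, h⟩)

/-- The fields in the cell with two coexisting phases form the maximal solution that starts at
the field of this kind on the symmetry axis. -/
theorem isMaximalMaxwellSolution_coexistCurve (hβ : 0 < β) {u₀ : ℝ} (hu₀ : u₀ < 0)
    (h0 : Coexist β u₀ 0) (haxis : ∀ u, u₀ < u → u ≤ 0 → ∀ ν ∈ groundStates β (u, 0), β * ν 2 ≤ 1) :
    IsMaximalMaxwellSolution β u₀ 0 (coexistDomain β) (coexistCurve β) where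
  isSolution :=
    { interval := by
        refine ⟨fun a ha b hb c hc => ?_⟩
        obtain ⟨vb, hb⟩ := hb
        have ha0 : u₀ ≤ a := by
          obtain ⟨va, ha⟩ := ha
          by_contra! hlt
          linarith [(ha.antichain hβ h0 hlt.le ha.2.1).1]
        rcases hc.1.eq_or_lt with rfl | hac
        · exact ha
        rcases hc.2.eq_or_lt with rfl | hcb
        · exact ⟨vb, hb⟩
        exact hb.exists_left hβ hcb
          (haxis c (ha0.trans_lt hac) (hcb.le.trans (hb.1.trans hb.2.1)))
      isLeast := by
        refine ⟨⟨0, h0⟩, fun a ha => ?_⟩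
        obtain ⟨va, ha⟩ := ha
        by_contra! hlt
        linarith [(ha.antichain hβ h0 hlt.le ha.2.1).1]
      initial := (h0.eq_coexistCurve hβ).symm
      mem_cell := fun u hu => by
        have := coexist_coexistCurve hu
        exact fieldOfUV_mem_cell_iff.2 ⟨this.1, this.2.1⟩
      ode := fun u hu => by
        obtain ⟨m, hm⟩ := (coexist_coexistCurve hu).exists_isSaddle hβ
        obtain ⟨ν, hν, hνm⟩ := hm.upper
        obtain ⟨μ, hμ, hμm⟩ := hm.lower
        have hlt : μ 2 < ν 2 := lt_of_mul_lt_mul_left (hμm.trans hνm) hβ.le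
        have hord := lt_of_groundStates_lt hβ hm.wedge_left hm.wedge_right hν hμ hlt
        have h1 := mem_localMinimizers_of_mem_minimizersOn hm.wedge_left hm.wedge_right hν
        have h2 := mem_localMinimizers_of_mem_minimizersOn hm.wedge_left hm.wedge_right hμ
        refine ⟨ν, μ, ?_, hord.2.1.ne,
          hasDerivWithinAt_of_coexist hβ (fun s hs => coexist_coexistCurve hs) hu hν hμ hlt⟩
        ext c
        constructor
        · exact fun hc => eq_or_eq_of_mem_localMinimizers hβ hm.wedge_left hm.wedge_right h1 h2 hc
            (fun he => hlt.ne (congrFun he 2).symm)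
        · rintro (rfl | rfl)
          exacts [h1, h2] }
  nontrivial := by
    obtain ⟨m, hm⟩ := h0.exists_isSaddle hβ
    obtain ⟨ε, hε, h⟩ := hm.exists_right hβ hu₀ one_pos
    obtain ⟨v', hv', huv', h1, h2⟩ := h (u₀ + ε / 2) (by linarith) (by linarith)
    exact ⟨u₀, ⟨0, h0⟩, u₀ + ε / 2, ⟨v', coexist_of_separated huv' hv'.2 h1 h2⟩, by
      intro he; linarith⟩
  maximal := fun J w hJ =>
    ⟨fun x hx => ⟨w x, hJ.coexist hβ h0 hx⟩, fun x hx => (hJ.coexist hβ h0 hx).eq_coexistCurve hβ⟩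

end

section

variable {β u v : ℝ} {ν μ : Fin 3 → ℝ}

/-! ### Numbers of global minimizers -/

theorem candidate_of_mem_groundStates (hβ : 0 < β) (huv : u ≤ v) (hv : v ≤ 0)
    (hν : ν ∈ groundStates β (u, v)) : IsCandidate β u v (β * ν 2) ∧
      β * ν 0 = low (ell (β * ν 2) + u) ∧ β * ν 1 = low (ell (β * ν 2) + v) :=
  candidate_of_mem_localMinimizers hβ (mem_localMinimizers_of_mem_minimizersOn huv hv hν)
    (huv.trans hv) hv

theorem groundStates_eq_singleton (huv : u ≤ v) (hv : v ≤ 0) (h : ¬ Coexist β u v) :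
    ∃ ν, groundStates β (u, v) = {ν} := by
  obtain ⟨ν, hν⟩ := groundStates_nonempty (β := β) (u, v)
  have hs : (groundStates β (u, v)).Subsingleton := by
    rw [← not_nontrivial_iff]
    exact fun h' => h ⟨huv, hv, h'⟩
  exact ⟨ν, hs.eq_singleton_of_mem hν⟩

theorem groundStates_eq_pair (hβ : 0 < β) (huv : u ≤ v) (hv : v ≤ 0)
    (hν : ν ∈ groundStates β (u, v)) (hμ : μ ∈ groundStates β (u, v)) (h : ν ≠ μ) :
    groundStates β (u, v) = {ν, μ} := by
  ext c
  constructor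
  · exact fun hc => groundStates_eq_or_eq hβ huv hv hν hμ hc h
  · rintro (rfl | rfl)
    exacts [hν, hμ]

/-- On the symmetry axis a disordered phase is symmetric. -/
theorem apply_one_eq_apply_two (hβ : 0 < β) (hu : u ≤ 0) (hν : ν ∈ groundStates β (u, 0))
    (h : β * ν 2 ≤ 1) : ν 1 = ν 2 := by
  obtain ⟨hc, -, h1⟩ := candidate_of_mem_groundStates hβ hu le_rfl hν
  rw [add_zero, low_ell hc.pos h] at h1
  exact mul_left_cancel₀ hβ.ne' h1

theorem apply_one_lt_apply_two (hβ : 0 < β) (huv : u ≤ v) (hv : v ≤ 0)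
    (hν : ν ∈ groundStates β (u, v)) (h : 1 < β * ν 2) : ν 1 < ν 2 := by
  obtain ⟨-, -, h1⟩ := candidate_of_mem_groundStates hβ huv hv hν
  exact lt_of_mul_lt_mul_left (h1.trans_lt ((low_le_one _).trans_lt h)) hβ.le

theorem ncard_of_neg (hβ : 0 < β) (huv : u ≤ v) (hv : v < 0) (h : ¬ Coexist β u v) :
    (globalMinimizers β (fieldOfUV u v)).ncard = 1 := by
  obtain ⟨ν, hν⟩ := groundStates_eq_singleton huv hv.le h
  rw [globalMinimizers_eq_of_neg hβ huv hv]
  exact (congrArg ncard hν).trans (ncard_singleton ν)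

theorem Coexist.ncard_of_neg (hβ : 0 < β) (h : Coexist β u v) (hv : v < 0) :
    (globalMinimizers β (fieldOfUV u v)).ncard = 2 := by
  obtain ⟨huv, hv', ν, hν, μ, hμ, hne⟩ := h
  rw [globalMinimizers_eq_of_neg hβ huv hv]
  exact (congrArg ncard (groundStates_eq_pair hβ huv hv' hν hμ hne)).trans (ncard_pair hne)

theorem comp_swap_eq_self (h : ν 1 = ν 2) : ν ∘ Equiv.swap 1 2 = ν := by
  funext i
  fin_cases i
  · simp [Equiv.swap_apply_of_ne_of_ne]
  · simp [h]
  · simp [h]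

theorem ncard_axis_of_le_one (hβ : 0 < β) (hu : u < 0) (hco : ¬ Coexist β u 0)
    (h : ∃ ν ∈ groundStates β (u, 0), β * ν 2 ≤ 1) :
    (globalMinimizers β (fieldOfUV u 0)).ncard = 1 := by
  obtain ⟨ν, hν, h1⟩ := h
  obtain ⟨ν', hν'⟩ := groundStates_eq_singleton hu.le le_rfl hco
  obtain rfl : ν = ν' := by rw [hν'] at hν; exact hν
  rw [globalMinimizers_eq_of_axis hu, show minimizersOn β sortedSimplex (u, 0) = _ from hν', image_singleton,
    comp_swap_eq_self (apply_one_eq_apply_two hβ hu.le hν h1), union_self, ncard_singleton]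

theorem ncard_axis_of_one_lt (hβ : 0 < β) (hu : u < 0) (hco : ¬ Coexist β u 0)
    (h : ∃ ν ∈ groundStates β (u, 0), 1 < β * ν 2) :
    (globalMinimizers β (fieldOfUV u 0)).ncard = 2 := by
  obtain ⟨ν, hν, h1⟩ := h
  obtain ⟨ν', hν'⟩ := groundStates_eq_singleton hu.le le_rfl hco
  obtain rfl : ν = ν' := by rw [hν'] at hν; exact hν
  rw [globalMinimizers_eq_of_axis hu, show minimizersOn β sortedSimplex (u, 0) = _ from hν', image_singleton, singleton_union, ncard_pair]
  intro he
  have := congrFun he 1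
  simp only [Function.comp_apply, Equiv.swap_apply_left] at this
  exact (apply_one_lt_apply_two hβ hu.le le_rfl hν h1).ne this

theorem ncard_axis_of_coexist (hβ : 0 < β) (hu : u < 0) (hν : ν ∈ groundStates β (u, 0))
    (hμ : μ ∈ groundStates β (u, 0)) (h1 : 1 < β * ν 2) (h2 : β * μ 2 ≤ 1) :
    (globalMinimizers β (fieldOfUV u 0)).ncard = 3 := by
  have hne : ν ≠ μ := by rintro rfl; linarith
  have e1 := apply_one_eq_apply_two hβ hu.le hμ h2
  have e2 := apply_one_lt_apply_two hβ hu.le le_rfl hν h1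
  rw [globalMinimizers_eq_of_axis hu, show minimizersOn β sortedSimplex (u, 0) = _ from
    groundStates_eq_pair hβ hu.le le_rfl hν hμ hne, image_pair,
    comp_swap_eq_self e1]
  have : ({ν, μ} ∪ {ν ∘ Equiv.swap 1 2, μ} : Set (Fin 3 → ℝ)) = {ν, ν ∘ Equiv.swap 1 2, μ} := by
    ext x
    simp only [mem_union, mem_insert_iff, mem_singleton_iff]
    tauto
  rw [this, ncard_eq_three]
  refine ⟨_, _, _, ?_, hne, ?_, rfl⟩
  · intro he
    have := congrFun he 1
    simp only [Function.comp_apply, Equiv.swap_apply_left] at this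
    exact e2.ne this
  · intro he
    have h3 := congrFun he 1
    have h4 := congrFun he 2
    simp only [Function.comp_apply, Equiv.swap_apply_left, Equiv.swap_apply_right] at h3 h4
    linarith

theorem groundStates_zero_eq (hβ : 0 < β) (hν : ν ∈ groundStates β (0, 0)) : ν 0 = ν 1 := by
  obtain ⟨-, h0, h1⟩ := candidate_of_mem_groundStates hβ le_rfl le_rfl hν
  exact mul_left_cancel₀ hβ.ne' (h0.trans h1.symm)

theorem eq_center (hβ : 0 < β) (hν : ν ∈ groundStates β (0, 0)) (h : β * ν 2 ≤ 1) :
    ν = fun _ => 1 / 3 := by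
  have h0 := groundStates_zero_eq hβ hν
  have h1 := apply_one_eq_apply_two hβ le_rfl hν h
  have hs := hν.1.1.2
  rw [Fin.sum_univ_three] at hs
  funext i
  fin_cases i <;> simp <;> linarith

theorem center_comp (σ : Equiv.Perm (Fin 3)) :
    (fun _ => 1 / 3 : Fin 3 → ℝ) ∘ σ = fun _ => 1 / 3 := rfl

/-- The rearrangements of a vector whose first two coordinates are equal. -/
theorem setOf_comp_perm_eq (h : ν 0 = ν 1) : {x | ∃ σ : Equiv.Perm (Fin 3), x = ν ∘ σ} =
    {ν, ν ∘ Equiv.swap 0 2, ν ∘ Equiv.swap 1 2} := by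
  have key : ∀ σ : Equiv.Perm (Fin 3), ∀ i, ν (σ i) = if σ i = 2 then ν 2 else ν 0 := by
    intro σ i
    generalize σ i = j
    fin_cases j <;> simp [h]
  ext x
  simp only [mem_insert_iff, mem_singleton_iff]
  constructor
  · rintro ⟨σ, rfl⟩
    have hval : ∀ ρ : Equiv.Perm (Fin 3), σ.symm 2 = ρ.symm 2 → ν ∘ σ = ν ∘ ρ := by
      intro ρ hρ
      funext i
      simp only [Function.comp_apply]
      rw [key σ, key ρ]
      have e1 : σ i = 2 ↔ i = σ.symm 2 := (Equiv.eq_symm_apply σ).symm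
      have e2 : ρ i = 2 ↔ i = ρ.symm 2 := (Equiv.eq_symm_apply ρ).symm
      simp only [e1, e2, hρ]
    generalize hj : σ.symm 2 = j at hval
    fin_cases j
    · exact Or.inr (Or.inl (hval (Equiv.swap 0 2) (by simp)))
    · exact Or.inr (Or.inr (hval (Equiv.swap 1 2) (by simp)))
    · exact Or.inl (hval (Equiv.refl _) (by simp))
  · rintro (rfl | rfl | rfl)
    exacts [⟨Equiv.refl _, rfl⟩, ⟨_, rfl⟩, ⟨_, rfl⟩]

theorem ncard_setOf_comp_perm (h : ν 0 = ν 1) (h' : ν 1 < ν 2) :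
    {x | ∃ σ : Equiv.Perm (Fin 3), x = ν ∘ σ}.ncard = 3 := by
  rw [setOf_comp_perm_eq h, ncard_eq_three]
  refine ⟨_, _, _, ?_, ?_, ?_, rfl⟩
  · intro he
    have := congrFun he 0
    simp only [Function.comp_apply, Equiv.swap_apply_left] at this
    linarith
  · intro he
    have := congrFun he 1
    simp only [Function.comp_apply, Equiv.swap_apply_left] at this
    linarith
  · intro he
    have := congrFun he 0
    simp only [Function.comp_apply, Equiv.swap_apply_left] at this
    rw [Equiv.swap_apply_of_ne_of_ne (by decide) (by decide)] at this
    linarith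

theorem ncard_zero_of_le_one (hβ : 0 < β) (h : ∀ ν ∈ groundStates β (0, 0), β * ν 2 ≤ 1) :
    (globalMinimizers β (fieldOfUV 0 0)).ncard = 1 := by
  obtain ⟨ν, hν⟩ := groundStates_nonempty (β := β) (0, 0)
  rw [ncard_eq_one]
  refine ⟨fun _ => 1 / 3, ?_⟩
  rw [globalMinimizers_eq_of_zero]
  ext x
  constructor
  · rintro ⟨σ, μ, hμ, rfl⟩
    rw [eq_center hβ hμ (h μ hμ), center_comp]
    rfl
  · rintro rfl
    exact ⟨Equiv.refl _, ν, hν, by rw [eq_center hβ hν (h ν hν), center_comp]⟩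

theorem ncard_zero_of_one_lt (hβ : 0 < β) (hco : ¬ Coexist β 0 0)
    (h : ∃ ν ∈ groundStates β (0, 0), 1 < β * ν 2) :
    (globalMinimizers β (fieldOfUV 0 0)).ncard = 3 := by
  obtain ⟨ν, hν, h1⟩ := h
  obtain ⟨ν', hν'⟩ := groundStates_eq_singleton le_rfl le_rfl hco
  obtain rfl : ν = ν' := by rw [hν'] at hν; exact hν
  rw [globalMinimizers_eq_of_zero]
  refine Eq.trans (congrArg ncard ?_) (ncard_setOf_comp_perm (groundStates_zero_eq hβ hν)
    (apply_one_lt_apply_two hβ le_rfl le_rfl hν h1))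
  ext x
  simp only [mem_ofPred_eq]
  refine exists_congr fun σ => ⟨?_, fun h => ⟨ν, hν, h⟩⟩
  rintro ⟨μ, hμ, rfl⟩
  have hμ' : μ ∈ groundStates β (0, 0) := hμ
  rw [hν'] at hμ'
  rw [hμ']

theorem ncard_zero_of_coexist (hβ : 0 < β) (hν : ν ∈ groundStates β (0, 0))
    (h1 : 1 < β * ν 2) (hμ : (fun _ => 1 / 3) ∈ groundStates β (0, 0)) :
    (globalMinimizers β (fieldOfUV 0 0)).ncard = 4 := by
  have hlt := apply_one_lt_apply_two hβ le_rfl le_rfl hν h1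
  have hne : ν ≠ fun _ => 1 / 3 := by rintro rfl; exact hlt.false
  have hset : globalMinimizers β (fieldOfUV 0 0) =
      insert (fun _ => 1 / 3) {x | ∃ σ : Equiv.Perm (Fin 3), x = ν ∘ σ} := by
    rw [globalMinimizers_eq_of_zero]
    ext x
    simp only [mem_insert_iff, mem_ofPred_eq]
    constructor
    · rintro ⟨σ, μ', hμ', rfl⟩
      rcases groundStates_eq_or_eq hβ le_rfl le_rfl hν hμ hμ' hne with rfl | rfl
      · exact Or.inr ⟨σ, rfl⟩
      · exact Or.inl rfl
    · rintro (rfl | ⟨σ, rfl⟩)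
      · exact ⟨Equiv.refl _, _, hμ, rfl⟩
      · exact ⟨σ, ν, hν, rfl⟩
  rw [hset, ncard_insert_of_notMem ?_ ?_, ncard_setOf_comp_perm (groundStates_zero_eq hβ hν) hlt]
  · rintro ⟨σ, hσ⟩
    apply hne
    funext i
    have := congrFun hσ (σ.symm i)
    simpa using this.symm
  · rw [setOf_comp_perm_eq (groundStates_zero_eq hβ hν)]
    exact toFinite _

/-! ### Orbits of sorted fields -/

/-- A sorted vector has no other sorted rearrangement. -/
theorem eq_of_comp_perm_mem_cell {f : Fin 3 → ℝ} (hf : f ∈ cell) {σ : Equiv.Perm (Fin 3)}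
    (h : f ∘ σ ∈ cell) : f ∘ σ = f :=
  Tuple.unique_monotone (σ := σ) (τ := Equiv.refl _) (mem_cell_iff_monotone.1 h)
    (mem_cell_iff_monotone.1 hf)

/-- If one permutation sorts all members of `A`, then membership in the orbit of `A` can be
decided on the sorted field. -/
theorem mem_orbit_iff {A : Set (Fin 3 → ℝ)} {ρ : Equiv.Perm (Fin 3)} (hA : ∀ γ ∈ A, γ ∘ ρ ∈ cell)
    {α f : Fin 3 → ℝ} {σ : Equiv.Perm (Fin 3)} (hα : α ∘ σ = f) (hf : f ∈ cell) :
    α ∈ orbit A ↔ f ∘ ρ.symm ∈ A := by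
  subst hα
  constructor
  · rintro ⟨π, hπ⟩
    have h := eq_of_comp_perm_mem_cell hf (σ := ρ.trans (π.trans σ.symm)) (by
      convert hA _ hπ using 1
      funext i
      simp)
    rw [← h]
    convert hπ using 1
    funext i
    simp
  · intro h
    exact ⟨ρ.symm.trans σ, h⟩

theorem fieldOfUV_mem_fields (u v : ℝ) : fieldOfUV u v ∈ fields := by
  refine ⟨fieldOfUV_pos u v, ?_⟩
  have hZ : Real.exp u + Real.exp v + 1 ≠ 0 := by positivity
  rw [Fin.sum_univ_three]
  simp only [fieldOfUV, Matrix.cons_val]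
  field_simp

theorem comp_perm_mem_fields {α : Fin 3 → ℝ} (hα : α ∈ fields) (σ : Equiv.Perm (Fin 3)) :
    α ∘ σ ∈ fields :=
  ⟨fun _ => hα.1 _, (Equiv.sum_comp σ α).trans hα.2⟩

theorem eq_fieldOfUV {α : Fin 3 → ℝ} (hα : α ∈ fields) :
    α = fieldOfUV (uCoord α) (vCoord α) := by
  obtain ⟨hpos, hs⟩ := hα
  have h0 := hpos 0
  have h1 := hpos 1
  have h2 := hpos 2
  rw [Fin.sum_univ_three] at hs
  have hZ : α 0 / α 2 + α 1 / α 2 + 1 = 1 / α 2 := by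
    field_simp
    exact hs
  funext i
  unfold fieldOfUV uCoord vCoord
  rw [Real.exp_log (div_pos h0 h2), Real.exp_log (div_pos h1 h2), hZ]
  fin_cases i <;> simp <;> field_simp

theorem uCoord_fieldOfUV (u v : ℝ) : uCoord (fieldOfUV u v) = u := by
  have hZ : Real.exp u + Real.exp v + 1 ≠ 0 := by positivity
  simp only [uCoord, fieldOfUV, Matrix.cons_val]
  rw [div_div_div_cancel_right₀ hZ, div_one, Real.log_exp]

theorem vCoord_fieldOfUV (u v : ℝ) : vCoord (fieldOfUV u v) = v := by
  have hZ : Real.exp u + Real.exp v + 1 ≠ 0 := by positivity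
  simp only [vCoord, fieldOfUV, Matrix.cons_val]
  rw [div_div_div_cancel_right₀ hZ, div_one, Real.log_exp]

theorem fieldOfUV_inj {u' v' : ℝ} : fieldOfUV u v = fieldOfUV u' v' ↔ u = u' ∧ v = v' := by
  constructor
  · intro h
    have h1 := congrArg uCoord h
    have h2 := congrArg vCoord h
    rw [uCoord_fieldOfUV, uCoord_fieldOfUV] at h1
    rw [vCoord_fieldOfUV, vCoord_fieldOfUV] at h2
    exact ⟨h1, h2⟩
  · rintro ⟨rfl, rfl⟩; rfl

/-- Every field is a permutation of a field with coordinates in the wedge `u ≤ v ≤ 0`. -/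
theorem exists_comp_perm_eq_fieldOfUV {α : Fin 3 → ℝ} (hα : α ∈ fields) :
    ∃ (σ : Equiv.Perm (Fin 3)) (u v : ℝ), u ≤ v ∧ v ≤ 0 ∧ α ∘ σ = fieldOfUV u v := by
  have h := eq_fieldOfUV (comp_perm_mem_fields hα (Tuple.sort α))
  have hc : α ∘ Tuple.sort α ∈ cell := mem_cell_iff_monotone.2 (Tuple.monotone_sort α)
  rw [h] at hc
  obtain ⟨h1, h2⟩ := fieldOfUV_mem_cell_iff.1 hc
  exact ⟨_, _, _, h1, h2, h⟩

theorem yCoord_axis (s : ℝ) : yCoord (fieldOfUV s 0 ∘ Equiv.swap 0 2) =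
    -((1 - Real.exp s) / (2 + Real.exp s)) := by
  have hZ : 2 + Real.exp s ≠ 0 := by positivity
  have hZ' : Real.exp s + 1 + 1 ≠ 0 := by positivity
  simp only [yCoord, fieldOfUV, Function.comp_apply, Equiv.swap_apply_right, Matrix.cons_val,
    Real.exp_zero]
  field_simp
  ring

theorem xCoord_comp_swap : xCoord (fieldOfUV u v ∘ Equiv.swap 0 2) = 0 ↔ v = 0 := by
  have hZ : 0 < Real.exp u + Real.exp v + 1 := by positivity
  have h3 : Real.sqrt 3 / 2 ≠ 0 := by positivity
  simp only [xCoord, fieldOfUV, Function.comp_apply, Equiv.swap_apply_left, Matrix.cons_val]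
  rw [Equiv.swap_apply_of_ne_of_ne (by decide) (by decide), mul_eq_zero, or_iff_right h3,
    sub_eq_zero, div_left_inj' hZ.ne']
  rw [eq_comm]
  exact Real.exp_eq_one_iff v

/-- The segments of the symmetry axes in terms of the coordinates of the sorted field. -/
theorem mem_orbit_axisSegment_iff {α : Fin 3 → ℝ} {σ : Equiv.Perm (Fin 3)} {s : ℝ} (hs : s ≤ 0)
    (huv : u ≤ v) (hv : v ≤ 0) (hα : α ∘ σ = fieldOfUV u v) :
    α ∈ orbit (axisSegment (-(1 / 2)) (-((1 - Real.exp s) / (2 + Real.exp s)))) ↔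
      v = 0 ∧ u < s := by
  have hes : Real.exp s ≤ 1 := Real.exp_le_one_iff.2 hs
  have hpos := Real.exp_pos s
  rw [mem_orbit_iff (ρ := Equiv.swap 0 2) ?_ hα (fieldOfUV_mem_cell_iff.2 ⟨huv, hv⟩)]
  · rw [Equiv.symm_swap]
    constructor
    · rintro ⟨-, hx, -, hy⟩
      obtain rfl := xCoord_comp_swap.1 hx
      refine ⟨rfl, ?_⟩
      rw [yCoord_axis, neg_lt_neg_iff, div_lt_div_iff₀ (by positivity) (by positivity)] at hy
      rw [← Real.exp_lt_exp]
      linarith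
    · rintro ⟨rfl, hus⟩
      refine ⟨comp_perm_mem_fields (fieldOfUV_mem_fields _ _) _, xCoord_comp_swap.2 rfl, ?_, ?_⟩
      · rw [yCoord_axis, neg_lt_neg_iff, div_lt_div_iff₀ (by positivity) (by positivity)]
        linarith [Real.exp_pos u]
      · rw [yCoord_axis, neg_lt_neg_iff, div_lt_div_iff₀ (by positivity) (by positivity)]
        linarith [Real.exp_lt_exp.2 hus]
  · rintro γ ⟨⟨-, hsum⟩, hx, -, hy⟩
    have h3 : Real.sqrt 3 / 2 ≠ 0 := by positivity
    have h01 : γ 0 = γ 1 := by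
      rw [xCoord, mul_eq_zero, or_iff_right h3] at hx
      linarith
    have hy0 : yCoord γ < 0 := hy.trans_le (neg_nonpos.2 (div_nonneg (by linarith) (by positivity)))
    rw [yCoord] at hy0
    rw [Fin.sum_univ_three] at hsum
    change γ (Equiv.swap 0 2 0) ≤ γ (Equiv.swap 0 2 1) ∧ γ (Equiv.swap 0 2 1) ≤ γ (Equiv.swap 0 2 2)
    rw [Equiv.swap_apply_left, Equiv.swap_apply_right,
      Equiv.swap_apply_of_ne_of_ne (by decide) (by decide)]
    exact ⟨by linarith, h01.ge⟩

end

section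

variable {β u v : ℝ} {ν μ : Fin 3 → ℝ}

/-! ### The symmetry axis and the zero field -/

theorem mass_axis_one (u : ℝ) : mass u 0 1 = low (u - 1) + 2 := by
  rw [mass, ell_one, add_zero, low_neg_one, show (-1 : ℝ) + u = u - 1 by ring]
  ring

/-- A disordered phase requires mass at least `β` at the end `z = 1` of the disordered branch. -/
theorem le_mass_one (hβ : 0 < β) (huv : u ≤ v) (hv : v ≤ 0) (hν : ν ∈ groundStates β (u, v))
    (h : β * ν 2 ≤ 1) : β ≤ mass u v 1 := by
  have hc := (candidate_of_mem_groundStates hβ huv hv hν).1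
  rw [← hc.mass_eq]
  exact mass_strictMonoOn_Ioc.monotoneOn ⟨hc.pos, h⟩ ⟨one_pos, le_rfl⟩ h

theorem mass_axis_one_lt_iff (h2 : 2 < β) (h3 : β ≤ 3) :
    mass u 0 1 < β ↔ u < ell (β - 2) + 1 := by
  rw [mass_axis_one]
  constructor
  · intro h
    by_contra! hle
    have := low_mono (show ell (β - 2) ≤ u - 1 by linarith)
    rw [low_ell (by linarith) (by linarith)] at this
    linarith
  · intro h
    linarith [low_lt_of_lt_ell (show 0 < β - 2 by linarith) (show u - 1 < ell (β - 2) by linarith)]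

theorem not_coexist_of_le (hβ0 : 0 < β) (hβ : β ≤ 18 / 7) : ¬ Coexist β u v := by
  intro h
  obtain ⟨m, hm⟩ := h.exists_isSaddle hβ0
  obtain ⟨a, ha, ham⟩ := hm.upper
  obtain ⟨b, hb, hbm⟩ := hm.lower
  have ca := (candidate_of_mem_groundStates hβ0 hm.wedge_left hm.wedge_right ha).1
  have cb := (candidate_of_mem_groundStates hβ0 hm.wedge_left hm.wedge_right hb).1
  exact (lt_mass_of_le hβ hm.wedge_left hm.wedge_right cb.pos (hbm.trans ham)
    cb.mass_eq.ge).ne ca.mass_eq.symm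

theorem le_one_of_le_mass_one (hβ0 : 0 < β) (hβ : β ≤ 18 / 7) (huv : u ≤ v) (hv : v ≤ 0)
    (hν : ν ∈ groundStates β (u, v)) (h : β ≤ mass u v 1) : β * ν 2 ≤ 1 := by
  by_contra! hlt
  have hc := (candidate_of_mem_groundStates hβ0 huv hv hν).1
  exact (lt_mass_of_le hβ huv hv one_pos hlt h).ne hc.mass_eq.symm

/-- Two ordered phases would force the lower one to have a large first coordinate. -/
theorem not_coexist_of_forall (hβ : 0 < β)
    (h : ∀ ν ∈ groundStates β (u, v), 1 < β * ν 2 ∧ β * ν 0 < 4 / 7) : ¬ Coexist β u v := by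
  intro hco
  obtain ⟨m, hm⟩ := hco.exists_isSaddle hβ
  obtain ⟨a, ha, ham⟩ := hm.upper
  obtain ⟨b, hb, hbm⟩ := hm.lower
  have ca := candidate_of_mem_groundStates hβ hm.wedge_left hm.wedge_right ha
  have cb := candidate_of_mem_groundStates hβ hm.wedge_left hm.wedge_right hb
  have := cb.1.low_gt_of_one_lt hm.wedge_left hm.wedge_right ca.1 (hbm.trans ham) (h b hb).1
  linarith [(h b hb).2, cb.2.1]

theorem mul_apply_zero_lt (hβ : 0 < β) (hu : u ≤ 0) (hν : ν ∈ groundStates β (u, 0))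
    (h : 1 < β * ν 2) : β * ν 0 < 4 / 7 := by
  obtain ⟨hc, h0, -⟩ := candidate_of_mem_groundStates hβ hu le_rfl hν
  rw [h0]
  exact low_lt_of_gap_nonneg_axis h hu (hc.gap_nonneg h)

theorem sum_mul_self_ge (h : ν ∈ stdSimplex ℝ (Fin 3)) :
    1 / 3 + (ν 2 - 1 / 3) ^ 2 ≤ ∑ i, ν i * ν i := by
  have hs := h.2
  rw [Fin.sum_univ_three] at hs ⊢
  nlinarith [sq_nonneg (ν 0 - 1 / 3), sq_nonneg (ν 1 - 1 / 3)]

/-- The ordered phase at the Ellis-Wang point. -/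
noncomputable def orderedState : Fin 3 → ℝ := ![1 / 6, 1 / 6, 2 / 3]

theorem orderedState_mem : orderedState ∈ sortedSimplex := by
  refine ⟨⟨fun i => ?_, ?_⟩, ?_⟩
  · fin_cases i <;> norm_num [orderedState]
  · simp [orderedState, Fin.sum_univ_three]; norm_num
  · simp [orderedState, cell]; norm_num

theorem center_mem : (fun _ => 1 / 3 : Fin 3 → ℝ) ∈ sortedSimplex := by
  refine ⟨⟨fun i => by norm_num, ?_⟩, le_rfl, le_rfl⟩
  simp

theorem tiltedEnergy_center : tiltedEnergy β (0, 0) (fun _ => 1 / 3) = -β / 6 - Real.log 3 := by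
  simp only [tiltedEnergy, Fin.sum_univ_three]
  rw [one_div (3 : ℝ), Real.log_inv]
  ring

theorem tiltedEnergy_orderedState :
    tiltedEnergy β (0, 0) orderedState = -β / 4 + Real.log 2 / 3 - Real.log 3 := by
  simp only [tiltedEnergy, Fin.sum_univ_three, orderedState, Matrix.cons_val]
  rw [one_div (6 : ℝ), Real.log_inv, Real.log_div (by norm_num) (by norm_num),
    show (6 : ℝ) = 2 * 3 by norm_num, Real.log_mul (by norm_num) (by norm_num)]
  ring

theorem four_log_two_lt : 4 * Real.log 2 < 2.8 := by linarith [Real.log_two_lt_d9]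

theorem lt_four_log_two : 2.75 < 4 * Real.log 2 := by linarith [Real.log_two_gt_d9]

theorem isCandidate_center (hβ : 0 < β) (h3 : β ≤ 3) : IsCandidate β 0 0 (β / 3) where
  pos := by positivity
  mass_eq := by
    rw [mass, add_zero, low_ell (by positivity) (by linarith)]
    ring
  gap_nonneg := fun h => by linarith

theorem isCandidate_orderedState :
    IsCandidate (4 * Real.log 2) 0 0 (4 * Real.log 2 * (2 / 3)) := by
  have h1 := four_log_two_lt
  have h2 := lt_four_log_two
  set b := 4 * Real.log 2 with hb
  have hlow : low (ell (b * (2 / 3))) = b / 6 := by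
    rw [← low_ell (show 0 < b / 6 by linarith) (by linarith)]
    congr 1
    -- The two arguments differ by the factor `4`, so `ell` agrees as `log 4 = b / 2`.
    have h4 : Real.log 4 = b / 2 := by
      rw [hb, show (4 : ℝ) = 2 ^ 2 by norm_num, Real.log_pow]
      push_cast
      ring
    rw [ell, ell, show b * (2 / 3) = 4 * (b / 6) by ring,
      Real.log_mul (by norm_num) (by linarith), h4]
    ring
  refine ⟨by linarith, ?_, fun _ => ?_⟩
  · rw [mass, add_zero, hlow]
    ring
  · rw [gap, odds, add_zero, hlow]
    have h3 : 0 < b * (2 / 3) - 1 := by linarith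
    have h4 : 0 < 1 - b / 6 := by linarith
    have key : b * (2 / 3) / (b * (2 / 3) - 1) - b / 6 / (1 - b / 6) - b / 6 / (1 - b / 6) =
        b * (3 - b) / (3 * (b * (2 / 3) - 1) * (1 - b / 6)) := by
      have := h3.ne'
      have := h4.ne'
      have : b * 2 - 3 ≠ 0 := by linarith
      have : 6 - b ≠ 0 := by linarith
      field_simp
      ring
    rw [key]
    have : 0 < 3 - b := by linarith
    have : 0 < b := by linarith
    positivity

/-- At the Ellis-Wang point and zero field the uniform distribution and the ordered state have
the same, minimal, energy. -/
theorem tiltedEnergy_of_mem_groundStates (hν : ν ∈ groundStates (4 * Real.log 2) (0, 0)) :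
    tiltedEnergy (4 * Real.log 2) (0, 0) ν =
      tiltedEnergy (4 * Real.log 2) (0, 0) (fun _ => 1 / 3) := by
  have h1 := four_log_two_lt
  have h2 := lt_four_log_two
  have hpos : 0 < 4 * Real.log 2 := by linarith
  rcases le_or_gt (4 * Real.log 2 * ν 2) 1 with hle | hlt
  · rw [eq_center hpos hν hle]
  · have hc := (candidate_of_mem_groundStates hpos le_rfl le_rfl hν).1
    have h01 := groundStates_zero_eq hpos hν
    have hcc := isCandidate_center hpos (by linarith)
    have hz : 4 * Real.log 2 * ν 2 = 4 * Real.log 2 * (2 / 3) := by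
      rcases lt_trichotomy (4 * Real.log 2 * ν 2) (4 * Real.log 2 * (2 / 3)) with h | h | h
      · exact (hcc.not_lt_lt le_rfl le_rfl hc isCandidate_orderedState (by linarith) h).elim
      · exact h
      · exact (hcc.not_lt_lt le_rfl le_rfl isCandidate_orderedState hc (by linarith) h).elim
    have hz2 : ν 2 = 2 / 3 := mul_left_cancel₀ hpos.ne' hz
    have hs := hν.1.1.2
    rw [Fin.sum_univ_three] at hs
    have : ν = orderedState := by
      funext i
      fin_cases i <;> simp [orderedState] <;> linarith
    rw [this, tiltedEnergy_center, tiltedEnergy_orderedState]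
    ring

theorem center_mem_groundStates_four_log_two :
    (fun _ => 1 / 3) ∈ groundStates (4 * Real.log 2) (0, 0) := by
  obtain ⟨ν, hν⟩ := groundStates_nonempty (β := 4 * Real.log 2) (0, 0)
  exact ⟨center_mem, fun μ hμ => (tiltedEnergy_of_mem_groundStates hν).symm.trans_le (hν.2 μ hμ)⟩

theorem orderedState_mem_groundStates :
    orderedState ∈ groundStates (4 * Real.log 2) (0, 0) := by
  refine ⟨orderedState_mem, fun μ hμ => le_trans (le_of_eq ?_)
    (center_mem_groundStates_four_log_two.2 μ hμ)⟩
  rw [tiltedEnergy_center, tiltedEnergy_orderedState]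
  ring

/-- Dependence of the energy on the inverse temperature. -/
theorem tiltedEnergy_eq_add (β γ : ℝ) (y : ℝ × ℝ) (ν : Fin 3 → ℝ) :
    tiltedEnergy β y ν = tiltedEnergy γ y ν + (γ - β) / 2 * ∑ i, ν i * ν i := by
  unfold tiltedEnergy
  ring

/-- Below the Ellis-Wang point the uniform distribution is the only phase at zero field, since it
minimizes `∑ i, ν i * ν i`. -/
theorem le_one_of_lt_four_log_two (h : β < 4 * Real.log 2)
    (hν : ν ∈ groundStates β (0, 0)) : β * ν 2 ≤ 1 := by
  have h1 := hν.2 _ center_mem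
  have h2 := center_mem_groundStates_four_log_two.2 ν hν.1
  have h3 := sum_mul_self_ge hν.1.1
  rw [tiltedEnergy_eq_add β (4 * Real.log 2) (0, 0) ν,
    tiltedEnergy_eq_add β (4 * Real.log 2) (0, 0) (fun _ => 1 / 3)] at h1
  have h4 : ∑ i : Fin 3, (fun _ => (1 / 3 : ℝ)) i * (fun _ => (1 / 3 : ℝ)) i = 1 / 3 := by
    simp
  rw [h4] at h1
  have h5 : (ν 2 - 1 / 3) ^ 2 ≤ 0 := by
    by_contra! hpos
    nlinarith
  have h6 : ν 2 = 1 / 3 := by nlinarith [sq_nonneg (ν 2 - 1 / 3)]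
  rw [h6]
  linarith [four_log_two_lt]

/-- Beyond the Ellis-Wang point all phases at zero field are ordered. -/
theorem one_lt_of_four_log_two_lt (h : 4 * Real.log 2 < β)
    (hν : ν ∈ groundStates β (0, 0)) : 1 < β * ν 2 := by
  have hβ : 0 < β := by linarith [lt_four_log_two]
  by_contra! hle
  have := hν.2 _ orderedState_mem
  rw [eq_center hβ hν hle, tiltedEnergy_center, tiltedEnergy_orderedState] at this
  linarith

theorem exists_one_lt_of_four_log_two_le (h : 4 * Real.log 2 ≤ β) :
    ∃ ν ∈ groundStates β (0, 0), 1 < β * ν 2 := by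
  rcases h.eq_or_lt with rfl | h
  · refine ⟨_, orderedState_mem_groundStates, ?_⟩
    simp only [orderedState, Matrix.cons_val]
    linarith [lt_four_log_two]
  · obtain ⟨ν, hν⟩ := groundStates_nonempty (β := β) (0, 0)
    exact ⟨ν, hν, one_lt_of_four_log_two_lt h hν⟩

/-- From the Ellis-Wang point on, all phases in a nonzero field are ordered: the field moves mass
to the largest coordinate, compared with an ordered phase at zero field. -/
theorem ordered_of_four_log_two_le (h : 4 * Real.log 2 ≤ β) (hu : u < 0) (hv : v ≤ 0)
    (hμ : μ ∈ groundStates β (u, v)) : 1 < β * μ 2 ∧ β * μ 0 < 4 / 7 := by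
  have hβ : 0 < β := by linarith [lt_four_log_two]
  obtain ⟨ν, hν, hν1⟩ := exists_one_lt_of_four_log_two_le h
  have h0 := mul_apply_zero_lt hβ le_rfl hν hν1
  have h01 := groundStates_zero_eq hβ hν
  have hmono := groundStates_monotone hν hμ
  simp only [sub_zero] at hmono
  have hμ0 : μ 0 ≤ ν 0 := by
    by_contra! hlt
    have : ν 1 ≤ μ 1 := by linarith [hμ.1.2.1]
    nlinarith
  have hlt : β * μ 0 < 4 / 7 := (mul_le_mul_of_nonneg_left hμ0 hβ.le).trans_lt h0
  refine ⟨?_, hlt⟩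
  by_contra! hle
  have hs := hμ.1.1.2
  rw [Fin.sum_univ_three] at hs
  have h12 : β * μ 1 ≤ β * μ 2 := mul_le_mul_of_nonneg_left hμ.1.2.2 hβ.le
  have : β * μ 0 + β * μ 1 + β * μ 2 = β := by rw [← mul_add, ← mul_add, hs, mul_one]
  linarith [lt_four_log_two]

/-! ### The triple point -/

/-- If there are ordered phases at one point of the symmetry axis and disordered ones at a point
closer to zero, then they coexist in between. -/
theorem exists_coexist_axis (hβ : 18 / 7 < β) {a b : ℝ} (hab : a ≤ b) (hb : b ≤ 0)
    (h1 : ∃ ν ∈ groundStates β (a, 0), 1 < β * ν 2)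
    (h2 : ∃ ν ∈ groundStates β (b, 0), β * ν 2 ≤ 1) :
    ∃ u ∈ Icc a b, Coexist β u 0 ∧ (∃ ν ∈ groundStates β (u, 0), 1 < β * ν 2) ∧
      ∃ ν ∈ groundStates β (u, 0), β * ν 2 ≤ 1 := by
  have hβ0 : 0 < β := by linarith
  have hγ : Continuous fun t : ℝ => (t, (0 : ℝ)) := by fun_prop
  obtain ⟨ν, hν, hν1⟩ := h1
  obtain ⟨μ, hμ, hμ1⟩ := h2
  -- The bound on the smallest coordinate keeps the ordered phases away from `β * ν 2 = 1`.
  obtain ⟨u, hu, ⟨x, hx, hx1, hx0⟩, y, hy, hy1⟩ := exists_mem_both (β := β) hγ hab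
    ((isClosed_setOf_le_apply 1 2).inter (isClosed_setOf_apply_le (4 / 7) 0))
    (isClosed_setOf_apply_le 1 2) (fun t ht x hx => by
      rcases le_or_gt (β * x 2) 1 with h | h
      · exact Or.inr h
      · exact Or.inl ⟨h.le, (mul_apply_zero_lt hβ0 (ht.2.trans hb) hx h).le⟩)
    ⟨ν, hν, hν1.le, (mul_apply_zero_lt hβ0 (hab.trans hb) hν hν1).le⟩ ⟨μ, hμ, hμ1⟩
  simp only [mem_ofPred_eq] at hx1 hx0 hy1
  have hx' : 1 < β * x 2 := by
    refine lt_of_le_of_ne hx1 fun he => ?_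
    have h12 := apply_one_eq_apply_two hβ0 (hu.2.trans hb) hx he.ge
    have hs := hx.1.1.2
    rw [Fin.sum_univ_three] at hs
    have h3 : β * x 0 + β * x 1 + β * x 2 = β := by rw [← mul_add, ← mul_add, hs, mul_one]
    rw [h12] at h3
    linarith
  refine ⟨u, hu, ⟨hu.2.trans hb, le_rfl, x, hx, y, hy, ?_⟩, ⟨x, hx, hx'⟩, y, hy, hy1⟩
  rintro rfl
  linarith

theorem exists_ordered_of_lt (hβ2 : 2 < β) (hβ3 : β ≤ 3) (hu0 : u ≤ 0) (hu : u < ell (β - 2) + 1) :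
    ∃ ν ∈ groundStates β (u, 0), 1 < β * ν 2 := by
  obtain ⟨ν, hν⟩ := groundStates_nonempty (β := β) (u, 0)
  refine ⟨ν, hν, ?_⟩
  by_contra! hle
  have := le_mass_one (by linarith) hu0 le_rfl hν hle
  linarith [(mass_axis_one_lt_iff hβ2 hβ3).2 hu]

/-- For intermediate `β` there is a point on the symmetry axis where ordered and disordered phases
coexist, while the axis is ordered before it and disordered after it. -/
theorem exists_triple_point (h1 : 18 / 7 < β) (h2 : β < 4 * Real.log 2) :
    ∃ u₀ < 0, Coexist β u₀ 0 ∧ (∃ ν ∈ groundStates β (u₀, 0), 1 < β * ν 2) ∧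
      (∃ ν ∈ groundStates β (u₀, 0), β * ν 2 ≤ 1) ∧
      (∀ u < u₀, ∀ ν ∈ groundStates β (u, 0), 1 < β * ν 2) ∧
      ∀ u, u₀ < u → u ≤ 0 → ∀ ν ∈ groundStates β (u, 0), β * ν 2 ≤ 1 := by
  have hβ : 0 < β := by linarith
  have h3 : β ≤ 3 := by linarith [four_log_two_lt]
  have hord : ∀ u ≤ ell (β - 2), ∃ ν ∈ groundStates β (u, 0), 1 < β * ν 2 := fun u hu =>
    exists_ordered_of_lt (by linarith) h3
      (by linarith [ell_le_neg_one (show 0 < β - 2 by linarith)]) (by linarith)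
  have h0 : ∃ ν ∈ groundStates β (0, 0), β * ν 2 ≤ 1 := by
    obtain ⟨ν, hν⟩ := groundStates_nonempty (β := β) (0, 0)
    exact ⟨ν, hν, le_one_of_lt_four_log_two h2 hν⟩
  obtain ⟨u₀, hu₀, hco, hx, hy⟩ := exists_coexist_axis h1
    (by linarith [ell_le_neg_one (show 0 < β - 2 by linarith)]) le_rfl (hord _ le_rfl) h0
  refine ⟨u₀, lt_of_le_of_ne hu₀.2 ?_, hco, hx, hy, ?_, ?_⟩
  · rintro rfl
    obtain ⟨x, hx, hx1⟩ := hx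
    linarith [le_one_of_lt_four_log_two h2 hx]
  · intro u hu ν hν
    by_contra! hle
    obtain ⟨u', hu', hco', -⟩ := exists_coexist_axis h1 (min_le_right (ell (β - 2)) u)
      (hu.le.trans hu₀.2) (hord _ (min_le_left _ _)) ⟨ν, hν, hle⟩
    linarith [(hco'.antichain hβ hco (hu'.2.trans hu.le) le_rfl).1, hu'.2]
  · intro u hu hu0 ν hν
    by_contra! hlt
    obtain ⟨u', hu', hco', -⟩ := exists_coexist_axis h1 hu0 le_rfl ⟨ν, hν, hlt⟩ h0
    linarith [(hco.antichain hβ hco' (hu.le.trans hu'.1) le_rfl).1, hu'.1]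

/-! ### The phase diagrams -/

/-- For `β ≤ 2` the axis is disordered throughout. -/
theorem ncard_of_le_two (hβ : 0 < β) (h : β ≤ 2) (huv : u ≤ v) (hv : v ≤ 0) :
    (globalMinimizers β (fieldOfUV u v)).ncard = 1 := by
  have h18 : β ≤ 18 / 7 := by linarith
  rcases hv.lt_or_eq with hv | rfl
  · exact ncard_of_neg hβ huv hv (not_coexist_of_le hβ h18)
  have hle : ∀ ν ∈ groundStates β (u, 0), β * ν 2 ≤ 1 := fun ν hν =>
    le_one_of_le_mass_one hβ h18 huv le_rfl hν
      (by rw [mass_axis_one]; linarith [low_pos (u - 1)])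
  rcases huv.lt_or_eq with hu | rfl
  · obtain ⟨ν, hν⟩ := groundStates_nonempty (β := β) (u, 0)
    exact ncard_axis_of_le_one hβ hu (not_coexist_of_le hβ h18) ⟨ν, hν, hle ν hν⟩
  · exact ncard_zero_of_le_one hβ hle

theorem ncard_of_le (h2 : 2 < β) (h : β ≤ 18 / 7) (huv : u ≤ v) (hv : v ≤ 0) :
    (v = 0 ∧ u < ell (β - 2) + 1 → (globalMinimizers β (fieldOfUV u v)).ncard = 2) ∧
      (¬ (v = 0 ∧ u < ell (β - 2) + 1) → (globalMinimizers β (fieldOfUV u v)).ncard = 1) := by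
  have hβ : 0 < β := by linarith
  have hs : ell (β - 2) + 1 < 0 := by
    linarith [ell_lt_neg_one (show 0 < β - 2 by linarith) (by linarith)]
  constructor
  · rintro ⟨rfl, hu⟩
    exact ncard_axis_of_one_lt hβ (hu.trans hs) (not_coexist_of_le hβ h)
      (exists_ordered_of_lt h2 (by linarith) huv hu)
  · intro hnot
    rcases hv.lt_or_eq with hv | rfl
    · exact ncard_of_neg hβ huv hv (not_coexist_of_le hβ h)
    have hu' : ell (β - 2) + 1 ≤ u := by
      by_contra! h'
      exact hnot ⟨rfl, h'⟩
    have hle : ∀ ν ∈ groundStates β (u, 0), β * ν 2 ≤ 1 := fun ν hν =>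
      le_one_of_le_mass_one hβ h huv le_rfl hν <| by
        by_contra! h'
        exact hu'.not_gt ((mass_axis_one_lt_iff h2 (by linarith)).1 h')
    rcases huv.lt_or_eq with hu | rfl
    · obtain ⟨ν, hν⟩ := groundStates_nonempty (β := β) (u, 0)
      exact ncard_axis_of_le_one hβ hu (not_coexist_of_le hβ h) ⟨ν, hν, hle ν hν⟩
    · exact ncard_zero_of_le_one hβ hle

theorem ncard_of_four_log_two_le (h : 4 * Real.log 2 ≤ β) (hu : u < 0) (huv : u ≤ v) (hv : v ≤ 0) :
    (v = 0 → (globalMinimizers β (fieldOfUV u v)).ncard = 2) ∧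
      (v ≠ 0 → (globalMinimizers β (fieldOfUV u v)).ncard = 1) := by
  have hβ : 0 < β := by linarith [lt_four_log_two]
  have hno : ¬ Coexist β u v :=
    not_coexist_of_forall hβ fun ν hν => ordered_of_four_log_two_le h hu hv hν
  constructor
  · rintro rfl
    obtain ⟨ν, hν⟩ := groundStates_nonempty (β := β) (u, 0)
    exact ncard_axis_of_one_lt hβ hu hno ⟨ν, hν, (ordered_of_four_log_two_le h hu hv hν).1⟩
  · exact fun hne => ncard_of_neg hβ huv (lt_of_le_of_ne hv hne) hno

theorem fieldOfUV_zero : fieldOfUV 0 0 = fun _ => 1 / 3 := by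
  funext i
  fin_cases i <;> simp [fieldOfUV] <;> norm_num

theorem comp_eq_fieldOfUV_zero_iff {α : Fin 3 → ℝ} {σ : Equiv.Perm (Fin 3)}
    (hα : α ∘ σ = fieldOfUV u v) : α = (fun _ => 1 / 3) ↔ u = 0 ∧ v = 0 := by
  rw [← fieldOfUV_inj (u' := 0) (v' := 0), fieldOfUV_zero, ← hα]
  constructor
  · rintro rfl
    rfl
  · intro h
    funext i
    have := congrFun h (σ.symm i)
    simpa using this

/-- The union of the coexistence segment and the coexistence curve, both without the triple point,
for sorted fields. -/
theorem coexist_or_axis_iff {α : Fin 3 → ℝ} {σ : Equiv.Perm (Fin 3)} {u₀ : ℝ} (hβ : 0 < β)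
    (hu₀ : u₀ < 0) (huv : u ≤ v) (hv : v ≤ 0) (hα : α ∘ σ = fieldOfUV u v) :
    α ∈ orbit (axisSegment (-(1 / 2)) (yCoord (fieldOfUV u₀ 0 ∘ Equiv.swap 0 2))) ∪
        orbit (maxwellCurve u₀ (coexistDomain β) (coexistCurve β)) ↔
      (v = 0 ∧ u < u₀) ∨ (Coexist β u v ∧ u ≠ u₀) := by
  rw [mem_union, yCoord_axis, mem_orbit_axisSegment_iff hu₀.le huv hv hα]
  refine or_congr Iff.rfl ?_
  rw [mem_orbit_iff (ρ := Equiv.refl _) ?_ hα (fieldOfUV_mem_cell_iff.2 ⟨huv, hv⟩)]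
  · constructor
    · rintro ⟨x, hx, hne, he⟩
      obtain ⟨rfl, rfl⟩ := fieldOfUV_inj.1 he
      exact ⟨coexist_coexistCurve hx, hne⟩
    · rintro ⟨hco, hne⟩
      refine ⟨u, ⟨v, hco⟩, hne, ?_⟩
      rw [← hco.eq_coexistCurve hβ]
      rfl
  · rintro γ ⟨x, hx, -, rfl⟩
    have := coexist_coexistCurve hx
    exact fieldOfUV_mem_cell_iff.2 ⟨this.1, this.2.1⟩

theorem mem_orbit_triple_iff {α : Fin 3 → ℝ} {σ : Equiv.Perm (Fin 3)} {u₀ : ℝ}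
    (hu₀ : u₀ < 0) (huv : u ≤ v) (hv : v ≤ 0) (hα : α ∘ σ = fieldOfUV u v) :
    α ∈ orbit {fieldOfUV u₀ 0 ∘ Equiv.swap 0 2} ↔ u = u₀ ∧ v = 0 := by
  have hinv : ∀ f : Fin 3 → ℝ, (f ∘ Equiv.swap 0 2) ∘ Equiv.swap 0 2 = f := by
    intro f
    funext i
    simp
  rw [mem_orbit_iff (ρ := Equiv.swap 0 2) ?_ hα (fieldOfUV_mem_cell_iff.2 ⟨huv, hv⟩),
    mem_singleton_iff, Equiv.symm_swap, ← fieldOfUV_inj]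
  · constructor
    · intro h
      rw [← hinv (fieldOfUV u v), h, hinv]
    · intro h
      rw [h]
  · rintro γ rfl
    rw [hinv]
    exact fieldOfUV_mem_cell_iff.2 ⟨hu₀.le, le_rfl⟩

/-- The numbers of global minimizers for intermediate `β`, away from the triple point `(u₀, 0)`. -/
theorem ncard_of_ne_triple (hβ : 0 < β) {u₀ : ℝ} (hu₀ : u₀ < 0) (hco : Coexist β u₀ 0)
    (hord : ∀ u < u₀, ∀ ν ∈ groundStates β (u, 0), 1 < β * ν 2)
    (hdis : ∀ u, u₀ < u → u ≤ 0 → ∀ ν ∈ groundStates β (u, 0), β * ν 2 ≤ 1)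
    (huv : u ≤ v) (hv : v ≤ 0) (hne : ¬ (u = u₀ ∧ v = 0)) :
    ((v = 0 ∧ u < u₀) ∨ (Coexist β u v ∧ u ≠ u₀) →
        (globalMinimizers β (fieldOfUV u v)).ncard = 2) ∧
      (¬ ((v = 0 ∧ u < u₀) ∨ (Coexist β u v ∧ u ≠ u₀)) →
        (globalMinimizers β (fieldOfUV u v)).ncard = 1) := by
  have haxis : ∀ u, u ≠ u₀ → ¬ Coexist β u 0 := by
    intro u hu h
    rcases le_total u u₀ with hle | hle
    · exact hu (h.antichain hβ hco hle le_rfl).1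
    · exact hu (hco.antichain hβ h hle le_rfl).1.symm
  rcases hv.lt_or_eq with hv | rfl
  · constructor
    · rintro (⟨h, -⟩ | ⟨h, -⟩)
      · exact absurd h hv.ne
      · exact h.ncard_of_neg hβ hv
    · intro h
      refine ncard_of_neg hβ huv hv fun hc => h (Or.inr ⟨hc, ?_⟩)
      rintro rfl
      exact hv.ne (hc.right_unique hβ hco)
  · have hu : u ≠ u₀ := fun h => hne ⟨h, rfl⟩
    obtain ⟨ν, hν⟩ := groundStates_nonempty (β := β) (u, 0)
    constructor
    · rintro (⟨-, h⟩ | ⟨h, -⟩)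
      · exact ncard_axis_of_one_lt hβ (h.trans hu₀) (haxis u hu) ⟨ν, hν, hord u h ν hν⟩
      · exact absurd h (haxis u hu)
    · intro h
      have hlt : u₀ < u := lt_of_le_of_ne (not_lt.1 fun h' => h (Or.inl ⟨rfl, h'⟩)) hu.symm
      rcases huv.lt_or_eq with hu0 | rfl
      · exact ncard_axis_of_le_one hβ hu0 (haxis u hu) ⟨ν, hν, hdis u hlt huv ν hν⟩
      · exact ncard_zero_of_le_one hβ (hdis 0 hlt le_rfl)

end

end PottsField

theorem mainTheorem4 (β : ℝ) (hβ : 0 < β) :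
    -- high temperature
    (β ≤ 2 → ∀ α ∈ PottsField.fields, (PottsField.globalMinimizers β α).ncard = 1) ∧
    -- symmetry-axis segments only
    (2 < β → β ≤ 18 / 7 → ∀ α ∈ PottsField.fields,
      (α ∈ PottsField.orbit (PottsField.axisSegment (-(1 / 2))
          (-((1 - (β - 2) * Real.exp (3 - β)) / (2 + (β - 2) * Real.exp (3 - β))))) →
        (PottsField.globalMinimizers β α).ncard = 2) ∧
      (α ∉ PottsField.orbit (PottsField.axisSegment (-(1 / 2))
          (-((1 - (β - 2) * Real.exp (3 - β)) / (2 + (β - 2) * Real.exp (3 - β))))) →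
        (PottsField.globalMinimizers β α).ncard = 1)) ∧
    -- segments up to the triple point `τ`, and curves starting there; the image of `τ` in
    -- the closed fundamental cell is `τ ∘ Equiv.swap 0 2`
    (18 / 7 < β → β < 4 * Real.log 2 →
      ∃ τ ∈ PottsField.fields, PottsField.xCoord τ = 0 ∧ PottsField.yCoord τ < 0 ∧
      ∃ (I : Set ℝ) (v : ℝ → ℝ),
        PottsField.IsMaximalMaxwellSolution β
          (PottsField.uCoord (τ ∘ Equiv.swap 0 2)) (PottsField.vCoord (τ ∘ Equiv.swap 0 2)) I v ∧
        ∀ α ∈ PottsField.fields,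
          (α ∈ PottsField.orbit {τ} → (PottsField.globalMinimizers β α).ncard = 3) ∧
          (α ∈ PottsField.orbit (PottsField.axisSegment (-(1 / 2)) (PottsField.yCoord τ)) ∪
              PottsField.orbit
                (PottsField.maxwellCurve (PottsField.uCoord (τ ∘ Equiv.swap 0 2)) I v) →
            (PottsField.globalMinimizers β α).ncard = 2) ∧
          (α ∉ PottsField.orbit {τ} →
            α ∉ PottsField.orbit (PottsField.axisSegment (-(1 / 2)) (PottsField.yCoord τ)) ∪
              PottsField.orbit
                (PottsField.maxwellCurve (PottsField.uCoord (τ ∘ Equiv.swap 0 2)) I v) →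
            (PottsField.globalMinimizers β α).ncard = 1)) ∧
    -- at and beyond the Ellis-Wang point
    (4 * Real.log 2 ≤ β →
      (β = 4 * Real.log 2 → (PottsField.globalMinimizers β (fun _ => 1 / 3)).ncard = 4) ∧
      (4 * Real.log 2 < β → (PottsField.globalMinimizers β (fun _ => 1 / 3)).ncard = 3) ∧
      ∀ α ∈ PottsField.fields,
        (α ∈ PottsField.orbit (PottsField.axisSegment (-(1 / 2)) 0) →
          (PottsField.globalMinimizers β α).ncard = 2) ∧
        (α ∉ PottsField.orbit (PottsField.axisSegment (-(1 / 2)) 0) → α ≠ (fun _ => 1 / 3) →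
          (PottsField.globalMinimizers β α).ncard = 1)) := by
  open PottsField in
  refine ⟨fun h2 α hα => ?_, fun h2 h18 α hα => ?_, fun h18 h4 => ?_, fun h4 => ⟨?_, ?_, ?_⟩⟩
  · obtain ⟨σ, u, v, huv, hv, he⟩ := exists_comp_perm_eq_fieldOfUV hα
    rw [← ncard_globalMinimizers_comp_perm α σ, he]
    exact ncard_of_le_two hβ h2 huv hv
  · obtain ⟨σ, u, v, huv, hv, he⟩ := exists_comp_perm_eq_fieldOfUV hα
    have hpos : 0 < β - 2 := by linarith
    have hexp : (β - 2) * Real.exp (3 - β) = Real.exp (ell (β - 2) + 1) := by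
      rw [ell, show Real.log (β - 2) - (β - 2) + 1 = Real.log (β - 2) + (3 - β) by ring,
        Real.exp_add, Real.exp_log hpos]
    rw [← ncard_globalMinimizers_comp_perm α σ, he, hexp,
      mem_orbit_axisSegment_iff (by linarith [ell_le_neg_one hpos]) huv hv he]
    exact ncard_of_le h2 h18 huv hv
  · obtain ⟨u₀, hu₀, hco, ⟨x, hx, hx1⟩, ⟨y, hy, hy1⟩, hord, hdis⟩ := exists_triple_point h18 h4
    have hinv : (fieldOfUV u₀ 0 ∘ Equiv.swap 0 2) ∘ Equiv.swap 0 2 = fieldOfUV u₀ 0 := by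
      funext i
      simp
    refine ⟨fieldOfUV u₀ 0 ∘ Equiv.swap 0 2, comp_perm_mem_fields (fieldOfUV_mem_fields _ _) _,
      xCoord_comp_swap.2 rfl, ?_, coexistDomain β, coexistCurve β, ?_, fun α hα => ?_⟩
    · rw [yCoord_axis, neg_lt_zero]
      exact div_pos (by linarith [Real.exp_lt_one_iff.2 hu₀]) (by positivity)
    · rw [hinv, uCoord_fieldOfUV, vCoord_fieldOfUV]
      exact isMaximalMaxwellSolution_coexistCurve hβ hu₀ hco hdis
    · obtain ⟨σ, u, v, huv, hv, he⟩ := exists_comp_perm_eq_fieldOfUV hα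
      rw [hinv, uCoord_fieldOfUV, coexist_or_axis_iff hβ hu₀ huv hv he,
        mem_orbit_triple_iff hu₀ huv hv he, ← ncard_globalMinimizers_comp_perm α σ, he]
      refine ⟨?_, fun h => ?_, fun hne => ?_⟩
      · rintro ⟨rfl, rfl⟩
        exact ncard_axis_of_coexist hβ hu₀ hx hy hx1 hy1
      · refine (ncard_of_ne_triple hβ hu₀ hco hord hdis huv hv ?_).1 h
        rintro ⟨rfl, rfl⟩
        rcases h with ⟨-, h⟩ | ⟨-, h⟩
        exacts [h.false, h rfl]
      · exact (ncard_of_ne_triple hβ hu₀ hco hord hdis huv hv hne).2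
  · rintro rfl
    rw [← fieldOfUV_zero]
    obtain ⟨ν, hν, h1⟩ := exists_one_lt_of_four_log_two_le le_rfl
    exact ncard_zero_of_coexist hβ hν h1 center_mem_groundStates_four_log_two
  · intro h
    rw [← fieldOfUV_zero]
    refine ncard_zero_of_one_lt hβ (not_coexist_of_forall hβ fun ν hν => ?_)
      (exists_one_lt_of_four_log_two_le h4)
    have h1 := one_lt_of_four_log_two_lt h hν
    exact ⟨h1, mul_apply_zero_lt hβ le_rfl hν h1⟩
  · intro α hα
    obtain ⟨σ, u, v, huv, hv, he⟩ := exists_comp_perm_eq_fieldOfUV hα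
    have hseg := mem_orbit_axisSegment_iff le_rfl huv hv he
    rw [Real.exp_zero, sub_self, zero_div, neg_zero] at hseg
    rw [hseg, ← ncard_globalMinimizers_comp_perm α σ, he, Ne, comp_eq_fieldOfUV_zero_iff he]
    refine ⟨fun h => (ncard_of_four_log_two_le h4 h.2 huv hv).1 h.1, fun h1 h2 => ?_⟩
    have hu : u < 0 := by
      refine lt_of_le_of_ne (huv.trans hv) fun hu => h2 ⟨hu, ?_⟩
      linarith
    exact (ncard_of_four_log_two_le h4 hu huv hv).2 fun h => h1 ⟨h, hu⟩
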